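/- **Definitions.** For morphisms $\phi:X\to Y$, $\phi':X'\to Y'$ of a category and isomorphisms $\sigma:X\cong X'$, $\sigma':Y\cong Y'$ with $\phi'=\sigma'\phi\sigma^{-1}$, write $(\sigma\Downarrow\sigma'):\phi\to\phi'$ for the corresponding isomorphism of the arrow category. *$\mathcal C^{\boxtimes+}$.* For a category $\mathcal C$, $\mathcal C^{\boxtimes+}$ is the strict monoidal category (respectively, in its symmetric version, the strict symmetric monoidal category) whose objects are words $\phi_1\boxtimes\dots\boxtimes\phi_n$ of morphisms of $\mathcal C$, generated by the isomorphisms $(\sigma\Downarrow\sigma')$ and by $\gamma_{\phi_1,\phi_0}:\phi_1\boxtimes\phi_0\to\phi_1\circ\phi_0$ for composable $(\phi_1,\phi_0)$, subject to: functoriality of $(\sigma\Downarrow\sigma')$; inner equivariance $\gamma_{\phi_1\sigma^{-1},\sigma\phi_0}\circ((\sigma\Downarrow\mathrm{id})\boxtimes(\mathrm{id}\Downarrow\sigma))=\gamma_{\phi_1,\phi_0}$; outer equivariance $\gamma_{\sigma'\phi_1,\phi_0\sigma^{-1}}\circ((\mathrm{id}\Downarrow\sigma')\boxtimes(\sigma\Downarrow\mathrm{id}))=(\sigma\Downarrow\sigma')\circ\gamma_{\phi_1,\phi_0}$;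 associativity $\gamma_{\phi_2\phi_1,\phi_0}\circ(\gamma_{\phi_2,\phi_1}\boxtimes\mathrm{id})=\gamma_{\phi_2,\phi_1\phi_0}\circ(\mathrm{id}\boxtimes\gamma_{\phi_1,\phi_0})$. *$\mathcal M^{nc+}$.* For a monoidal category $\mathcal M$, $\mathcal M^{nc+}$ is the strict symmetric monoidal category with product $\boxtimes$ obtained from the symmetric version of $\mathcal M^{\boxtimes+}$ by adjoining generators $\mu_{\phi_1,\phi_2}:\phi_1\boxtimes\phi_2\to\phi_1\otimes\phi_2$ subject to: equivariance $\mu\circ((\sigma_1\Downarrow\sigma_1')\boxtimes(\sigma_2\Downarrow\sigma_2'))=(\sigma_1\otimes\sigma_2\Downarrow\sigma_1'\otimes\sigma_2')\circ\mu$; associativity of $\mu$ (up to the isomorphism $(A\Downarrow A)$ given by the associators $A$ of $\mathcal M$); interchange $\gamma_{\phi_0\otimes\psi_0,\phi_1\otimes\psi_1}\circ(\mu_{\phi_0,\psi_0}\boxtimes\mu_{\phi_1,\psi_1})=\mu_{\phi_0\phi_1,\psi_0\psi_1}\circ(\gamma_{\phi_0,\phi_1}\boxtimes\gamma_{\psi_0,\psi_1})\circ\tau_{23}$,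 where $\tau_{23}$ is the symmetry of the two middle factors. If $\mathcal M$ is symmetric, with commutators $C$, one imposes in addition $(C\Downarrow C)\circ\mu_{\phi_1,\phi_2}=\mu_{\phi_2,\phi_1}\circ\tau_{12}$, with $\tau_{12}$ the symmetry of $\boxtimes$. *$\mathcal M^{loc+}$* is obtained from $\mathcal M^{nc+}$ by adjoining generators $\mu^{-1}_{\phi_1,\phi_2}:\phi_1\otimes\phi_2\to\phi_1\boxtimes\phi_2$ inverse to the $\mu_{\phi_1,\phi_2}$. *$\mathcal M^+$* is the monoidal (symmetric monoidal, if $\mathcal M$ is symmetric) category whose objects are the morphisms of $\mathcal M$, with product $\otimes$, generated by the monoidal groupoid of isomorphisms $(\sigma\Downarrow\sigma')$ of the arrow category of $\mathcal M$ (with its constraints, including commutators in the symmetric case) and by $\bar\gamma_{\phi_1,\phi_0}:\phi_1\otimes\phi_0\to\phi_1\circ\phi_0$, subject to equivariance and associativity as for $\gamma$, with $\boxtimes$ replaced by $\otimes$. In the symmetric case there is a second version, in which the interchange relation $\bar\gamma_{\phi_0\otimes\psi_0,\phi_1\otimes\psi_1}=(\bar\gamma_{\phi_0,\phi_1}\otimes\bar\gamma_{\psi_0,\psi_1})\circ\tau_{23}$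 is imposed as well; the theorem holds for both. **Theorem.** (1) *Functoriality.* Let $P$ be one of the constructions $nc+$, $loc+$, $+$. A strong monoidal functor $F:\mathcal M\to\mathcal M'$ with structure isomorphisms $f_{X,Y}:F(X)\otimes F(Y)\to F(X\otimes Y)$ induces a strong monoidal functor $F^P:\mathcal M^P\to(\mathcal M')^P$ such that $F^P(\phi)=F(\phi)$ for morphisms $\phi$ of $\mathcal M$, $F^P(\sigma\Downarrow\sigma')=(F\sigma\Downarrow F\sigma')$, and the following holds. For $P=nc+$ and $P=loc+$, $F^P$ is strict and symmetric, with $F^P(\gamma_{\phi_1,\phi_0})=\gamma_{F\phi_1,F\phi_0}$ and $F^P(\mu_{\phi_1,\phi_2})=(f_{X_1,X_2}\Downarrow f_{Y_1,Y_2})\circ\mu_{F\phi_1,F\phi_2}$ for $\phi_i:X_i\to Y_i$. For $P=+$, the structure isomorphism $F\phi_1\otimes F\phi_2\to F(\phi_1\otimes\phi_2)$ of $F^+$ is $(f_{X_1,X_2}\Downarrow f_{Y_1,Y_2})$, and $F^+(\bar\gamma_{\phi_1,\phi_0})$ is the inverse of this structure isomorphism followed by $\bar\gamma_{F\phi_1,F\phi_0}$.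 A monoidal natural isomorphism $\alpha:F\Rightarrow G$ induces a monoidal natural isomorphism $\alpha^P:F^P\Rightarrow G^P$ with $\alpha^P_\phi=(\alpha_{s(\phi)}\Downarrow\alpha_{t(\phi)})$ on morphisms $\phi$ of $\mathcal M$ with source $s(\phi)$ and target $t(\phi)$. These assignments preserve identity functors and composition of functors strictly, identities and vertical composition of natural isomorphisms, and their whiskering with functors. In particular $P$ is an endofunctor of the category of small monoidal categories and strong monoidal functors. The same holds with symmetric monoidal categories and strong symmetric monoidal functors throughout, so that $P$ is then an endofunctor of symmetric monoidal categories. In the same way $\mathcal C\mapsto\mathcal C^{\boxtimes+}$, with arbitrary functors and natural isomorphisms and with values strict monoidal functors and monoidal natural isomorphisms, is a functor from categories to monoidal categories and, in its symmetric version, to symmetric monoidal categories. (2) *Equivalences.* If the monoidal categories $\mathcal M$ and $\mathcal M'$ are monoidally equivalent, then $\mathcal M^{nc+}\simeq(\mathcal M')^{nc+}$ and $\mathcal M^{loc+}\simeq(\mathcal M')^{loc+}$ as symmetric monoidal categories and $\mathcal M^+\simeq(\mathcal M')^+$ as monoidal categories. If the symmetric monoidal categories $\mathcal M$ and $\mathcal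 M'$ are equivalent as such, then so are $\mathcal M^{nc+}$ and $(\mathcal M')^{nc+}$, $\mathcal M^{loc+}$ and $(\mathcal M')^{loc+}$, and $\mathcal M^+$ and $(\mathcal M')^+$. If $\mathcal C$ and $\mathcal C'$ are equivalent categories, then $\mathcal C^{\boxtimes+}$ and $(\mathcal C')^{\boxtimes+}$ are monoidally equivalent, and their symmetric versions are symmetric monoidally equivalent. -/

import Mathlib

open CategoryTheory MonoidalCategory

set_option linter.checkUnivs false

universe w₁ w₂ v u v₁ u₁ v₂ u₂ v₃ u₃

namespace PlusConstruction

/-! ### Strong monoidal functors and monoidal natural transformations -/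

section MonoidalFunctors

/-- A bundled strong monoidal functor. -/
structure MonFunctor (C : Type u₁) [Category.{v₁} C] [MonoidalCategory C]
    (D : Type u₂) [Category.{v₂} D] [MonoidalCategory D] extends C ⥤ D where
  [monoidal : toFunctor.Monoidal]

attribute [instance] MonFunctor.monoidal

variable {C : Type u₁} [Category.{v₁} C] [MonoidalCategory C]
  {D : Type u₂} [Category.{v₂} D] [MonoidalCategory D]
  {E : Type u₃} [Category.{v₃} E] [MonoidalCategory E]

/-- A monoidal natural transformation between strong monoidal functors. -/
@[ext]
structure MonTrans (F G : MonFunctor C D) where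
  hom : F.toFunctor ⟶ G.toFunctor
  isMonoidal : NatTrans.IsMonoidal hom

attribute [instance] MonTrans.isMonoidal

/-- Strong monoidal functors and monoidal natural transformations form a category; its isomorphisms
are the monoidal natural isomorphisms. -/
instance : Category (MonFunctor C D) where
  Hom := MonTrans
  id F := ⟨𝟙 F.toFunctor, inferInstance⟩
  comp α β := ⟨α.hom ≫ β.hom, inferInstance⟩
  id_comp α := MonTrans.ext (Category.id_comp α.hom)
  comp_id α := MonTrans.ext (Category.comp_id α.hom)
  assoc α β κ := MonTrans.ext (Category.assoc α.hom β.hom κ.hom)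

theorem MonTrans.ext_hom {F G : MonFunctor C D} {α β : F ⟶ G} (h : α.hom = β.hom) : α = β :=
  MonTrans.ext h

/-- The natural isomorphism underlying a monoidal natural isomorphism. -/
def MonFunctor.natIso {F G : MonFunctor C D} (α : F ≅ G) : F.toFunctor ≅ G.toFunctor where
  hom := α.hom.hom
  inv := α.inv.hom
  hom_inv_id := congrArg MonTrans.hom α.hom_inv_id
  inv_hom_id := congrArg MonTrans.hom α.inv_hom_id

/-- A natural isomorphism with monoidal underlying transformation, as an isomorphism of strong
monoidal functors. -/
def MonFunctor.isoMk {F G : MonFunctor C D} (e : F.toFunctor ≅ G.toFunctor)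
    (_ : NatTrans.IsMonoidal e.hom) : F ≅ G where
  hom := ⟨e.hom, inferInstance⟩
  inv := ⟨e.inv, inferInstance⟩
  hom_inv_id := MonTrans.ext e.hom_inv_id
  inv_hom_id := MonTrans.ext e.inv_hom_id

/-- The identity functor, as a strong monoidal functor. -/
def MonFunctor.id (C : Type u₁) [Category.{v₁} C] [MonoidalCategory C] : MonFunctor C C where
  toFunctor := 𝟭 C

/-- Composition of strong monoidal functors. -/
def MonFunctor.comp (F : MonFunctor C D) (G : MonFunctor D E) : MonFunctor C E where
  toFunctor := F.toFunctor ⋙ G.toFunctor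

/-- A strong monoidal functor between symmetric monoidal categories is symmetric if it respects the
commutativity constraints. -/
def MonFunctor.IsSymmetric [SymmetricCategory C] [SymmetricCategory D] (F : MonFunctor C D) :
    Prop :=
  ∀ X Y : C, Functor.LaxMonoidal.μ F.toFunctor X Y ≫ F.map (β_ X Y).hom =
    (β_ (F.obj X) (F.obj Y)).hom ≫ Functor.LaxMonoidal.μ F.toFunctor Y X

/-- A monoidal functor is strict if its structure morphisms are identities. -/
structure MonFunctor.IsStrict (F : MonFunctor C D) : Prop where
  obj_unit : 𝟙_ D = F.obj (𝟙_ C)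
  obj_tensor : ∀ X Y : C, F.obj X ⊗ F.obj Y = F.obj (X ⊗ Y)
  ε_eq : Functor.LaxMonoidal.ε F.toFunctor = eqToHom obj_unit
  μ_eq : ∀ X Y : C, Functor.LaxMonoidal.μ F.toFunctor X Y = eqToHom (obj_tensor X Y)

/-- Monoidal equivalence of monoidal categories. -/
def MonEquivalent (C : Type u₁) [Category.{v₁} C] [MonoidalCategory C]
    (D : Type u₂) [Category.{v₂} D] [MonoidalCategory D] : Prop :=
  ∃ (F : MonFunctor C D) (G : MonFunctor D C),
    Nonempty (F.comp G ≅ MonFunctor.id C) ∧ Nonempty (G.comp F ≅ MonFunctor.id D)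

/-- Symmetric monoidal equivalence of symmetric monoidal categories. -/
def SymMonEquivalent (C : Type u₁) [Category.{v₁} C] [MonoidalCategory C] [SymmetricCategory C]
    (D : Type u₂) [Category.{v₂} D] [MonoidalCategory D] [SymmetricCategory D] : Prop :=
  ∃ (F : MonFunctor C D) (G : MonFunctor D C), F.IsSymmetric ∧ G.IsSymmetric ∧
    Nonempty (F.comp G ≅ MonFunctor.id C) ∧ Nonempty (G.comp F ≅ MonFunctor.id D)

end MonoidalFunctors

/-! ### The 2-categories of monoidal and of symmetric monoidal categories -/

/-- Bundled monoidal categories. -/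
structure MonoidalCat where
  carrier : Type u
  [category : Category.{v} carrier]
  [monoidal : MonoidalCategory carrier]

instance : CoeSort MonoidalCat.{v, u} (Type u) := ⟨MonoidalCat.carrier⟩

attribute [instance] MonoidalCat.category MonoidalCat.monoidal

/-- Bundled symmetric monoidal categories. -/
structure SymMonoidalCat extends MonoidalCat.{v, u} where
  [symmetric : SymmetricCategory carrier]

instance : CoeSort SymMonoidalCat.{v, u} (Type u) := ⟨fun M => M.carrier⟩

attribute [instance] SymMonoidalCat.symmetric

/-- Strong symmetric monoidal functors. -/
structure SymMonFunctor (M N : SymMonoidalCat.{v, u}) extends MonFunctor M N where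
  isSymmetric : toMonFunctor.IsSymmetric

instance (M N : SymMonoidalCat.{v, u}) : Category (SymMonFunctor M N) where
  Hom F G := F.toMonFunctor ⟶ G.toMonFunctor
  id F := 𝟙 F.toMonFunctor
  comp α β := CategoryStruct.comp (obj := MonFunctor M N) α β
  id_comp α := Category.id_comp (obj := MonFunctor M N) α
  comp_id α := Category.comp_id (obj := MonFunctor M N) α
  assoc α β κ := Category.assoc (obj := MonFunctor M N) α β κ

/-- The monoidal natural isomorphism underlying an isomorphism of strong symmetric monoidal
functors. -/
def SymMonFunctor.monIso {M N : SymMonoidalCat.{v, u}} {F G : SymMonFunctor M N} (α : F ≅ G) :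
    F.toMonFunctor ≅ G.toMonFunctor := ⟨α.hom, α.inv, α.hom_inv_id, α.inv_hom_id⟩

def SymMonFunctor.isoMk {M N : SymMonoidalCat.{v, u}} {F G : SymMonFunctor M N}
    (α : F.toMonFunctor ≅ G.toMonFunctor) : F ≅ G := ⟨α.hom, α.inv, α.hom_inv_id, α.inv_hom_id⟩

theorem MonTrans.ext_app {C : Type u₁} [Category.{v₁} C] [MonoidalCategory C]
    {D : Type u₂} [Category.{v₂} D] [MonoidalCategory D] {F G : MonFunctor C D} {α β : F ⟶ G}
    (h : ∀ X, α.hom.app X = β.hom.app X) : α = β :=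
  MonTrans.ext (NatTrans.ext (funext h))

/-- Monoidal categories, strong monoidal functors and monoidal natural transformations. -/
instance : Bicategory MonoidalCat.{v, u} where
  Hom M N := MonFunctor M N
  id M := MonFunctor.id M
  comp F G := F.comp G
  homCategory _ _ := inferInstance
  whiskerLeft F _ _ η := ⟨Functor.whiskerLeft F.toFunctor η.hom, NatTrans.IsMonoidal.whiskerLeft _⟩
  whiskerRight η H := ⟨Functor.whiskerRight η.hom H.toFunctor, NatTrans.IsMonoidal.whiskerRight _⟩
  associator F G H := MonFunctor.isoMk
    (F := (F.comp G).comp H) (G := F.comp (G.comp H))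
    (Functor.associator F.toFunctor G.toFunctor H.toFunctor)
    (inferInstanceAs (NatTrans.IsMonoidal
      (Functor.associator F.toFunctor G.toFunctor H.toFunctor).hom))
  leftUnitor F := MonFunctor.isoMk (F := (MonFunctor.id _).comp F) F.toFunctor.leftUnitor
    (inferInstanceAs (NatTrans.IsMonoidal F.toFunctor.leftUnitor.hom))
  rightUnitor F := MonFunctor.isoMk (F := F.comp (MonFunctor.id _)) F.toFunctor.rightUnitor
    (inferInstanceAs (NatTrans.IsMonoidal F.toFunctor.rightUnitor.hom))
  whiskerLeft_id _ _ := MonTrans.ext_app fun _ => rfl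
  whiskerLeft_comp _ _ _ _ _ _ := MonTrans.ext_app fun _ => rfl
  id_whiskerLeft η := MonTrans.ext_app fun X =>
    show η.hom.app X = 𝟙 _ ≫ η.hom.app X ≫ 𝟙 _ by simp
  comp_whiskerLeft F G _ _ η := MonTrans.ext_app fun X =>
    show η.hom.app (G.obj (F.obj X)) = 𝟙 _ ≫ η.hom.app (G.obj (F.obj X)) ≫ 𝟙 _ by simp
  id_whiskerRight _ G := MonTrans.ext_app fun _ => G.map_id _
  comp_whiskerRight _ _ G := MonTrans.ext_app fun _ => G.map_comp _ _
  whiskerRight_id η := MonTrans.ext_app fun X =>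
    show η.hom.app X = 𝟙 _ ≫ η.hom.app X ≫ 𝟙 _ by simp
  whiskerRight_comp η G H := MonTrans.ext_app fun X =>
    show H.map (G.map (η.hom.app X)) = 𝟙 _ ≫ H.map (G.map (η.hom.app X)) ≫ 𝟙 _ by simp
  whisker_assoc F _ _ η H := MonTrans.ext_app fun X =>
    show H.map (η.hom.app (F.obj X)) = 𝟙 _ ≫ H.map (η.hom.app (F.obj X)) ≫ 𝟙 _ by simp
  whisker_exchange η θ := MonTrans.ext_app fun X => (θ.hom.naturality (η.hom.app X)).symm
  pentagon F G H I := MonTrans.ext_app fun X =>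
    show I.map (𝟙 _) ≫ 𝟙 _ ≫ 𝟙 _ = 𝟙 _ ≫ 𝟙 _ by simp
  triangle F G := MonTrans.ext_app fun X =>
    show 𝟙 _ ≫ 𝟙 _ = G.map (𝟙 _) by simp

/-- Symmetric monoidal categories, strong symmetric monoidal functors and monoidal natural
transformations. -/
instance : Bicategory SymMonoidalCat.{v, u} where
  Hom M N := SymMonFunctor M N
  id M := ⟨MonFunctor.id M, fun _ _ => by
    show 𝟙 _ ≫ (β_ _ _).hom = (β_ _ _).hom ≫ 𝟙 _
    rw [Category.id_comp, Category.comp_id]⟩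
  comp F G := ⟨F.toMonFunctor.comp G.toMonFunctor, fun X Y => by
    have hF := F.isSymmetric X Y
    have hG := G.isSymmetric (F.obj X) (F.obj Y)
    show (Functor.LaxMonoidal.μ G.toFunctor _ _ ≫ G.map (Functor.LaxMonoidal.μ F.toFunctor X Y)) ≫
      G.map (F.map (β_ X Y).hom) = (β_ (G.obj (F.obj X)) (G.obj (F.obj Y))).hom ≫
      Functor.LaxMonoidal.μ G.toFunctor _ _ ≫ G.map (Functor.LaxMonoidal.μ F.toFunctor Y X)
    rw [Category.assoc, ← Functor.map_comp, hF, Functor.map_comp, reassoc_of% hG]⟩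
  homCategory _ _ := inferInstance
  whiskerLeft F _ _ η := Bicategory.whiskerLeft (B := MonoidalCat) F.toMonFunctor η
  whiskerRight η H := Bicategory.whiskerRight (B := MonoidalCat) η H.toMonFunctor
  associator F G H := SymMonFunctor.isoMk
    (Bicategory.associator (B := MonoidalCat) F.toMonFunctor G.toMonFunctor H.toMonFunctor)
  leftUnitor F := SymMonFunctor.isoMk (Bicategory.leftUnitor (B := MonoidalCat) F.toMonFunctor)
  rightUnitor F := SymMonFunctor.isoMk (Bicategory.rightUnitor (B := MonoidalCat) F.toMonFunctor)
  whiskerLeft_id F G :=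
    Bicategory.whiskerLeft_id (B := MonoidalCat) F.toMonFunctor G.toMonFunctor
  whiskerLeft_comp F _ _ _ η θ :=
    Bicategory.whiskerLeft_comp (B := MonoidalCat) F.toMonFunctor η θ
  id_whiskerLeft η := Bicategory.id_whiskerLeft (B := MonoidalCat) η
  comp_whiskerLeft F G _ _ η :=
    Bicategory.comp_whiskerLeft (B := MonoidalCat) F.toMonFunctor G.toMonFunctor η
  id_whiskerRight F G :=
    Bicategory.id_whiskerRight (B := MonoidalCat) F.toMonFunctor G.toMonFunctor
  comp_whiskerRight η θ G :=
    Bicategory.comp_whiskerRight (B := MonoidalCat) η θ G.toMonFunctor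
  whiskerRight_id η := Bicategory.whiskerRight_id (B := MonoidalCat) η
  whiskerRight_comp η G H :=
    Bicategory.whiskerRight_comp (B := MonoidalCat) η G.toMonFunctor H.toMonFunctor
  whisker_assoc F _ _ η H :=
    Bicategory.whisker_assoc (B := MonoidalCat) F.toMonFunctor η H.toMonFunctor
  whisker_exchange η θ := Bicategory.whisker_exchange (B := MonoidalCat) η θ
  pentagon F G H I := Bicategory.pentagon (B := MonoidalCat) F.toMonFunctor G.toMonFunctor
    H.toMonFunctor I.toMonFunctor
  triangle F G := Bicategory.triangle (B := MonoidalCat) F.toMonFunctor G.toMonFunctor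

/-- A strict 2-functor, on invertible 2-cells, whose effect on objects is the given map `obj`: it
preserves identities and composition of 1-cells on the nose, and vertical and horizontal
composition of invertible 2-cells. -/
structure TwoFunctor {A : Type u₁} {B : Type u₂} [Bicategory.{w₁, v₁} A] [Bicategory.{w₂, v₂} B]
    (obj : A → B) where
  map {M N : A} : (M ⟶ N) → (obj M ⟶ obj N)
  map₂ {M N : A} {F G : M ⟶ N} : (F ≅ G) → (map F ≅ map G)
  map_id (M : A) : map (𝟙 M) = 𝟙 (obj M)
  map_comp {M N K : A} (F : M ⟶ N) (G : N ⟶ K) : map (F ≫ G) = map F ≫ map G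
  map₂_refl {M N : A} (F : M ⟶ N) : map₂ (Iso.refl F) = Iso.refl (map F)
  map₂_trans {M N : A} {F G H : M ⟶ N} (α : F ≅ G) (β : G ≅ H) :
    map₂ (α ≪≫ β) = map₂ α ≪≫ map₂ β
  map₂_whiskerLeft {M N K : A} (F : M ⟶ N) {G H : N ⟶ K} (α : G ≅ H) :
    map₂ (Bicategory.whiskerLeftIso F α) =
      eqToIso (map_comp F G) ≪≫ Bicategory.whiskerLeftIso (map F) (map₂ α) ≪≫
        eqToIso (map_comp F H).symm
  map₂_whiskerRight {M N K : A} {F G : M ⟶ N} (α : F ≅ G) (H : N ⟶ K) :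
    map₂ (Bicategory.whiskerRightIso α H) =
      eqToIso (map_comp F H) ≪≫ Bicategory.whiskerRightIso (map₂ α) (map H) ≪≫
        eqToIso (map_comp G H).symm

/-! ### (Symmetric) monoidal categories given by generators and relations -/

/-- Objects with a unit and a product, and a family of generating morphisms. The proposition `symm`
says whether a symmetric monoidal category is generated (otherwise a monoidal one). -/
structure Signature where
  Obj : Type u
  unit : Obj
  tensor : Obj → Obj → Obj
  symm : Prop
  Gen : Obj → Obj → Type u

/-- Formal composites and tensor products of generators, identities and structural morphisms. -/
inductive Signature.Word (S : Signature.{u}) : S.Obj → S.Obj → Type u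
  | gen {X Y : S.Obj} (g : S.Gen X Y) : S.Word X Y
  | ident (X : S.Obj) : S.Word X X
  | comp {X Y Z : S.Obj} (f : S.Word X Y) (g : S.Word Y Z) : S.Word X Z
  | tensor {X Y X' Y' : S.Obj} (f : S.Word X Y) (g : S.Word X' Y') :
      S.Word (S.tensor X X') (S.tensor Y Y')
  | assocHom (X Y Z : S.Obj) :
      S.Word (S.tensor (S.tensor X Y) Z) (S.tensor X (S.tensor Y Z))
  | assocInv (X Y Z : S.Obj) :
      S.Word (S.tensor X (S.tensor Y Z)) (S.tensor (S.tensor X Y) Z)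
  | leftUnitHom (X : S.Obj) : S.Word (S.tensor S.unit X) X
  | leftUnitInv (X : S.Obj) : S.Word X (S.tensor S.unit X)
  | rightUnitHom (X : S.Obj) : S.Word (S.tensor X S.unit) X
  | rightUnitInv (X : S.Obj) : S.Word X (S.tensor X S.unit)
  | braid (h : S.symm) (X Y : S.Obj) : S.Word (S.tensor X Y) (S.tensor Y X)

/-- The identity of `X`, regarded as a morphism between equal objects. -/
def Signature.Word.eqTo {S : Signature.{u}} {X Y : S.Obj} (h : X = Y) : S.Word X Y :=
  h ▸ Signature.Word.ident X

/-- The symmetry exchanging the two middle factors of a fourfold product. -/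
def Signature.Word.middleSwap {S : Signature.{u}} (h : S.symm) (X₁ X₂ Y₁ Y₂ : S.Obj) :
    S.Word (S.tensor (S.tensor X₁ X₂) (S.tensor Y₁ Y₂))
      (S.tensor (S.tensor X₁ Y₁) (S.tensor X₂ Y₂)) :=
  .comp (.assocHom X₁ X₂ (S.tensor Y₁ Y₂))
    (.comp (.tensor (.ident X₁)
        (.comp (.assocInv X₂ Y₁ Y₂)
          (.comp (.tensor (.braid h X₂ Y₁) (.ident Y₂)) (.assocHom Y₁ X₂ Y₂))))
      (.assocInv X₁ Y₁ (S.tensor X₂ Y₂)))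

/-- A signature together with relations between words. -/
structure Presentation extends Signature.{u} where
  Rel : ∀ ⦃X Y : Obj⦄, toSignature.Word X Y → toSignature.Word X Y → Prop

open Signature.Word in
/-- The congruence generated by the axioms of a (symmetric) monoidal category and the relations of
the presentation. -/
inductive Presentation.Eqv (P : Presentation.{u}) :
    ∀ {X Y : P.Obj}, P.Word X Y → P.Word X Y → Prop
  | of {X Y : P.Obj} {f g : P.Word X Y} (h : P.Rel f g) : P.Eqv f g
  | refl {X Y : P.Obj} (f : P.Word X Y) : P.Eqv f f
  | symm {X Y : P.Obj} {f g : P.Word X Y} (h : P.Eqv f g) : P.Eqv g f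
  | trans {X Y : P.Obj} {f g h : P.Word X Y} (hfg : P.Eqv f g) (hgh : P.Eqv g h) : P.Eqv f h
  | comp_congr {X Y Z : P.Obj} {f f' : P.Word X Y} {g g' : P.Word Y Z} (hf : P.Eqv f f')
      (hg : P.Eqv g g') : P.Eqv (comp f g) (comp f' g')
  | tensor_congr {X Y X' Y' : P.Obj} {f f' : P.Word X Y} {g g' : P.Word X' Y'} (hf : P.Eqv f f')
      (hg : P.Eqv g g') : P.Eqv (tensor f g) (tensor f' g')
  | id_comp {X Y : P.Obj} (f : P.Word X Y) : P.Eqv (comp (ident X) f) f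
  | comp_id {X Y : P.Obj} (f : P.Word X Y) : P.Eqv (comp f (ident Y)) f
  | assoc {X Y Z W : P.Obj} (f : P.Word X Y) (g : P.Word Y Z) (h : P.Word Z W) :
      P.Eqv (comp (comp f g) h) (comp f (comp g h))
  | tensor_id (X Y : P.Obj) : P.Eqv (tensor (ident X) (ident Y)) (ident (P.tensor X Y))
  | interchange {X Y Z X' Y' Z' : P.Obj} (f : P.Word X Y) (f' : P.Word X' Y') (g : P.Word Y Z)
      (g' : P.Word Y' Z') :
      P.Eqv (comp (tensor f f') (tensor g g')) (tensor (comp f g) (comp f' g'))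
  | assoc_hom_inv (X Y Z : P.Obj) : P.Eqv (comp (assocHom X Y Z) (assocInv X Y Z)) (ident _)
  | assoc_inv_hom (X Y Z : P.Obj) : P.Eqv (comp (assocInv X Y Z) (assocHom X Y Z)) (ident _)
  | assoc_natural {X Y Z X' Y' Z' : P.Obj} (f : P.Word X X') (g : P.Word Y Y') (h : P.Word Z Z') :
      P.Eqv (comp (tensor (tensor f g) h) (assocHom X' Y' Z'))
        (comp (assocHom X Y Z) (tensor f (tensor g h)))
  | leftUnit_hom_inv (X : P.Obj) : P.Eqv (comp (leftUnitHom X) (leftUnitInv X)) (ident _)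
  | leftUnit_inv_hom (X : P.Obj) : P.Eqv (comp (leftUnitInv X) (leftUnitHom X)) (ident _)
  | leftUnit_natural {X Y : P.Obj} (f : P.Word X Y) :
      P.Eqv (comp (tensor (ident P.unit) f) (leftUnitHom Y)) (comp (leftUnitHom X) f)
  | rightUnit_hom_inv (X : P.Obj) : P.Eqv (comp (rightUnitHom X) (rightUnitInv X)) (ident _)
  | rightUnit_inv_hom (X : P.Obj) : P.Eqv (comp (rightUnitInv X) (rightUnitHom X)) (ident _)
  | rightUnit_natural {X Y : P.Obj} (f : P.Word X Y) :
      P.Eqv (comp (tensor f (ident P.unit)) (rightUnitHom Y)) (comp (rightUnitHom X) f)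
  | pentagon (W X Y Z : P.Obj) :
      P.Eqv (comp (tensor (assocHom W X Y) (ident Z))
          (comp (assocHom W (P.tensor X Y) Z) (tensor (ident W) (assocHom X Y Z))))
        (comp (assocHom (P.tensor W X) Y Z) (assocHom W X (P.tensor Y Z)))
  | triangle (X Y : P.Obj) :
      P.Eqv (comp (assocHom X P.unit Y) (tensor (ident X) (leftUnitHom Y)))
        (tensor (rightUnitHom X) (ident Y))
  | braid_braid (h : P.symm) (X Y : P.Obj) : P.Eqv (comp (braid h X Y) (braid h Y X)) (ident _)
  | braid_natural (h : P.symm) {X Y X' Y' : P.Obj} (f : P.Word X X') (g : P.Word Y Y') :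
      P.Eqv (comp (tensor f g) (braid h X' Y')) (comp (braid h X Y) (tensor g f))
  | hexagon (h : P.symm) (X Y Z : P.Obj) :
      P.Eqv (comp (assocHom X Y Z) (comp (braid h X (P.tensor Y Z)) (assocHom Y Z X)))
        (comp (tensor (braid h X Y) (ident Z))
          (comp (assocHom Y X Z) (tensor (ident Y) (braid h X Z))))
  | hexagon' (h : P.symm) (X Y Z : P.Obj) :
      P.Eqv (comp (assocInv X Y Z) (comp (braid h (P.tensor X Y) Z) (assocInv Z X Y)))
        (comp (tensor (ident X) (braid h Y Z))
          (comp (assocInv X Z Y) (tensor (braid h X Z) (ident Y))))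

namespace Presentation

/-- The (symmetric) monoidal category with the given generators and relations. -/
def Cat (P : Presentation.{u}) : Type u := P.Obj

variable (P : Presentation.{u})

/-- Words up to the congruence. -/
def homSetoid (X Y : P.Obj) : Setoid (P.Word X Y) where
  r f g := P.Eqv f g
  iseqv := ⟨Eqv.refl, Eqv.symm, Eqv.trans⟩

instance : Category.{u} P.Cat where
  Hom X Y := Quotient (P.homSetoid X Y)
  id X := Quotient.mk _ (Signature.Word.ident (S := P.toSignature) X)
  comp := Quotient.map₂ Signature.Word.comp fun _ _ hf _ _ hg => Eqv.comp_congr hf hg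
  id_comp := by rintro X Y ⟨f⟩; exact Quotient.sound (Eqv.id_comp f)
  comp_id := by rintro X Y ⟨f⟩; exact Quotient.sound (Eqv.comp_id f)
  assoc := by rintro W X Y Z ⟨f⟩ ⟨g⟩ ⟨h⟩; exact Quotient.sound (Eqv.assoc f g h)

variable {P} in
/-- The morphism represented by a word. -/
def hom {X Y : P.Obj} (f : P.Word X Y) : (show P.Cat from X) ⟶ (show P.Cat from Y) :=
  Quotient.mk _ f

/-- The product of morphisms. -/
def tensorMap {X Y X' Y' : P.Cat} :
    (X ⟶ Y) → (X' ⟶ Y') → ((show P.Cat from P.tensor X X') ⟶ (show P.Cat from P.tensor Y Y')) :=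
  Quotient.map₂ Signature.Word.tensor fun _ _ hf _ _ hg => Eqv.tensor_congr hf hg

instance : MonoidalCategoryStruct P.Cat where
  tensorObj X Y := P.tensor X Y
  tensorUnit := P.unit
  tensorHom f g := P.tensorMap f g
  whiskerLeft X _ _ f := P.tensorMap (𝟙 X) f
  whiskerRight f X := P.tensorMap f (𝟙 X)
  associator X Y Z := ⟨hom (.assocHom X Y Z), hom (.assocInv X Y Z),
    Quotient.sound (Eqv.assoc_hom_inv X Y Z), Quotient.sound (Eqv.assoc_inv_hom X Y Z)⟩
  leftUnitor X := ⟨hom (.leftUnitHom X), hom (.leftUnitInv X),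
    Quotient.sound (Eqv.leftUnit_hom_inv X), Quotient.sound (Eqv.leftUnit_inv_hom X)⟩
  rightUnitor X := ⟨hom (.rightUnitHom X), hom (.rightUnitInv X),
    Quotient.sound (Eqv.rightUnit_hom_inv X), Quotient.sound (Eqv.rightUnit_inv_hom X)⟩

instance : MonoidalCategory P.Cat := MonoidalCategory.ofTensorHom
  (id_tensorHom_id := fun X Y => Quotient.sound (Eqv.tensor_id X Y))
  (tensorHom_comp_tensorHom := by
    rintro _ _ _ _ _ _ ⟨f⟩ ⟨f'⟩ ⟨g⟩ ⟨g'⟩; exact Quotient.sound (Eqv.interchange f f' g g'))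
  (associator_naturality := by
    rintro _ _ _ _ _ _ ⟨f⟩ ⟨g⟩ ⟨h⟩; exact Quotient.sound (Eqv.assoc_natural f g h))
  (leftUnitor_naturality := by rintro _ _ ⟨f⟩; exact Quotient.sound (Eqv.leftUnit_natural f))
  (rightUnitor_naturality := by rintro _ _ ⟨f⟩; exact Quotient.sound (Eqv.rightUnit_natural f))
  (pentagon := fun W X Y Z => Quotient.sound (Eqv.pentagon W X Y Z))
  (triangle := fun X Y => Quotient.sound (Eqv.triangle X Y))

/-- The symmetric structure, if the presentation is one of a symmetric monoidal category. -/
@[reducible]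
def symmetricCategory (h : P.symm) : SymmetricCategory P.Cat where
  braiding X Y := ⟨hom (.braid h X Y), hom (.braid h Y X),
    Quotient.sound (Eqv.braid_braid h X Y), Quotient.sound (Eqv.braid_braid h Y X)⟩
  braiding_naturality_right := by
    rintro X _ _ ⟨f⟩; exact Quotient.sound (Eqv.braid_natural h (.ident X) f)
  braiding_naturality_left := by
    rintro _ _ ⟨f⟩ Z; exact Quotient.sound (Eqv.braid_natural h f (.ident Z))
  hexagon_forward X Y Z := Quotient.sound (Eqv.hexagon h X Y Z)
  hexagon_reverse X Y Z := Quotient.sound (Eqv.hexagon' h X Y Z)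
  symmetry X Y := Quotient.sound (Eqv.braid_braid h X Y)

end Presentation

/-! ### Morphisms as objects, and the relations of the plus constructions -/

section Arrows

variable {C : Type u} [Category.{v} C]

/-- The isomorphism `(σ ⇓ τ) : f ⟶ f'` of the arrow category, where `f' = τ ∘ f ∘ σ⁻¹`. -/
def cell {X Y X' Y' : C} {f : X ⟶ Y} {f' : X' ⟶ Y'} (σ : X ≅ X') (τ : Y ≅ Y')
    (h : σ.hom ≫ f' = f ≫ τ.hom := by simp) : Arrow.mk f ≅ Arrow.mk f' :=
  Arrow.isoMk' f f' σ τ h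

/-- The isomorphism given by identities between equal morphisms. -/
def cellEq {X Y : C} {f f' : X ⟶ Y} (h : f = f' := by simp) : Arrow.mk f ≅ Arrow.mk f' :=
  cell (Iso.refl X) (Iso.refl Y) (by simp [h])

variable [MonoidalCategory C]

/-- The monoidal product of two morphisms. -/
def arrowTensor (φ ψ : Arrow C) : Arrow C := Arrow.mk (φ.hom ⊗ₘ ψ.hom)

/-- The monoidal product `(σ ⊗ τ ⇓ σ' ⊗ τ')` of isomorphisms `(σ ⇓ σ')` and `(τ ⇓ τ')`. -/
def arrowTensorIso {φ φ' ψ ψ' : Arrow C} (e : φ ≅ φ') (e' : ψ ≅ ψ') :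
    arrowTensor φ ψ ≅ arrowTensor φ' ψ' :=
  cell (MonoidalCategory.tensorIso (Arrow.leftFunc.mapIso e) (Arrow.leftFunc.mapIso e'))
    (MonoidalCategory.tensorIso (Arrow.rightFunc.mapIso e) (Arrow.rightFunc.mapIso e'))
    (by
      show (e.hom.left ⊗ₘ e'.hom.left) ≫ (φ'.hom ⊗ₘ ψ'.hom) =
        (φ.hom ⊗ₘ ψ.hom) ≫ (e.hom.right ⊗ₘ e'.hom.right)
      rw [MonoidalCategory.tensorHom_comp_tensorHom, MonoidalCategory.tensorHom_comp_tensorHom]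
      exact congrArg₂ (fun a b => a ⊗ₘ b) (Arrow.w e.hom) (Arrow.w e'.hom))

/-- The associativity constraint `(A ⇓ A)`. -/
def arrowAssoc (φ ψ χ : Arrow C) :
    arrowTensor (arrowTensor φ ψ) χ ≅ arrowTensor φ (arrowTensor ψ χ) :=
  cell (α_ φ.left ψ.left χ.left) (α_ φ.right ψ.right χ.right)
    (MonoidalCategory.associator_naturality φ.hom ψ.hom χ.hom).symm

/-- The unit, which is the identity of the unit object. -/
def arrowUnit (C : Type u) [Category.{v} C] [MonoidalCategory C] : Arrow C := Arrow.mk (𝟙 (𝟙_ C))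

/-- The left unit constraint. -/
def arrowLeftUnit (φ : Arrow C) : arrowTensor (arrowUnit C) φ ≅ φ :=
  cell (λ_ φ.left) (λ_ φ.right) (by
    show (λ_ _).hom ≫ φ.hom = (𝟙 (𝟙_ C) ⊗ₘ φ.hom) ≫ (λ_ _).hom
    rw [MonoidalCategory.id_tensorHom, MonoidalCategory.leftUnitor_naturality])

/-- The right unit constraint. -/
def arrowRightUnit (φ : Arrow C) : arrowTensor φ (arrowUnit C) ≅ φ :=
  cell (ρ_ φ.left) (ρ_ φ.right) (by
    show (ρ_ _).hom ≫ φ.hom = (φ.hom ⊗ₘ 𝟙 (𝟙_ C)) ≫ (ρ_ _).hom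
    rw [MonoidalCategory.tensorHom_id, MonoidalCategory.rightUnitor_naturality])

/-- The commutativity constraint `(C ⇓ C)`. -/
def arrowBraid [SymmetricCategory C] (φ ψ : Arrow C) : arrowTensor φ ψ ≅ arrowTensor ψ φ :=
  cell (β_ φ.left ψ.left) (β_ φ.right ψ.right)
    (BraidedCategory.braiding_naturality φ.hom ψ.hom).symm

end Arrows

/-- Morphisms of `C` as objects, isomorphisms of the arrow category and composition morphisms `γ`
as words, in a given signature. -/
structure Letters (C : Type u) [Category.{v} C] (S : Signature.{w₁}) where
  obj : Arrow C → S.Obj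
  iso {φ ψ : Arrow C} (e : φ ≅ ψ) : S.Word (obj φ) (obj ψ)
  γ {X Y Z : C} (g : Y ⟶ Z) (f : X ⟶ Y) :
    S.Word (S.tensor (obj (Arrow.mk g)) (obj (Arrow.mk f))) (obj (Arrow.mk (f ≫ g)))

/-- In addition, multiplication morphisms `μ`. -/
structure MulLetters (C : Type u) [Category.{v} C] [MonoidalCategory C] (S : Signature.{w₁})
    extends Letters C S where
  μ (φ ψ : Arrow C) : S.Word (S.tensor (obj φ) (obj ψ)) (obj (arrowTensor φ ψ))

open Signature.Word in
/-- Functoriality of the isomorphisms, inner and outer equivariance of the composition morphisms,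
and their internal associativity. -/
inductive CompRel {C : Type u} [Category.{v} C] {S : Signature.{w₁}} (L : Letters C S) :
    ∀ ⦃X Y : S.Obj⦄, S.Word X Y → S.Word X Y → Prop
  | iso_refl (φ : Arrow C) : CompRel L (L.iso (Iso.refl φ)) (ident (L.obj φ))
  | iso_trans {φ ψ χ : Arrow C} (e : φ ≅ ψ) (e' : ψ ≅ χ) :
      CompRel L (L.iso (e ≪≫ e')) (comp (L.iso e) (L.iso e'))
  | inner {X₀ X₁ X₁' X₂ : C} (g : X₁ ⟶ X₂) (f : X₀ ⟶ X₁) (σ : X₁ ≅ X₁') :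
      CompRel L
        (comp (tensor (L.iso (cell (f := g) (f' := σ.inv ≫ g) σ (Iso.refl X₂)))
            (L.iso (cell (f := f) (f' := f ≫ σ.hom) (Iso.refl X₀) σ)))
          (L.γ (σ.inv ≫ g) (f ≫ σ.hom)))
        (comp (L.γ g f) (L.iso (cellEq (f := f ≫ g) (f' := (f ≫ σ.hom) ≫ σ.inv ≫ g))))
  | outer {X₀ X₀' X₁ X₂ X₂' : C} (g : X₁ ⟶ X₂) (f : X₀ ⟶ X₁) (σ : X₀ ≅ X₀') (σ' : X₂ ≅ X₂') :
      CompRel L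
        (comp (tensor (L.iso (cell (f := g) (f' := g ≫ σ'.hom) (Iso.refl X₁) σ'))
            (L.iso (cell (f := f) (f' := σ.inv ≫ f) σ (Iso.refl X₁))))
          (L.γ (g ≫ σ'.hom) (σ.inv ≫ f)))
        (comp (L.γ g f)
          (L.iso (cell (f := f ≫ g) (f' := (σ.inv ≫ f) ≫ g ≫ σ'.hom) σ σ')))
  | assoc {X₀ X₁ X₂ X₃ : C} (h : X₂ ⟶ X₃) (g : X₁ ⟶ X₂) (f : X₀ ⟶ X₁) :
      CompRel L
        (comp (tensor (L.γ h g) (ident (L.obj (Arrow.mk f)))) (L.γ (g ≫ h) f))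
        (comp (assocHom _ _ _) (comp (tensor (ident (L.obj (Arrow.mk h))) (L.γ g f))
          (comp (L.γ h (f ≫ g)) (L.iso (cellEq (f := (f ≫ g) ≫ h) (f' := f ≫ g ≫ h))))))

open Signature.Word in
/-- Equivariance of the multiplication morphisms and their internal associativity. -/
inductive MulRel {C : Type u} [Category.{v} C] [MonoidalCategory C] {S : Signature.{w₁}}
    (L : MulLetters C S) : ∀ ⦃X Y : S.Obj⦄, S.Word X Y → S.Word X Y → Prop
  | equivariance {φ φ' ψ ψ' : Arrow C} (e : φ ≅ φ') (e' : ψ ≅ ψ') :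
      MulRel L (comp (tensor (L.iso e) (L.iso e')) (L.μ φ' ψ'))
        (comp (L.μ φ ψ) (L.iso (arrowTensorIso e e')))
  | assoc (φ ψ χ : Arrow C) :
      MulRel L
        (comp (tensor (L.μ φ ψ) (ident (L.obj χ)))
          (comp (L.μ (arrowTensor φ ψ) χ) (L.iso (arrowAssoc φ ψ χ))))
        (comp (assocHom _ _ _) (comp (tensor (ident (L.obj φ)) (L.μ ψ χ))
          (L.μ φ (arrowTensor ψ χ))))

open Signature.Word in
/-- Internal interchange. -/
inductive InterchangeRel {C : Type u} [Category.{v} C] [MonoidalCategory C] {S : Signature.{w₁}}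
    (L : MulLetters C S) : ∀ ⦃X Y : S.Obj⦄, S.Word X Y → S.Word X Y → Prop
  | interchange (hS : S.symm) {X Y Z X' Y' Z' : C} (f₀ : Y ⟶ Z) (f₁ : X ⟶ Y) (g₀ : Y' ⟶ Z')
      (g₁ : X' ⟶ Y') :
      InterchangeRel L
        (comp (tensor (L.μ (Arrow.mk f₀) (Arrow.mk g₀)) (L.μ (Arrow.mk f₁) (Arrow.mk g₁)))
          (comp (L.γ (f₀ ⊗ₘ g₀) (f₁ ⊗ₘ g₁))
            (L.iso (cellEq (f := (f₁ ⊗ₘ g₁) ≫ (f₀ ⊗ₘ g₀)) (f' := (f₁ ≫ f₀) ⊗ₘ (g₁ ≫ g₀))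
              (MonoidalCategory.tensorHom_comp_tensorHom _ _ _ _)))))
        (comp (middleSwap hS _ _ _ _)
          (comp (tensor (L.γ f₀ f₁) (L.γ g₀ g₁))
            (L.μ (Arrow.mk (f₁ ≫ f₀)) (Arrow.mk (g₁ ≫ g₀)))))

open Signature.Word in
/-- Compatibility with commutators. -/
inductive CommRel {C : Type u} [Category.{v} C] [MonoidalCategory C] [SymmetricCategory C]
    {S : Signature.{w₁}} (L : MulLetters C S) :
    ∀ ⦃X Y : S.Obj⦄, S.Word X Y → S.Word X Y → Prop
  | comm (hS : S.symm) (φ ψ : Arrow C) :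
      CommRel L (comp (L.μ φ ψ) (L.iso (arrowBraid φ ψ)))
        (comp (braid hS (L.obj φ) (L.obj ψ)) (L.μ ψ φ))

/-! ### The constructions whose objects are words of morphisms -/

/-- The signature whose objects are words in `A`, with concatenation as product. -/
@[reducible]
def wordSignature (A : Type u) (symm : Prop) (Gen : List A → List A → Type u) :
    Signature.{u} where
  Obj := List A
  unit := []
  tensor X Y := X ++ Y
  symm := symm
  Gen := Gen

open Signature.Word in
/-- Strictness: the associativity and unit constraints are identities. -/
inductive StrictRel {A : Type u} {symm : Prop} {Gen : List A → List A → Type u} :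
    ∀ ⦃X Y : List A⦄, (wordSignature A symm Gen).Word X Y → (wordSignature A symm Gen).Word X Y → Prop
  | assoc (X Y Z : List A) : StrictRel (assocHom X Y Z) (eqTo (List.append_assoc X Y Z))
  | leftUnit (X : List A) : StrictRel (leftUnitHom X) (eqTo (List.nil_append X))
  | rightUnit (X : List A) : StrictRel (rightUnitHom X) (eqTo (List.append_nil X))

section Category

variable (C : Type u) [Category.{v} C]

inductive BoxGen : List (Arrow C) → List (Arrow C) → Type (max u v)
  | iso {φ ψ : Arrow C} (e : φ ≅ ψ) : BoxGen [φ] [ψ]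
  | γ {X Y Z : C} (g : Y ⟶ Z) (f : X ⟶ Y) : BoxGen [Arrow.mk g, Arrow.mk f] [Arrow.mk (f ≫ g)]

def boxLetters (symm : Prop) : Letters C (wordSignature (Arrow C) symm (BoxGen C)) where
  obj φ := [φ]
  iso e := .gen (.iso e)
  γ g f := .gen (.γ g f)

/-- The strict (symmetric, if `symm` holds) monoidal category generated by the isomorphisms of the
arrow category and the composition morphisms. -/
def boxPresentation (symm : Prop) : Presentation where
  toSignature := wordSignature (Arrow C) symm (BoxGen C)
  Rel _ _ f g := StrictRel f g ∨ CompRel (boxLetters C symm) f g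

end Category

section Monoidal

variable (M : Type u) [Category.{v} M] [MonoidalCategory M]

inductive NcGen : List (Arrow M) → List (Arrow M) → Type (max u v)
  | iso {φ ψ : Arrow M} (e : φ ≅ ψ) : NcGen [φ] [ψ]
  | γ {X Y Z : M} (g : Y ⟶ Z) (f : X ⟶ Y) : NcGen [Arrow.mk g, Arrow.mk f] [Arrow.mk (f ≫ g)]
  | μ (φ ψ : Arrow M) : NcGen [φ, ψ] [arrowTensor φ ψ]

def ncLetters : MulLetters M (wordSignature (Arrow M) True (NcGen M)) where
  obj φ := [φ]
  iso e := .gen (.iso e)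
  γ g f := .gen (.γ g f)
  μ φ ψ := .gen (.μ φ ψ)

/-- The presentation of `M^{nc+}` for a monoidal category `M`. -/
def ncPresentation : Presentation where
  toSignature := wordSignature (Arrow M) True (NcGen M)
  Rel _ _ f g := StrictRel f g ∨ CompRel (ncLetters M).toLetters f g ∨ MulRel (ncLetters M) f g ∨
    InterchangeRel (ncLetters M) f g

/-- The presentation of `M^{nc+}` for a symmetric monoidal category `M`. -/
def symNcPresentation [SymmetricCategory M] : Presentation where
  toSignature := wordSignature (Arrow M) True (NcGen M)
  Rel _ _ f g := (ncPresentation M).Rel f g ∨ CommRel (ncLetters M) f g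

inductive LocGen : List (Arrow M) → List (Arrow M) → Type (max u v)
  | nc {X Y : List (Arrow M)} (g : NcGen M X Y) : LocGen X Y
  | μInv (φ ψ : Arrow M) : LocGen [arrowTensor φ ψ] [φ, ψ]

def locLetters : MulLetters M (wordSignature (Arrow M) True (LocGen M)) where
  obj φ := [φ]
  iso e := .gen (.nc (.iso e))
  γ g f := .gen (.nc (.γ g f))
  μ φ ψ := .gen (.nc (.μ φ ψ))

open Signature.Word in
/-- The morphisms `μ` are inverted. -/
inductive InvRel : ∀ ⦃X Y : List (Arrow M)⦄, (wordSignature (Arrow M) True (LocGen M)).Word X Y →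
    (wordSignature (Arrow M) True (LocGen M)).Word X Y → Prop
  | μ_μInv (φ ψ : Arrow M) :
      InvRel (comp (gen (.nc (.μ φ ψ))) (gen (.μInv φ ψ))) (ident (S := wordSignature (Arrow M) True (LocGen M)) [φ, ψ])
  | μInv_μ (φ ψ : Arrow M) :
      InvRel (comp (gen (.μInv φ ψ)) (gen (.nc (.μ φ ψ)))) 
        (ident (S := wordSignature (Arrow M) True (LocGen M)) [arrowTensor φ ψ])

/-- The presentation of `M^{loc+}` for a monoidal category `M`. -/
def locPresentation : Presentation where
  toSignature := wordSignature (Arrow M) True (LocGen M)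
  Rel _ _ f g := StrictRel f g ∨ CompRel (locLetters M).toLetters f g ∨
    MulRel (locLetters M) f g ∨ InterchangeRel (locLetters M) f g ∨ InvRel M f g

/-- The presentation of `M^{loc+}` for a symmetric monoidal category `M`. -/
def symLocPresentation [SymmetricCategory M] : Presentation where
  toSignature := wordSignature (Arrow M) True (LocGen M)
  Rel _ _ f g := (locPresentation M).Rel f g ∨ CommRel (locLetters M) f g

/-! ### The reduced version, with the morphisms themselves as objects -/

inductive PlusGen : Arrow M → Arrow M → Type (max u v)
  | iso {φ ψ : Arrow M} (e : φ ≅ ψ) : PlusGen φ ψ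
  | γ {X Y Z : M} (g : Y ⟶ Z) (f : X ⟶ Y) :
      PlusGen (arrowTensor (Arrow.mk g) (Arrow.mk f)) (Arrow.mk (f ≫ g))

/-- The signature whose objects are the morphisms of `M`, with the product of `M`. -/
@[reducible]
def plusSignature (symm : Prop) : Signature where
  Obj := Arrow M
  unit := arrowUnit M
  tensor := arrowTensor
  symm := symm
  Gen := PlusGen M

/-- Here the product is that of `M`, and the multiplication morphisms are identities. -/
def plusLetters (symm : Prop) : MulLetters M (plusSignature M symm) where
  obj φ := φ
  iso e := .gen (.iso e)
  γ g f := .gen (.γ g f)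
  μ φ ψ := Signature.Word.ident (S := plusSignature M symm) (arrowTensor φ ψ)

open Signature.Word in
/-- The unit constraints are those of the arrow category. -/
inductive UnitRel (symm : Prop) : ∀ ⦃φ ψ : Arrow M⦄, (plusSignature M symm).Word φ ψ →
    (plusSignature M symm).Word φ ψ → Prop
  | leftUnit (φ : Arrow M) : UnitRel symm (leftUnitHom φ) (gen (.iso (arrowLeftUnit φ)))
  | rightUnit (φ : Arrow M) : UnitRel symm (rightUnitHom φ) (gen (.iso (arrowRightUnit φ)))

/-- The presentation of `M⁺` for a monoidal category `M`. The relations `MulRel` and `UnitRel` say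
that the isomorphisms of the arrow category are included as a monoidal groupoid: as the `μ` are
identities, they identify products of isomorphisms and associativity and unit constraints with those
of the arrow category. -/
def plusPresentation : Presentation where
  toSignature := plusSignature M False
  Rel _ _ f g := UnitRel M False f g ∨ MulRel (plusLetters M False) f g ∨
    CompRel (plusLetters M False).toLetters f g

/-- The presentation of `M⁺` for a symmetric monoidal category `M`. The relation `CommRel` identifies
the commutativity constraints with those of the arrow category. The proposition `inter` says whether
the interchange relation that the `γ` satisfy in `M^{loc+}` is imposed as well. -/
def symPlusPresentation (inter : Prop) [SymmetricCategory M] : Presentation where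
  toSignature := plusSignature M True
  Rel _ _ f g := UnitRel M True f g ∨ MulRel (plusLetters M True) f g ∨
    CompRel (plusLetters M True).toLetters f g ∨ CommRel (plusLetters M True) f g ∨
    (inter ∧ InterchangeRel (plusLetters M True) f g)

end Monoidal

instance (C : Type u) [Category.{v} C] : SymmetricCategory (boxPresentation C True).Cat :=
  Presentation.symmetricCategory _ trivial

section

variable (M : Type u) [Category.{v} M] [MonoidalCategory M]

instance : SymmetricCategory (ncPresentation M).Cat := Presentation.symmetricCategory _ trivial

instance : SymmetricCategory (locPresentation M).Cat := Presentation.symmetricCategory _ trivial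

variable [SymmetricCategory M]

instance : SymmetricCategory (symNcPresentation M).Cat := Presentation.symmetricCategory _ trivial

instance : SymmetricCategory (symLocPresentation M).Cat := Presentation.symmetricCategory _ trivial

instance (inter : Prop) : SymmetricCategory (symPlusPresentation M inter).Cat :=
  Presentation.symmetricCategory _ trivial

end

/-- `C^{⊠+}`, as a monoidal category. -/
abbrev BoxPlus (C : CategoryTheory.Cat.{v, u}) : MonoidalCat.{max u v, max u v} :=
  { carrier := (boxPresentation C False).Cat }

/-- `C^{⊠+}`, as a symmetric monoidal category. -/
abbrev SymBoxPlus (C : CategoryTheory.Cat.{v, u}) : SymMonoidalCat.{max u v, max u v} :=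
  { carrier := (boxPresentation C True).Cat }

/-- `M^{nc+}` for a monoidal category `M`. -/
abbrev NcPlus (M : MonoidalCat.{v, u}) : SymMonoidalCat.{max u v, max u v} :=
  { carrier := (ncPresentation M).Cat }

/-- `M^{nc+}` for a symmetric monoidal category `M`. -/
abbrev SymNcPlus (M : SymMonoidalCat.{v, u}) : SymMonoidalCat.{max u v, max u v} :=
  { carrier := (symNcPresentation M).Cat }

/-- `M^{loc+}` for a monoidal category `M`. -/
abbrev LocPlus (M : MonoidalCat.{v, u}) : SymMonoidalCat.{max u v, max u v} :=
  { carrier := (locPresentation M).Cat }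

/-- `M^{loc+}` for a symmetric monoidal category `M`. -/
abbrev SymLocPlus (M : SymMonoidalCat.{v, u}) : SymMonoidalCat.{max u v, max u v} :=
  { carrier := (symLocPresentation M).Cat }

/-- `M⁺` for a monoidal category `M`. -/
abbrev Plus (M : MonoidalCat.{v, u}) : MonoidalCat.{max u v, max u v} :=
  { carrier := (plusPresentation M).Cat }

/-- `M⁺` for a symmetric monoidal category `M`, with or without the interchange relation. -/
abbrev SymPlus (inter : Prop) (M : SymMonoidalCat.{v, u}) : SymMonoidalCat.{max u v, max u v} :=
  { carrier := (symPlusPresentation M inter).Cat }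

/-! ### The values of the plus construction of functors and natural isomorphisms on generators -/

section Values

variable {C : Type u₁} [Category.{v₁} C] {D : Type u₂} [Category.{v₂} D]
  {P : Presentation.{w₁}} {P' : Presentation.{w₂}}

/-- A morphism of `C`, as an object of the plus construction. -/
abbrev Letters.toCat (L : Letters C P.toSignature) (φ : Arrow C) : P.Cat := L.obj φ

/-- The isomorphism of objects of the plus construction given by `(σ ⇓ σ')`. -/
abbrev Letters.isoHom (L : Letters C P.toSignature) {φ ψ : Arrow C} (e : φ ≅ ψ) :
    L.toCat φ ⟶ L.toCat ψ := Presentation.hom (L.iso e)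

/-- The morphism `γ`. -/
abbrev Letters.γHom (L : Letters C P.toSignature) {X Y Z : C} (g : Y ⟶ Z) (f : X ⟶ Y) :
    L.toCat (Arrow.mk g) ⊗ L.toCat (Arrow.mk f) ⟶ L.toCat (Arrow.mk (f ≫ g)) :=
  Presentation.hom (L.γ g f)

/-- The morphism `μ`. -/
abbrev MulLetters.μHom [MonoidalCategory C] (L : MulLetters C P.toSignature) (φ ψ : Arrow C) :
    L.toCat φ ⊗ L.toCat ψ ⟶ L.toCat (arrowTensor φ ψ) :=
  Presentation.hom (L.μ φ ψ)

/-- The strong monoidal functor `Q` of plus constructions is given by `F` on morphisms, on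
isomorphisms and on composition morphisms: `φ ↦ F φ`, `(σ ⇓ σ') ↦ (F σ ⇓ F σ')`,
`γ_{g, f} ↦ γ_{F g, F f}`, up to the structure morphism of `Q`. -/
structure Extends (F : C ⥤ D) (L : Letters C P.toSignature) (L' : Letters D P'.toSignature)
    (Q : MonFunctor P.Cat P'.Cat) : Prop where
  obj : ∀ φ : Arrow C, Q.obj (L.toCat φ) = L'.toCat (F.mapArrow.obj φ)
  iso : ∀ {φ ψ : Arrow C} (e : φ ≅ ψ),
    Q.map (L.isoHom e) =
      eqToHom (obj φ) ≫ L'.isoHom (F.mapArrow.mapIso e) ≫ eqToHom (obj ψ).symm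
  γ : ∀ {X Y Z : C} (g : Y ⟶ Z) (f : X ⟶ Y),
    Functor.LaxMonoidal.μ Q.toFunctor _ _ ≫ Q.map (L.γHom g f) =
      (eqToHom (obj (Arrow.mk g)) ⊗ₘ eqToHom (obj (Arrow.mk f))) ≫
        L'.γHom (F.map g) (F.map f) ≫
        L'.isoHom (cellEq (F.map_comp f g).symm) ≫
        eqToHom (obj (Arrow.mk (f ≫ g))).symm

/-- The isomorphism `(f_{X₁, X₂} ⇓ f_{Y₁, Y₂}) : F φ ⊗ F ψ ≅ F (φ ⊗ ψ)` given by the structure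
morphisms of a strong monoidal functor. -/
def MonFunctor.arrowμ [MonoidalCategory C] [MonoidalCategory D] (F : MonFunctor C D)
    (φ ψ : Arrow C) :
    arrowTensor (F.toFunctor.mapArrow.obj φ) (F.toFunctor.mapArrow.obj ψ) ≅
      F.toFunctor.mapArrow.obj (arrowTensor φ ψ) :=
  cell (Functor.Monoidal.μIso F.toFunctor φ.left ψ.left)
    (Functor.Monoidal.μIso F.toFunctor φ.right ψ.right)
    (Functor.LaxMonoidal.μ_natural F.toFunctor φ.hom ψ.hom).symm

/-- Moreover `Q` sends `μ_{φ, ψ}` to `μ_{F φ, F ψ}` followed by the isomorphism given by the structure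
morphisms of `F`, up to the structure morphism of `Q`. -/
structure ExtendsMul [MonoidalCategory C] [MonoidalCategory D] (F : MonFunctor C D)
    (L : MulLetters C P.toSignature) (L' : MulLetters D P'.toSignature)
    (Q : MonFunctor P.Cat P'.Cat) : Prop
    extends Extends F.toFunctor L.toLetters L'.toLetters Q where
  μ : ∀ φ ψ : Arrow C,
    Functor.LaxMonoidal.μ Q.toFunctor _ _ ≫ Q.map (L.μHom φ ψ) =
      (eqToHom (obj φ) ⊗ₘ eqToHom (obj ψ)) ≫
        L'.μHom (F.toFunctor.mapArrow.obj φ) (F.toFunctor.mapArrow.obj ψ) ≫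
        L'.isoHom (F.arrowμ φ ψ) ≫ eqToHom (obj (arrowTensor φ ψ)).symm

/-- The natural isomorphism `A` is given by `(α_{s(φ)} ⇓ α_{t(φ)})` on morphisms `φ`. -/
def IsExtension {F G : C ⥤ D} (α : F ≅ G) (L : Letters C P.toSignature)
    (L' : Letters D P'.toSignature) {Q R : MonFunctor P.Cat P'.Cat} (A : Q ≅ R) : Prop :=
  ∀ φ : Arrow C, ∃ (hQ : Q.obj (L.toCat φ) = L'.toCat (F.mapArrow.obj φ))
    (hR : L'.toCat (G.mapArrow.obj φ) = R.obj (L.toCat φ)),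
    A.hom.hom.app (L.toCat φ) =
      eqToHom hQ ≫ L'.isoHom (Arrow.isoOfNatIso α φ) ≫ eqToHom hR

end Values

end PlusConstruction

open PlusConstruction

/-! A strong monoidal functor out of a category given by generators and relations is obtained from
images of the objects and generators, with isomorphisms comparing units and products, as soon as the
relations hold for these images. For a given `F`, each generator goes to the corresponding generator
at the `F`-images, followed or preceded by an isomorphism of the arrow category that corrects for
`F` preserving composites only up to an equality and products only up to `f`. The relations survive
because equivariance of `γ` and `μ` moves every correction to the end. What is left is an equation
between isomorphisms of the arrow category, checked at sources and targets, where it is an axiom of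
a strong (symmetric) monoidal functor: naturality, associativity, unitality or symmetry of `f`. This
is the content of `CompData.Laws.pullback`, `MulData.MulLaws.pullback`,
`MulData.Interchange.pullback` and `MulData.Comm.pullback`.

Words are evaluated not in the target `D` itself but in `Interp.Induced`, a copy of the objects of
the signature carrying the monoidal structure of `D` transported along the comparison isomorphisms.
There evaluation is strict on objects, so each axiom of `Presentation.Eqv` is literally an axiom of
a monoidal category (`Interp.Sound.eval_eq`). The forgetful functor to `D` is faithful and strong
monoidal, so laws proved in `D` hold there as well (`CompData.Laws.of_map` and its companions).

For a natural isomorphism `α`, the family `(α ⇓ α)` is prescribed on letters. When objects are words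
it extends in exactly one way to a family compatible with products (`wordFamily`); for `M⁺` every
object is already a letter. Such a family is natural as soon as it is natural on generators
(`IsMonoidalFamily.natural_of_gen`). On `γ` this is equivariance along the components of `α`, and on
`μ` it is equivariance together with monoidality of `α`.

Strict functoriality comes from uniqueness rather than from computing composites. Two functors with
the defining properties for the same `F` are compared by the extension of the identity of `F`. Its
components are identities up to equality of objects, which forces the functors to be equal
(`MonFunctor.eq_of_trans`). The defining properties hold for identities and are stable under
composition, so identities and composites are preserved on the nose (`exists_twoFunctor`). For
equivalences, the isomorphisms between the composites `F.comp G`, `G.comp F` and the identities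
extend in the same way. -/

namespace PlusConstruction

/-! ### The coherence axioms in terms of products of morphisms -/

section Axioms

variable {C : Type u} [Category.{v} C] [MonoidalCategory C]

/-- The axioms of `Presentation.Eqv` are written with products of morphisms and identities only, so
the coherence axioms are needed here in a form free of whiskering. -/
theorem pentagon_tensorHom (W X Y Z : C) :
    ((α_ W X Y).hom ⊗ₘ 𝟙 Z) ≫ (α_ W (X ⊗ Y) Z).hom ≫ (𝟙 W ⊗ₘ (α_ X Y Z).hom) =
      (α_ (W ⊗ X) Y Z).hom ≫ (α_ W X (Y ⊗ Z)).hom := by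
  simp

theorem triangle_tensorHom (X Y : C) :
    (α_ X (𝟙_ C) Y).hom ≫ (𝟙 X ⊗ₘ (λ_ Y).hom) = (ρ_ X).hom ⊗ₘ 𝟙 Y := by
  simp

theorem hexagon_forward_tensorHom [BraidedCategory C] (X Y Z : C) :
    (α_ X Y Z).hom ≫ (β_ X (Y ⊗ Z)).hom ≫ (α_ Y Z X).hom =
      ((β_ X Y).hom ⊗ₘ 𝟙 Z) ≫ (α_ Y X Z).hom ≫ (𝟙 Y ⊗ₘ (β_ X Z).hom) := by
  rw [BraidedCategory.hexagon_forward, tensorHom_id, id_tensorHom]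

theorem hexagon_reverse_tensorHom [BraidedCategory C] (X Y Z : C) :
    (α_ X Y Z).inv ≫ (β_ (X ⊗ Y) Z).hom ≫ (α_ Z X Y).inv =
      (𝟙 X ⊗ₘ (β_ Y Z).hom) ≫ (α_ X Z Y).inv ≫ ((β_ X Z).hom ⊗ₘ 𝟙 Y) := by
  rw [BraidedCategory.hexagon_reverse, tensorHom_id, id_tensorHom]

end Axioms

/-! ### Interpretations of a signature in a monoidal category -/

/-- An interpretation of the objects and generators of a signature in a monoidal category, with
isomorphisms comparing the units and products. -/
structure Interp (S : Signature.{w₁}) (D : Type u₁) [Category.{v₁} D] [MonoidalCategory D] where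
  obj : S.Obj → D
  ε : 𝟙_ D ≅ obj S.unit
  μ : ∀ X Y, obj X ⊗ obj Y ≅ obj (S.tensor X Y)
  sym : S.symm → SymmetricCategory D
  gen : ∀ {X Y}, S.Gen X Y → (obj X ⟶ obj Y)

namespace Interp

section

variable {S : Signature.{w₁}} {D : Type u₁} [Category.{v₁} D] [MonoidalCategory D]
  (I : Interp S D)

/-- The objects of the signature, with the monoidal structure transported from `D`. -/
def Induced (_ : Interp S D) : Type w₁ := S.Obj

/-- Morphisms are those of `D` between the interpreted objects. The point of the copy is that
`S.tensor X Y` is its product on the nose, so no comparison isomorphism appears when a word is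
evaluated. -/
instance : Category.{v₁} I.Induced where
  Hom X Y := I.obj X ⟶ I.obj Y
  id X := 𝟙 (I.obj X)
  comp f g := CategoryStruct.comp (obj := D) f g
  id_comp f := Category.id_comp (obj := D) f
  comp_id f := Category.comp_id (obj := D) f
  assoc f g h := Category.assoc (obj := D) f g h

/-- The functor to the category in which the signature is interpreted. -/
def forget : I.Induced ⥤ D where
  obj := I.obj
  map f := f
  map_id _ := rfl
  map_comp _ _ := rfl

/-- A morphism in `D`, as a morphism of the transported category. -/
def lift {X Y : I.Induced} (f : I.forget.obj X ⟶ I.forget.obj Y) : X ⟶ Y := f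

/-- An isomorphism in `D`, as an isomorphism of the transported category. -/
def liftIso {X Y : I.Induced} (e : I.forget.obj X ≅ I.forget.obj Y) : X ≅ Y where
  hom := e.hom
  inv := e.inv
  hom_inv_id := e.hom_inv_id
  inv_hom_id := e.inv_hom_id

instance : I.forget.Faithful where
  map_injective h := h

/-- Every operation is the one of `D` conjugated by `I.μ` and `I.ε`. The bracketing is the one
prescribed for a structure induced along a functor, so that the compatibilities of `inducingData`
hold by definition. -/
instance : MonoidalCategoryStruct I.Induced where
  tensorObj := S.tensor
  tensorUnit := S.unit
  tensorHom {X Y X' Y'} f g := I.lift (X := S.tensor X X') (Y := S.tensor Y Y')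
    ((I.μ X X').inv ≫ (I.forget.map f ⊗ₘ I.forget.map g) ≫ (I.μ Y Y').hom)
  whiskerLeft X Y Z f := I.lift (X := S.tensor X Y) (Y := S.tensor X Z)
    ((I.μ X Y).inv ≫ (I.obj X ◁ I.forget.map f) ≫ (I.μ X Z).hom)
  whiskerRight {X Y} f Z := I.lift (X := S.tensor X Z) (Y := S.tensor Y Z)
    ((I.μ X Z).inv ≫ (I.forget.map f ▷ I.obj Z) ≫ (I.μ Y Z).hom)
  associator X Y Z := I.liftIso
    (X := S.tensor (S.tensor X Y) Z) (Y := S.tensor X (S.tensor Y Z))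
    (((I.μ (S.tensor X Y) Z).symm ≪≫ ((I.μ X Y).symm ⊗ᵢ Iso.refl (I.obj Z))) ≪≫
      α_ (I.obj X) (I.obj Y) (I.obj Z) ≪≫
      ((Iso.refl (I.obj X) ⊗ᵢ I.μ Y Z) ≪≫ I.μ X (S.tensor Y Z)))
  leftUnitor X := I.liftIso (X := S.tensor S.unit X) (Y := X)
    (((I.μ S.unit X).symm ≪≫ (I.ε.symm ⊗ᵢ Iso.refl (I.obj X))) ≪≫ λ_ (I.obj X))
  rightUnitor X := I.liftIso (X := S.tensor X S.unit) (Y := X)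
    (((I.μ X S.unit).symm ≪≫ (Iso.refl (I.obj X) ⊗ᵢ I.ε.symm)) ≪≫ ρ_ (I.obj X))

/-- The comparison isomorphisms of the interpretation. -/
def inducingData : Monoidal.InducingFunctorData I.forget where
  μIso := I.μ
  εIso := I.ε
  whiskerLeft_eq _ _ _ _ := rfl
  whiskerRight_eq _ _ := rfl
  tensorHom_eq _ _ := rfl
  associator_eq _ _ _ := rfl
  leftUnitor_eq _ := rfl
  rightUnitor_eq _ := rfl

instance : MonoidalCategory I.Induced := Monoidal.induced I.forget I.inducingData

instance : I.forget.Monoidal := Monoidal.fromInducedMonoidal I.forget I.inducingData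

/-- The transported braiding. -/
@[reducible]
def braidedCategory (h : S.symm) : BraidedCategory I.Induced :=
  letI := I.sym h
  BraidedCategory.ofFaithful I.forget
    (fun X Y => I.liftIso ((I.μ X Y).symm ≪≫ β_ (I.obj X) (I.obj Y) ≪≫ I.μ Y X))
    (fun X Y => by
      show (I.μ X Y).hom ≫ (I.μ X Y).inv ≫ (β_ (I.obj X) (I.obj Y)).hom ≫ (I.μ Y X).hom = _
      rw [Iso.hom_inv_id_assoc]; rfl)

/-- The transported symmetry. -/
@[reducible]
def symmetricCategory (h : S.symm) : SymmetricCategory I.Induced :=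
  letI := I.sym h
  letI := I.braidedCategory h
  { symmetry := fun X Y => by
      show ((I.μ X Y).inv ≫ (β_ (I.obj X) (I.obj Y)).hom ≫ (I.μ Y X).hom) ≫
        (I.μ Y X).inv ≫ (β_ (I.obj Y) (I.obj X)).hom ≫ (I.μ X Y).hom = 𝟙 (I.obj (S.tensor X Y))
      simp }

/-- An object of the signature, as an object of the transported category. -/
abbrev toInduced (X : S.Obj) : I.Induced := X

/-- The interpretation of words. -/
def eval : ∀ {X Y : S.Obj}, S.Word X Y → (I.toInduced X ⟶ I.toInduced Y)
  | _, _, .gen g => I.gen g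
  | _, _, .ident X => 𝟙 (I.toInduced X)
  | _, _, .comp f g => eval f ≫ eval g
  | _, _, .tensor f g => eval f ⊗ₘ eval g
  | _, _, .assocHom X Y Z => (α_ (I.toInduced X) (I.toInduced Y) (I.toInduced Z)).hom
  | _, _, .assocInv X Y Z => (α_ (I.toInduced X) (I.toInduced Y) (I.toInduced Z)).inv
  | _, _, .leftUnitHom X => (λ_ (I.toInduced X)).hom
  | _, _, .leftUnitInv X => (λ_ (I.toInduced X)).inv
  | _, _, .rightUnitHom X => (ρ_ (I.toInduced X)).hom
  | _, _, .rightUnitInv X => (ρ_ (I.toInduced X)).inv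
  -- A braiding of the target is available only in the presence of a proof of `S.symm`, which the
  -- constructor carries.
  | _, _, .braid h X Y => letI := I.symmetricCategory h; (β_ (I.toInduced X) (I.toInduced Y)).hom

theorem eval_eqTo {X Y : S.Obj} (h : X = Y) :
    I.eval (Signature.Word.eqTo h) = eqToHom (congrArg I.obj h) := by
  subst h; rfl

end

section

variable {P : Presentation.{w₁}} {D : Type u₁} [Category.{v₁} D] [MonoidalCategory D]
  (I : Interp P.toSignature D)

/-- The interpretation satisfies the relations of the presentation. -/
def Sound : Prop := ∀ ⦃X Y : P.Obj⦄ ⦃f g : P.Word X Y⦄, P.Rel f g → I.eval f = I.eval g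

variable {I}

/-- Each constructor of the congruence other than `of` is an axiom of (symmetric) monoidal
categories or of congruences and holds in `I.Induced`; the hypothesis is needed for the relations of
the presentation alone. -/
theorem Sound.eval_eq (hI : I.Sound) {X Y : P.Obj} {f g : P.Word X Y} (h : P.Eqv f g) :
    I.eval f = I.eval g := by
  induction h with
  | of h => exact hI h
  | refl => rfl
  | symm _ ih => exact ih.symm
  | trans _ _ ih ih' => exact ih.trans ih'
  | comp_congr _ _ ih ih' => exact congrArg₂ (fun a b => a ≫ b) ih ih'
  | tensor_congr _ _ ih ih' => exact congrArg₂ (fun a b => a ⊗ₘ b) ih ih'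
  | id_comp f => exact Category.id_comp (I.eval f)
  | comp_id f => exact Category.comp_id (I.eval f)
  | assoc f g h => exact Category.assoc (I.eval f) (I.eval g) (I.eval h)
  | tensor_id X Y => exact id_tensorHom_id (C := I.Induced) X Y
  | interchange f f' g g' =>
    exact tensorHom_comp_tensorHom (I.eval f) (I.eval f') (I.eval g) (I.eval g')
  | assoc_hom_inv X Y Z => exact (α_ (I.toInduced X) (I.toInduced Y) (I.toInduced Z)).hom_inv_id
  | assoc_inv_hom X Y Z => exact (α_ (I.toInduced X) (I.toInduced Y) (I.toInduced Z)).inv_hom_id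
  | assoc_natural f g h => exact associator_naturality (I.eval f) (I.eval g) (I.eval h)
  | leftUnit_hom_inv X => exact (λ_ (I.toInduced X)).hom_inv_id
  | leftUnit_inv_hom X => exact (λ_ (I.toInduced X)).inv_hom_id
  | leftUnit_natural f =>
    exact (congrArg (fun a => a ≫ _) (id_tensorHom _ (I.eval f))).trans
      (leftUnitor_naturality (I.eval f))
  | rightUnit_hom_inv X => exact (ρ_ (I.toInduced X)).hom_inv_id
  | rightUnit_inv_hom X => exact (ρ_ (I.toInduced X)).inv_hom_id
  | rightUnit_natural f =>
    exact (congrArg (fun a => a ≫ _) (tensorHom_id (I.eval f) _)).trans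
      (rightUnitor_naturality (I.eval f))
  | pentagon W X Y Z =>
    exact pentagon_tensorHom (C := I.Induced) W X Y Z
  | triangle X Y =>
    exact triangle_tensorHom (C := I.Induced) X Y
  | braid_braid h X Y =>
    let _ := I.symmetricCategory h
    exact SymmetricCategory.symmetry (C := I.Induced) X Y
  | braid_natural h f g =>
    let _ := I.symmetricCategory h
    exact BraidedCategory.braiding_naturality (I.eval f) (I.eval g)
  | hexagon h X Y Z =>
    let _ := I.symmetricCategory h
    exact hexagon_forward_tensorHom (C := I.Induced) X Y Z
  | hexagon' h X Y Z =>
    let _ := I.symmetricCategory h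
    exact hexagon_reverse_tensorHom (C := I.Induced) X Y Z

/-- The strong monoidal functor given by an interpretation that satisfies the relations. -/
def Sound.functor (hI : I.Sound) : MonFunctor P.Cat D where
  obj := I.obj
  map := Quotient.lift I.eval fun _ _ h => hI.eval_eq h
  map_id _ := rfl
  map_comp := by rintro _ _ _ ⟨f⟩ ⟨g⟩; rfl
  monoidal := Functor.CoreMonoidal.toMonoidal
    { εIso := I.ε
      μIso := I.μ
      -- The structure morphisms are those of `I.forget`. Only naturality needs a translation:
      -- whiskering in `P.Cat` is a product with an identity, whereas `I.Induced` has its own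
      -- whiskering.
      μIso_hom_natural_left := by
        rintro X Y ⟨f⟩ Z
        exact (Functor.LaxMonoidal.μ_natural_left I.forget (I.eval f) Z).trans
          (congrArg (fun a => (I.μ X Z).hom ≫ I.forget.map a) (tensorHom_id (I.eval f) Z).symm)
      μIso_hom_natural_right := by
        rintro X Y Z ⟨f⟩
        exact (Functor.LaxMonoidal.μ_natural_right I.forget Z (I.eval f)).trans
          (congrArg (fun a => (I.μ Z X).hom ≫ I.forget.map a)
            (id_tensorHom (C := I.Induced) Z (I.eval f)).symm)
      associativity := fun X Y Z => Functor.LaxMonoidal.associativity I.forget X Y Z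
      left_unitality := fun X => Functor.LaxMonoidal.left_unitality I.forget X
      right_unitality := fun X => Functor.LaxMonoidal.right_unitality I.forget X }

end

end Interp

end PlusConstruction

namespace PlusConstruction

/-! ### Algebras over the plus construction -/

section Cells

variable {C : Type u} [Category.{v} C]

/-- All bookkeeping with correction isomorphisms ends here: an equation between their images under
`A.iso` follows from an equation of sources and one of targets. -/
theorem arrowIso_ext {φ ψ : Arrow C} {e e' : φ ≅ ψ} (hl : e.hom.left = e'.hom.left)
    (hr : e.hom.right = e'.hom.right) : e = e' :=
  Iso.ext (Arrow.hom_ext _ _ hl hr)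

end Cells

/-- The images of the objects, isomorphisms and composition morphisms of a plus construction in a
monoidal category. -/
structure CompData (C : Type u) [Category.{v} C] (D : Type u₁) [Category.{v₁} D]
    [MonoidalCategory D] where
  obj : Arrow C → D
  iso {φ ψ : Arrow C} (e : φ ≅ ψ) : obj φ ⟶ obj ψ
  γ {X Y Z : C} (g : Y ⟶ Z) (f : X ⟶ Y) :
    obj (Arrow.mk g) ⊗ obj (Arrow.mk f) ⟶ obj (Arrow.mk (f ≫ g))

/-- Functoriality of the isomorphisms, equivariance and associativity of the composition
morphisms. -/
structure CompData.Laws {C : Type u} [Category.{v} C] {D : Type u₁} [Category.{v₁} D]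
    [MonoidalCategory D] (A : CompData C D) : Prop where
  iso_refl (φ : Arrow C) : A.iso (Iso.refl φ) = 𝟙 _
  iso_trans {φ ψ χ : Arrow C} (e : φ ≅ ψ) (e' : ψ ≅ χ) : A.iso (e ≪≫ e') = A.iso e ≫ A.iso e'
  -- Inner equivariance is the case of identities `a` and `c`, outer equivariance the case of an
  -- identity `b`. Commuting squares replace explicit conjugates, which makes the law applicable to
  -- the naturality squares of a transformation.
  equivariance {X Y Z X' Y' Z' : C} {g : Y ⟶ Z} {f : X ⟶ Y} {g' : Y' ⟶ Z'} {f' : X' ⟶ Y'}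
    (a : X ≅ X') (b : Y ≅ Y') (c : Z ≅ Z') (hg : b.hom ≫ g' = g ≫ c.hom)
    (hf : a.hom ≫ f' = f ≫ b.hom) (hh : a.hom ≫ f' ≫ g' = (f ≫ g) ≫ c.hom) :
    (A.iso (cell b c hg) ⊗ₘ A.iso (cell a b hf)) ≫ A.γ g' f' = A.γ g f ≫ A.iso (cell a c hh)
  assoc {X₀ X₁ X₂ X₃ : C} (h : X₂ ⟶ X₃) (g : X₁ ⟶ X₂) (f : X₀ ⟶ X₁) :
    (A.γ h g ⊗ₘ 𝟙 (A.obj (Arrow.mk f))) ≫ A.γ (g ≫ h) f =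
      (α_ _ _ _).hom ≫ (𝟙 (A.obj (Arrow.mk h)) ⊗ₘ A.γ g f) ≫ A.γ h (f ≫ g) ≫
        A.iso (cellEq (Category.assoc f g h))

/-- In addition, the images of the multiplication morphisms. -/
structure MulData (C : Type u) [Category.{v} C] [MonoidalCategory C] (D : Type u₁)
    [Category.{v₁} D] [MonoidalCategory D] extends CompData C D where
  μ (φ ψ : Arrow C) : obj φ ⊗ obj ψ ⟶ obj (arrowTensor φ ψ)

/-- Equivariance and associativity of the multiplication morphisms. -/
structure MulData.MulLaws {C : Type u} [Category.{v} C] [MonoidalCategory C] {D : Type u₁}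
    [Category.{v₁} D] [MonoidalCategory D] (A : MulData C D) : Prop where
  equivariance {φ φ' ψ ψ' : Arrow C} (e : φ ≅ φ') (e' : ψ ≅ ψ') :
    (A.iso e ⊗ₘ A.iso e') ≫ A.μ φ' ψ' = A.μ φ ψ ≫ A.iso (arrowTensorIso e e')
  assoc (φ ψ χ : Arrow C) :
    (A.μ φ ψ ⊗ₘ 𝟙 (A.obj χ)) ≫ A.μ (arrowTensor φ ψ) χ ≫ A.iso (arrowAssoc φ ψ χ) =
      (α_ _ _ _).hom ≫ (𝟙 (A.obj φ) ⊗ₘ A.μ ψ χ) ≫ A.μ φ (arrowTensor ψ χ)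

/-- Interchange of multiplication and composition morphisms. -/
def MulData.Interchange {C : Type u} [Category.{v} C] [MonoidalCategory C] {D : Type u₁}
    [Category.{v₁} D] [MonoidalCategory D] [BraidedCategory D] (A : MulData C D) : Prop :=
  ∀ {X Y Z X' Y' Z' : C} (f₀ : Y ⟶ Z) (f₁ : X ⟶ Y) (g₀ : Y' ⟶ Z') (g₁ : X' ⟶ Y'),
    (A.μ (Arrow.mk f₀) (Arrow.mk g₀) ⊗ₘ A.μ (Arrow.mk f₁) (Arrow.mk g₁)) ≫
      A.γ (f₀ ⊗ₘ g₀) (f₁ ⊗ₘ g₁) ≫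
        A.iso (cellEq (f := (f₁ ⊗ₘ g₁) ≫ (f₀ ⊗ₘ g₀)) (f' := (f₁ ≫ f₀) ⊗ₘ (g₁ ≫ g₀))
          (MonoidalCategory.tensorHom_comp_tensorHom _ _ _ _)) =
      tensorμ _ _ _ _ ≫ (A.γ f₀ f₁ ⊗ₘ A.γ g₀ g₁) ≫ A.μ (Arrow.mk (f₁ ≫ f₀)) (Arrow.mk (g₁ ≫ g₀))

/-- Compatibility of the multiplication morphisms with commutators. -/
def MulData.Comm {C : Type u} [Category.{v} C] [MonoidalCategory C] [SymmetricCategory C]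
    {D : Type u₁} [Category.{v₁} D] [MonoidalCategory D] [BraidedCategory D]
    (A : MulData C D) : Prop :=
  ∀ φ ψ : Arrow C, A.μ φ ψ ≫ A.iso (arrowBraid φ ψ) = (β_ (A.obj φ) (A.obj ψ)).hom ≫ A.μ ψ φ

/-! #### Change of the category whose morphisms are the objects -/

section Pullback

variable {C : Type u₁} [Category.{v₁} C] {C' : Type u₂} [Category.{v₂} C'] {D : Type u₃}
  [Category.{v₃} D] [MonoidalCategory D]

theorem CompData.Laws.iso_comp {A : CompData C D} (hA : A.Laws) {φ ψ χ : Arrow C} (e : φ ≅ ψ)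
    (e' : ψ ≅ χ) {e'' : φ ≅ χ} (hl : e.hom.left ≫ e'.hom.left = e''.hom.left)
    (hr : e.hom.right ≫ e'.hom.right = e''.hom.right) : A.iso e ≫ A.iso e' = A.iso e'' := by
  rw [← hA.iso_trans]
  exact congrArg A.iso (arrowIso_ext hl hr)

/-- The isomorphism of `D` given by an isomorphism of the arrow category. -/
def CompData.Laws.isoOf {A : CompData C D} (hA : A.Laws) {φ ψ : Arrow C} (e : φ ≅ ψ) :
    A.obj φ ≅ A.obj ψ where
  hom := A.iso e
  inv := A.iso e.symm
  hom_inv_id := by rw [← hA.iso_trans, Iso.self_symm_id, hA.iso_refl]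
  inv_hom_id := by rw [← hA.iso_trans, Iso.symm_self_id, hA.iso_refl]

theorem CompData.Laws.iso_cellEq_self {A : CompData C D} (hA : A.Laws) {X Y : C} {f : X ⟶ Y}
    (h : f = f) : A.iso (cellEq h) = 𝟙 (A.obj (Arrow.mk f)) :=
  (congrArg A.iso (arrowIso_ext rfl rfl)).trans (hA.iso_refl _)

/-- A functor turns `f ≫ g` into a morphism that merely equals `F.map f ≫ F.map g`, so a restricted
`γ` carries a `cellEq`. With the composites as variables, substitution makes these corrections
trivial, except for the one that records associativity of composition in `C`. -/
theorem CompData.Laws.assoc_cellEq {A : CompData C D} (hA : A.Laws) {X₀ X₁ X₂ X₃ : C}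
    {h : X₂ ⟶ X₃} {g : X₁ ⟶ X₂} {f : X₀ ⟶ X₁} {hg : X₁ ⟶ X₃} {gf : X₀ ⟶ X₂} {k k' : X₀ ⟶ X₃}
    (e₁ : g ≫ h = hg) (e₂ : f ≫ g = gf) (e₃ : f ≫ hg = k) (e₄ : gf ≫ h = k') (e₅ : k' = k) :
    ((A.γ h g ≫ A.iso (cellEq e₁)) ⊗ₘ 𝟙 (A.obj (Arrow.mk f))) ≫ A.γ hg f ≫ A.iso (cellEq e₃) =
      (α_ _ _ _).hom ≫ (𝟙 (A.obj (Arrow.mk h)) ⊗ₘ (A.γ g f ≫ A.iso (cellEq e₂))) ≫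
        (A.γ h gf ≫ A.iso (cellEq e₄)) ≫ A.iso (cellEq e₅) := by
  subst e₁ e₂ e₃ e₅
  simp only [hA.iso_cellEq_self, Category.comp_id, hA.assoc]

omit [MonoidalCategory D] in
theorem comp_comp_comp_congr {X Y Y' Z Z' W : D} {f : X ⟶ Y} {g : Y ⟶ Z} {h : Z ⟶ W}
    {f' : X ⟶ Y'} {g' : Y' ⟶ Z'} {h' : Z' ⟶ W} (e : f ≫ g ≫ h = f' ≫ g' ≫ h') {V : D}
    (k : W ⟶ V) : f ≫ g ≫ h ≫ k = f' ≫ g' ≫ h' ≫ k := by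
  simpa only [Category.assoc] using congrArg (fun x => x ≫ k) e

/-- Restriction along a functor. -/
def CompData.pullback (A : CompData C' D) (F : C ⥤ C') : CompData C D where
  obj φ := A.obj (F.mapArrow.obj φ)
  iso e := A.iso (F.mapArrow.mapIso e)
  γ g f := A.γ (F.map g) (F.map f) ≫ A.iso (cellEq (F.map_comp f g).symm)

theorem CompData.Laws.pullback {A : CompData C' D} (hA : A.Laws) (F : C ⥤ C') :
    (A.pullback F).Laws where
  iso_refl φ := (congrArg A.iso (F.mapArrow.mapIso_refl φ)).trans (hA.iso_refl _)
  iso_trans e e' := (congrArg A.iso (F.mapArrow.mapIso_trans e e')).trans (hA.iso_trans _ _)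
  equivariance {X Y Z X' Y' Z' g f g' f'} a b c hg hf hh := by
    have h := hA.equivariance (F.mapIso a) (F.mapIso b) (F.mapIso c) (g := F.map g)
      (f := F.map f) (g' := F.map g') (f' := F.map f')
      (by simp only [Functor.mapIso_hom, ← F.map_comp, hg])
      (by simp only [Functor.mapIso_hom, ← F.map_comp, hf])
      (by simp only [Functor.mapIso_hom, ← F.map_comp, hh])
    refine (Category.assoc _ _ _).symm.trans ((congrArg (fun x => x ≫ _) h).trans ?_)
    refine (Category.assoc _ _ _).trans (Eq.trans ?_ (Category.assoc _ _ _).symm)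
    refine congrArg (fun x => _ ≫ x) ?_
    refine (hA.iso_trans _ _).symm.trans (Eq.trans ?_ (hA.iso_trans _ _))
    -- The correction `cellEq` has identity components, hence commutes with the image of `cell a c`.
    refine congrArg A.iso (arrowIso_ext ?_ ?_)
    · exact (Category.comp_id _).trans (Category.id_comp _).symm
    · exact (Category.comp_id _).trans (Category.id_comp _).symm
  assoc {X₀ X₁ X₂ X₃} h g f := by
    -- The components on the left are `F.map (𝟙 _)`, which are identities only after an application
    -- of `F.map_id`.
    have e : A.iso (F.mapArrow.mapIso (cellEq (Category.assoc f g h))) =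
        A.iso (cellEq (congrArg F.map (Category.assoc f g h))) :=
      congrArg A.iso (arrowIso_ext (F.map_id _) (F.map_id _))
    exact (hA.assoc_cellEq (F.map_comp g h).symm (F.map_comp f g).symm
      (F.map_comp f (g ≫ h)).symm (F.map_comp (f ≫ g) h).symm
      (congrArg F.map (Category.assoc f g h))).trans
      (congrArg (fun x => _ ≫ _ ≫ _ ≫ x) e.symm)

variable [MonoidalCategory C] [MonoidalCategory C']

/-- Restriction along a strong monoidal functor. -/
def MulData.pullback (A : MulData C' D) (F : MonFunctor C C') : MulData C D where
  toCompData := A.toCompData.pullback F.toFunctor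
  μ φ ψ := A.μ (F.toFunctor.mapArrow.obj φ) (F.toFunctor.mapArrow.obj ψ) ≫ A.iso (F.arrowμ φ ψ)

/-- Equivariance slides `e₁` and `e₂` past the outer multiplication. Associativity of `A.μ` then
leaves only `h`, an equation in the arrow category. For a restriction along `F` it is the
associativity axiom of the structure morphisms of `F`. -/
theorem MulData.MulLaws.assoc_iso {A : MulData C D} (hA : A.Laws) (hA' : A.MulLaws)
    {φ ψ χ φψ ψχ ω ω' : Arrow C} (e₁ : arrowTensor φ ψ ≅ φψ) (e₂ : arrowTensor ψ χ ≅ ψχ)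
    (e₃ : arrowTensor φψ χ ≅ ω) (e₄ : arrowTensor φ ψχ ≅ ω') (e₅ : ω ≅ ω')
    (h : arrowTensorIso e₁ (Iso.refl χ) ≪≫ e₃ ≪≫ e₅ =
      arrowAssoc φ ψ χ ≪≫ arrowTensorIso (Iso.refl φ) e₂ ≪≫ e₄) :
    ((A.μ φ ψ ≫ A.iso e₁) ⊗ₘ 𝟙 (A.obj χ)) ≫ (A.μ φψ χ ≫ A.iso e₃) ≫ A.iso e₅ =
      (α_ _ _ _).hom ≫ (𝟙 (A.obj φ) ⊗ₘ (A.μ ψ χ ≫ A.iso e₂)) ≫ A.μ φ ψχ ≫ A.iso e₄ := by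
  have h₁ : (A.μ φ ψ ≫ A.iso e₁) ⊗ₘ 𝟙 (A.obj χ) =
      (A.μ φ ψ ⊗ₘ 𝟙 _) ≫ (A.iso e₁ ⊗ₘ A.iso (Iso.refl χ)) := by
    rw [hA.iso_refl, tensorHom_comp_tensorHom, Category.comp_id]
  have h₂ : 𝟙 (A.obj φ) ⊗ₘ (A.μ ψ χ ≫ A.iso e₂) =
      (𝟙 _ ⊗ₘ A.μ ψ χ) ≫ (A.iso (Iso.refl φ) ⊗ₘ A.iso e₂) := by
    rw [hA.iso_refl, tensorHom_comp_tensorHom, Category.comp_id]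
  have h₃ := congrArg A.iso h
  simp only [hA.iso_trans] at h₃
  have h₄ := hA'.assoc φ ψ χ
  rw [h₁, h₂]
  simp only [Category.assoc]
  rw [reassoc_of% (hA'.equivariance e₁ (Iso.refl χ)),
    reassoc_of% (hA'.equivariance (Iso.refl φ) e₂), h₃, reassoc_of% h₄]

/-- Equivariance reduces to naturality of the structure morphisms of `F`, associativity to their
associativity axiom, each read once at sources and once at targets. -/
theorem MulData.MulLaws.pullback {A : MulData C' D} (hA : A.Laws) (hA' : A.MulLaws)
    (F : MonFunctor C C') : (A.pullback F).MulLaws where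
  equivariance {φ φ' ψ ψ'} e e' := by
    refine (Category.assoc _ _ _).symm.trans ((congrArg (fun x => x ≫ _)
      (hA'.equivariance (F.toFunctor.mapArrow.mapIso e) (F.toFunctor.mapArrow.mapIso e'))).trans ?_)
    refine (Category.assoc _ _ _).trans (Eq.trans ?_ (Category.assoc _ _ _).symm)
    refine congrArg (fun x => _ ≫ x) ?_
    refine (hA.iso_trans _ _).symm.trans (Eq.trans ?_ (hA.iso_trans _ _))
    exact congrArg A.iso (arrowIso_ext (Functor.LaxMonoidal.μ_natural F.toFunctor _ _)
      (Functor.LaxMonoidal.μ_natural F.toFunctor _ _))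
  assoc φ ψ χ := by
    refine hA'.assoc_iso hA (F.arrowμ φ ψ) (F.arrowμ ψ χ) (F.arrowμ (arrowTensor φ ψ) χ)
      (F.arrowμ φ (arrowTensor ψ χ)) (F.toFunctor.mapArrow.mapIso (arrowAssoc φ ψ χ)) ?_
    refine arrowIso_ext ?_ ?_
    · exact (congrArg (fun x => x ≫ _) (tensorHom_id _ _)).trans
        ((Functor.LaxMonoidal.associativity F.toFunctor _ _ _).trans
          (congrArg (fun x => _ ≫ x ≫ _) (id_tensorHom _ _).symm))
    · exact (congrArg (fun x => x ≫ _) (tensorHom_id _ _)).trans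
        ((Functor.LaxMonoidal.associativity F.toFunctor _ _ _).trans
          (congrArg (fun x => _ ≫ x ≫ _) (id_tensorHom _ _).symm))

/-- Composites are variables as in `assoc_cellEq`, and the structure isomorphisms of a functor
become arbitrary `a`, `b`, `c`. Equivariance of `γ` merges the cells over `(b, c)` and `(a, b)` into
one over `(a, c)`, the middle isomorphism `b` disappearing. Interchange for `A` applies, and the
isomorphisms left at the end agree by `hl` and `hr`. -/
theorem MulData.Interchange.cellEq [BraidedCategory D] {A : MulData C D} (hA : A.Laws)
    (hA'' : A.Interchange) {X Y Z X' Y' Z' XX YY ZZ : C} {f₀ : Y ⟶ Z}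
    {f₁ : X ⟶ Y} {g₀ : Y' ⟶ Z'} {g₁ : X' ⟶ Y'} {p₀ : YY ⟶ ZZ} {p₁ : XX ⟶ YY}
    {f : X ⟶ Z} {g : X' ⟶ Z'} {k : XX ⟶ ZZ} {ω : Arrow C}
    (a : X ⊗ X' ≅ XX) (b : Y ⊗ Y' ≅ YY) (c : Z ⊗ Z' ≅ ZZ)
    (h₀ : b.hom ≫ p₀ = (f₀ ⊗ₘ g₀) ≫ c.hom) (h₁ : a.hom ≫ p₁ = (f₁ ⊗ₘ g₁) ≫ b.hom)
    (hf : f₁ ≫ f₀ = f) (hg : g₁ ≫ g₀ = g) (hk : p₁ ≫ p₀ = k)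
    (e : Arrow.mk k ≅ ω) (e' : arrowTensor (Arrow.mk f) (Arrow.mk g) ≅ ω)
    (hl : e'.hom.left = a.hom ≫ e.hom.left) (hr : e'.hom.right = c.hom ≫ e.hom.right) :
    ((A.μ (Arrow.mk f₀) (Arrow.mk g₀) ≫ A.iso (cell b c h₀)) ⊗ₘ
        (A.μ (Arrow.mk f₁) (Arrow.mk g₁) ≫ A.iso (cell a b h₁))) ≫
      (A.γ p₀ p₁ ≫ A.iso (PlusConstruction.cellEq hk)) ≫ A.iso e =
      tensorμ _ _ _ _ ≫ ((A.γ f₀ f₁ ≫ A.iso (PlusConstruction.cellEq hf)) ⊗ₘ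
        (A.γ g₀ g₁ ≫ A.iso (PlusConstruction.cellEq hg))) ≫
        A.μ (Arrow.mk f) (Arrow.mk g) ≫ A.iso e' := by
  subst hf hg hk
  simp only [hA.iso_cellEq_self, Category.comp_id]
  have h₂ : a.hom ≫ p₁ ≫ p₀ = ((f₁ ⊗ₘ g₁) ≫ (f₀ ⊗ₘ g₀)) ≫ c.hom := by
    rw [reassoc_of% h₁, h₀, Category.assoc]
  have h₃ := hA.equivariance a b c h₀ h₁ h₂
  have h₄ := hA'' f₀ f₁ g₀ g₁
  have h₅ : A.iso (cell a c h₂) ≫ A.iso e = A.iso (PlusConstruction.cellEq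
      (f := (f₁ ⊗ₘ g₁) ≫ (f₀ ⊗ₘ g₀)) (f' := (f₁ ≫ f₀) ⊗ₘ (g₁ ≫ g₀))
      (MonoidalCategory.tensorHom_comp_tensorHom _ _ _ _)) ≫ A.iso e' := by
    refine (hA.iso_trans _ _).symm.trans (Eq.trans ?_ (hA.iso_trans _ _))
    exact congrArg A.iso (arrowIso_ext (hl.symm.trans (Category.id_comp _).symm)
      (hr.symm.trans (Category.id_comp _).symm))
  rw [← tensorHom_comp_tensorHom, Category.assoc]
  erw [reassoc_of% h₃, h₅]
  exact comp_comp_comp_congr h₄ _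

theorem MulData.Interchange.pullback [BraidedCategory D] {A : MulData C' D} (hA : A.Laws)
    (hA'' : A.Interchange) (F : MonFunctor C C') :
    (A.pullback F).Interchange := by
  intro X Y Z X' Y' Z' f₀ f₁ g₀ g₁
  refine hA''.cellEq hA (Functor.Monoidal.μIso F.toFunctor X X')
    (Functor.Monoidal.μIso F.toFunctor Y Y') (Functor.Monoidal.μIso F.toFunctor Z Z')
    (Functor.LaxMonoidal.μ_natural F.toFunctor f₀ g₀).symm
    (Functor.LaxMonoidal.μ_natural F.toFunctor f₁ g₁).symm
    (F.map_comp f₁ f₀).symm (F.map_comp g₁ g₀).symm (F.map_comp _ _).symm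
    (F.toFunctor.mapArrow.mapIso (PlusConstruction.cellEq
      (MonoidalCategory.tensorHom_comp_tensorHom _ _ _ _)))
    (F.arrowμ (Arrow.mk (f₁ ≫ f₀)) (Arrow.mk (g₁ ≫ g₀))) ?_ ?_
  · exact ((congrArg (fun x => _ ≫ x) (F.map_id _)).trans (Category.comp_id _)).symm
  · exact ((congrArg (fun x => _ ≫ x) (F.map_id _)).trans (Category.comp_id _)).symm

/-- After commutativity in `A`, the remaining equation is symmetry of `F` at sources and at targets.
Among the laws, only this one needs a symmetric `F` for its restriction. -/
theorem MulData.Comm.pullback [SymmetricCategory C] [SymmetricCategory C'] [BraidedCategory D]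
    {A : MulData C' D} (hA : A.Laws) (hA' : A.Comm) {F : MonFunctor C C'}
    (hF : F.IsSymmetric) : (A.pullback F).Comm := by
  intro φ ψ
  refine (Category.assoc _ _ _).trans ?_
  have h := hA' (F.toFunctor.mapArrow.obj φ) (F.toFunctor.mapArrow.obj ψ)
  refine Eq.trans ?_ ((congrArg (fun x => x ≫ _) h).trans (Category.assoc _ _ _))
  refine Eq.trans ?_ (Category.assoc _ _ _).symm
  refine congrArg (fun x => _ ≫ x) ?_
  refine (hA.iso_trans _ _).symm.trans (Eq.trans ?_ (hA.iso_trans _ _))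
  exact congrArg A.iso (arrowIso_ext (hF _ _) (hF _ _))

end Pullback

end PlusConstruction

namespace PlusConstruction

/-! #### Faithful monoidal functors reflect the laws -/

section Reflect

variable {D : Type u₂} [Category.{v₂} D] [MonoidalCategory D]
  {E : Type u₃} [Category.{v₃} E] [MonoidalCategory E] (G : D ⥤ E) [G.Monoidal]

theorem tensorμ_eq [BraidedCategory D] (X₁ X₂ Y₁ Y₂ : D) :
    tensorμ X₁ X₂ Y₁ Y₂ = (α_ X₁ X₂ (Y₁ ⊗ Y₂)).hom ≫
      X₁ ◁ ((α_ X₂ Y₁ Y₂).inv ≫ (β_ X₂ Y₁).hom ▷ Y₂ ≫ (α_ Y₁ X₂ Y₂).hom) ≫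
        (α_ X₁ Y₁ (X₂ ⊗ Y₂)).inv := by
  simp [tensorμ]

local notation "m" => Functor.LaxMonoidal.μ G

/-- A strong symmetric monoidal functor respects the interchange of the middle factors of a fourfold
product. -/
theorem map_tensorμ [BraidedCategory D] [BraidedCategory E]
    (hG : ∀ X Y : D, m X Y ≫ G.map (β_ X Y).hom = (β_ (G.obj X) (G.obj Y)).hom ≫ m Y X)
    (X₁ X₂ Y₁ Y₂ : D) :
    (m X₁ X₂ ⊗ₘ m Y₁ Y₂) ≫ m _ _ ≫ G.map (tensorμ X₁ X₂ Y₁ Y₂) =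
      tensorμ _ _ _ _ ≫ (m X₁ Y₁ ⊗ₘ m X₂ Y₂) ≫ m _ _ := by
  -- The inner block, which moves `Y₁` past `X₂` and does not involve `X₁`. The outer associators
  -- are then absorbed by associativity of the structure morphisms.
  have h : G.obj X₂ ◁ m Y₁ Y₂ ≫ m _ _ ≫
      G.map ((α_ X₂ Y₁ Y₂).inv ≫ (β_ X₂ Y₁).hom ▷ Y₂ ≫ (α_ Y₁ X₂ Y₂).hom) =
      ((α_ _ _ _).inv ≫ (β_ _ _).hom ▷ _ ≫ (α_ _ _ _).hom) ≫ G.obj Y₁ ◁ m X₂ Y₂ ≫ m _ _ := by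
    simp only [Functor.map_comp, Category.assoc]
    rw [Functor.LaxMonoidal.associativity_inv_assoc, ← Functor.LaxMonoidal.μ_natural_left_assoc,
      ← comp_whiskerRight_assoc, hG, comp_whiskerRight_assoc, Functor.LaxMonoidal.associativity]
  rw [MonoidalCategory.tensorHom_def', MonoidalCategory.tensorHom_def', tensorμ_eq, tensorμ_eq,
    G.map_comp, G.map_comp]
  simp only [Category.assoc]
  rw [Functor.LaxMonoidal.associativity_assoc, ← Functor.LaxMonoidal.μ_natural_right_assoc]
  have h' := congrArg (fun x => G.obj X₁ ◁ x) h
  simp only [whiskerLeft_comp, Category.assoc] at h' ⊢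
  rw [associator_naturality_right_assoc, reassoc_of% h',
    Functor.LaxMonoidal.associativity_inv]
  simp

variable {G} [G.Faithful]

/-- Since `G` is faithful and its structure morphisms are epimorphisms, an equation may be tested
after applying `G` and precomposing with them; naturality then turns images of products into
products of images. -/
theorem equivariance_of_map {X X' Y Y' Z Z' : D} {a : X ⟶ X'} {b : Y ⟶ Y'} {c : X' ⊗ Y' ⟶ Z'}
    {d : X ⊗ Y ⟶ Z} {e : Z ⟶ Z'}
    (h : (G.map a ⊗ₘ G.map b) ≫ m _ _ ≫ G.map c = (m _ _ ≫ G.map d) ≫ G.map e) :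
    (a ⊗ₘ b) ≫ c = d ≫ e := by
  apply G.map_injective
  rw [← cancel_epi (m _ _), G.map_comp, G.map_comp, ← Functor.LaxMonoidal.μ_natural_assoc, h,
    Category.assoc]

theorem assoc_of_map {X Y Z U V W : D} {p : X ⊗ Y ⟶ U} {q : Y ⊗ Z ⟶ V} {r : U ⊗ Z ⟶ W}
    {s : X ⊗ V ⟶ W}
    (h : ((m _ _ ≫ G.map p) ⊗ₘ 𝟙 (G.obj Z)) ≫ m _ _ ≫ G.map r =
      (α_ _ _ _).hom ≫ (𝟙 (G.obj X) ⊗ₘ (m _ _ ≫ G.map q)) ≫ m _ _ ≫ G.map s) :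
    (p ⊗ₘ 𝟙 Z) ≫ r = (α_ _ _ _).hom ≫ (𝟙 X ⊗ₘ q) ≫ s := by
  apply G.map_injective
  rw [← cancel_epi (m _ _), ← cancel_epi (m X Y ▷ G.obj Z)]
  simp only [tensorHom_id, id_tensorHom, comp_whiskerRight, whiskerLeft_comp, Category.assoc,
    Functor.map_comp] at h ⊢
  rw [Functor.LaxMonoidal.associativity_assoc, ← Functor.LaxMonoidal.μ_natural_left_assoc,
    ← Functor.LaxMonoidal.μ_natural_right_assoc, h]

/-- The new ingredient is `map_tensorμ`: the exchange of the middle factors has to be carried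
through `G` too, and this requires `G` to be braided. -/
theorem interchange_of_map [BraidedCategory D] [BraidedCategory E]
    (hG : ∀ X Y : D, m X Y ≫ G.map (β_ X Y).hom = (β_ (G.obj X) (G.obj Y)).hom ≫ m Y X)
    {X₁ X₂ Y₁ Y₂ U V W U' V' : D} {p : X₁ ⊗ X₂ ⟶ U} {q : Y₁ ⊗ Y₂ ⟶ V} {r : U ⊗ V ⟶ W}
    {x : X₁ ⊗ Y₁ ⟶ U'} {y : X₂ ⊗ Y₂ ⟶ V'} {z : U' ⊗ V' ⟶ W}
    (h : ((m _ _ ≫ G.map p) ⊗ₘ (m _ _ ≫ G.map q)) ≫ m _ _ ≫ G.map r =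
      tensorμ _ _ _ _ ≫ ((m _ _ ≫ G.map x) ⊗ₘ (m _ _ ≫ G.map y)) ≫ m _ _ ≫ G.map z) :
    (p ⊗ₘ q) ≫ r = tensorμ _ _ _ _ ≫ (x ⊗ₘ y) ≫ z := by
  apply G.map_injective
  rw [← cancel_epi (m _ _), ← cancel_epi (m X₁ X₂ ⊗ₘ m Y₁ Y₂)]
  simp only [← tensorHom_comp_tensorHom, Category.assoc, Functor.map_comp] at h ⊢
  rw [reassoc_of% (map_tensorμ G hG), ← Functor.LaxMonoidal.μ_natural_assoc,
    ← Functor.LaxMonoidal.μ_natural_assoc, h]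

end Reflect

/-! ### Images of algebras under a strong monoidal functor -/

section Reflect

variable {C : Type u₁} [Category.{v₁} C] {D : Type u₂} [Category.{v₂} D] [MonoidalCategory D]
  {E : Type u₃} [Category.{v₃} E] [MonoidalCategory E] (G : D ⥤ E) [G.Monoidal]

local notation "m" => Functor.LaxMonoidal.μ G

/-- The image under a strong monoidal functor. -/
def CompData.map (A : CompData C D) : CompData C E where
  obj φ := G.obj (A.obj φ)
  iso e := G.map (A.iso e)
  γ g f := Functor.LaxMonoidal.μ G _ _ ≫ G.map (A.γ g f)

variable {G}

/-- This and its companions are used with `G = I.forget`: laws established in the target `D` become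
laws in `I.Induced`, where words are evaluated. -/
theorem CompData.Laws.of_map [G.Faithful] {A : CompData C D} (hA : (A.map G).Laws) : A.Laws where
  iso_refl φ := G.map_injective ((hA.iso_refl φ).trans (G.map_id _).symm)
  iso_trans e e' := G.map_injective ((hA.iso_trans e e').trans (G.map_comp _ _).symm)
  equivariance a b c hg hf hh := equivariance_of_map (hA.equivariance a b c hg hf hh)
  assoc h g f := assoc_of_map ((hA.assoc h g f).trans (by
    rw [G.map_comp]; exact congrArg (fun x => _ ≫ _ ≫ x) (Category.assoc _ _ _)))

variable [MonoidalCategory C]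

variable (G) in
/-- The image under a strong monoidal functor. -/
def MulData.map (A : MulData C D) : MulData C E where
  toCompData := A.toCompData.map G
  μ φ ψ := Functor.LaxMonoidal.μ G _ _ ≫ G.map (A.μ φ ψ)

theorem MulData.MulLaws.of_map [G.Faithful] {A : MulData C D} (hA : (A.map G).MulLaws) :
    A.MulLaws where
  equivariance e e' := equivariance_of_map (hA.equivariance e e')
  assoc φ ψ χ := assoc_of_map ((hA.assoc φ ψ χ).symm.trans (by
    rw [G.map_comp]; exact congrArg (fun x => _ ≫ x) (Category.assoc _ _ _))).symm

theorem MulData.Comm.of_map [SymmetricCategory C] [BraidedCategory D] [BraidedCategory E]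
    [G.Faithful]
    (hG : ∀ X Y : D, m X Y ≫ G.map (β_ X Y).hom = (β_ (G.obj X) (G.obj Y)).hom ≫ m Y X)
    {A : MulData C D} (hA : (A.map G).Comm) : A.Comm := by
  intro φ ψ
  apply G.map_injective
  have h := hA φ ψ
  rw [← cancel_epi (m _ _), G.map_comp, G.map_comp, reassoc_of% hG]
  exact (Category.assoc _ _ _).symm.trans h

theorem MulData.Interchange.of_map [BraidedCategory D] [BraidedCategory E] [G.Faithful]
    (hG : ∀ X Y : D, m X Y ≫ G.map (β_ X Y).hom = (β_ (G.obj X) (G.obj Y)).hom ≫ m Y X)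
    {A : MulData C D} (hA : (A.map G).Interchange) : A.Interchange := by
  intro X Y Z X' Y' Z' f₀ f₁ g₀ g₁
  refine interchange_of_map hG (Eq.trans ?_ (hA f₀ f₁ g₀ g₁))
  exact (congrArg (fun x => _ ≫ _ ≫ x) (G.map_comp _ _)).trans
    (congrArg (fun x => _ ≫ x) (Category.assoc _ _ _).symm)

end Reflect

end PlusConstruction

namespace PlusConstruction

/-! ### The algebras given by words -/

/-- The right-hand side has the shape of the word `Signature.Word.middleSwap`, so that the
interchange relation matches definitionally. -/
theorem tensorμ_eq_tensorHom {D : Type u₂} [Category.{v₂} D] [MonoidalCategory D]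
    [BraidedCategory D] (X₁ X₂ Y₁ Y₂ : D) :
    tensorμ X₁ X₂ Y₁ Y₂ = (α_ X₁ X₂ (Y₁ ⊗ Y₂)).hom ≫
      (𝟙 X₁ ⊗ₘ ((α_ X₂ Y₁ Y₂).inv ≫ ((β_ X₂ Y₁).hom ⊗ₘ 𝟙 Y₂) ≫ (α_ Y₁ X₂ Y₂).hom)) ≫
        (α_ X₁ Y₁ (X₂ ⊗ Y₂)).inv := by
  rw [tensorHom_id, id_tensorHom, tensorμ_eq]

section Generated

variable {P : Presentation.{w₁}} {C : Type u₁} [Category.{v₁} C]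

/-- The algebra of generators in the category generated by them. -/
def Letters.data (L : Letters C P.toSignature) : CompData C P.Cat where
  obj := L.toCat
  iso := L.isoHom
  γ := L.γHom

theorem Presentation.hom_eq {X Y : P.Obj} {f g : P.Word X Y} (h : P.Rel f g) :
    Presentation.hom f = Presentation.hom g :=
  Quotient.sound (Presentation.Eqv.of h)

/-- General equivariance is inner equivariance along `b` followed by outer equivariance along `a`
and `c`. The pairs of cells are factored accordingly, and functoriality of `iso` recombines the
results. -/
theorem Letters.laws {L : Letters C P.toSignature}
    (hL : ∀ ⦃X Y : P.Obj⦄ ⦃f g : P.Word X Y⦄, CompRel L f g → P.Rel f g) : L.data.Laws where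
  iso_refl φ := Presentation.hom_eq (hL (.iso_refl φ))
  iso_trans e e' := Presentation.hom_eq (hL (.iso_trans e e'))
  equivariance {X Y Z X' Y' Z' g f g' f'} a b c hg hf hh := by
    -- The commuting squares determine `g'` and `f'`; they are bracketed so that `b` acts first, as
    -- inner equivariance requires.
    obtain rfl : g' = (b.inv ≫ g) ≫ c.hom := by rw [Category.assoc, ← hg, Iso.inv_hom_id_assoc]
    obtain rfl : f' = a.inv ≫ f ≫ b.hom := by rw [← hf, Iso.inv_hom_id_assoc]
    have h₁ : (L.isoHom (cell (f := g) (f' := b.inv ≫ g) b (Iso.refl _)) ⊗ₘ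
        L.isoHom (cell (f := f) (f' := f ≫ b.hom) (Iso.refl _) b)) ≫
          L.γHom (b.inv ≫ g) (f ≫ b.hom) = L.γHom g f ≫ L.isoHom cellEq := Presentation.hom_eq (hL (.inner g f b))
    have h₂ : (L.isoHom (cell (f := b.inv ≫ g) (f' := (b.inv ≫ g) ≫ c.hom) (Iso.refl _) c) ⊗ₘ
        L.isoHom (cell (f := f ≫ b.hom) (f' := a.inv ≫ f ≫ b.hom) a (Iso.refl _))) ≫
          L.γHom ((b.inv ≫ g) ≫ c.hom) (a.inv ≫ f ≫ b.hom) =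
            L.γHom (b.inv ≫ g) (f ≫ b.hom) ≫ L.isoHom (cell a c) := Presentation.hom_eq (hL (.outer (b.inv ≫ g) (f ≫ b.hom) a c))
    have it : ∀ {φ ψ χ : Arrow C} (e : φ ≅ ψ) (e' : ψ ≅ χ),
      L.isoHom (e ≪≫ e') = L.isoHom e ≫ L.isoHom e' :=
        fun e e' => Presentation.hom_eq (hL (.iso_trans e e'))
    have k₁ : L.data.iso (cell b c hg) = L.isoHom (cell (f := g) (f' := b.inv ≫ g) b (Iso.refl _)) ≫
        L.isoHom (cell (f := b.inv ≫ g) (f' := (b.inv ≫ g) ≫ c.hom) (Iso.refl _) c) := by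
      rw [← it]
      exact congrArg L.isoHom (arrowIso_ext (Category.comp_id _).symm (Category.id_comp _).symm)
    have k₂ : L.data.iso (cell a b hf) = L.isoHom (cell (f := f) (f' := f ≫ b.hom) (Iso.refl _) b) ≫
        L.isoHom (cell (f := f ≫ b.hom) (f' := a.inv ≫ f ≫ b.hom) a (Iso.refl _)) := by
      rw [← it]
      exact congrArg L.isoHom (arrowIso_ext (Category.id_comp _).symm (Category.comp_id _).symm)
    rw [k₁, k₂]
    refine (congrArg (fun x => x ≫ _) (tensorHom_comp_tensorHom _ _ _ _).symm).trans ?_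
    refine (Category.assoc _ _ _).trans ((congrArg (fun x => _ ≫ x) h₂).trans ?_)
    refine (Category.assoc _ _ _).symm.trans ((congrArg (fun x => x ≫ _) h₁).trans ?_)
    refine (Category.assoc _ _ _).trans (congrArg (fun x => _ ≫ x) ?_)
    refine (it _ _).symm.trans ?_
    exact congrArg L.isoHom (arrowIso_ext (Category.id_comp _) (Category.id_comp _))
  assoc h g f := Presentation.hom_eq (hL (.assoc h g f))

variable [MonoidalCategory C]

/-- The algebra of generators in the category generated by them. -/
def MulLetters.data (L : MulLetters C P.toSignature) : MulData C P.Cat where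
  toCompData := L.toLetters.data
  μ := L.μHom

theorem MulLetters.mulLaws {L : MulLetters C P.toSignature}
    (hL : ∀ ⦃X Y : P.Obj⦄ ⦃f g : P.Word X Y⦄, MulRel L f g → P.Rel f g) : L.data.MulLaws where
  equivariance e e' := Presentation.hom_eq (hL (.equivariance e e'))
  assoc φ ψ χ := Presentation.hom_eq (hL (.assoc φ ψ χ))

theorem MulLetters.interchange {L : MulLetters C P.toSignature}
    (hL : ∀ ⦃X Y : P.Obj⦄ ⦃f g : P.Word X Y⦄, InterchangeRel L f g → P.Rel f g) (hS : P.symm) :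
    letI := P.symmetricCategory hS
    L.data.Interchange := by
  intro X Y Z X' Y' Z' f₀ f₁ g₀ g₁
  let _ := P.symmetricCategory hS
  rw [tensorμ_eq_tensorHom]
  exact Presentation.hom_eq (hL (.interchange hS f₀ f₁ g₀ g₁))

theorem MulLetters.comm [SymmetricCategory C] {L : MulLetters C P.toSignature}
    (hL : ∀ ⦃X Y : P.Obj⦄ ⦃f g : P.Word X Y⦄, CommRel L f g → P.Rel f g) (hS : P.symm) :
    letI := P.symmetricCategory hS
    L.data.Comm := by
  intro φ ψ
  exact Presentation.hom_eq (hL (.comm hS φ ψ))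

end Generated

/-! ### Laws in the target imply the relations between evaluated words -/

section Interpreted

variable {S : Signature.{w₁}} {C : Type u₁} [Category.{v₁} C] {D : Type u₂} [Category.{v₂} D]
  [MonoidalCategory D] (I : Interp S D)

/-- The interpretation of the letters. -/
def Interp.inducedData (L : Letters C S) : CompData C I.Induced where
  obj := L.obj
  iso e := I.eval (L.iso e)
  γ g f := I.eval (L.γ g f)

/-- The interpretation of the letters. -/
def Interp.compData (L : Letters C S) : CompData C D where
  obj φ := I.obj (L.obj φ)
  iso e := I.eval (L.iso e)
  γ g f := (I.μ _ _).hom ≫ I.forget.map (I.eval (L.γ g f))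

variable {I}

/-- The laws are assumed for the data in `D`, where `γ` includes the comparison `I.μ`; they are
reflected to `I.Induced`, and there the relations are instances of them. -/
theorem CompData.Laws.eval_eq {L : Letters C S} (hI : (I.compData L).Laws) ⦃X Y : S.Obj⦄
    ⦃f g : S.Word X Y⦄ (h : CompRel L f g) : I.eval f = I.eval g := by
  have hA : (I.inducedData L).Laws := CompData.Laws.of_map (G := I.forget) hI
  cases h with
  | iso_refl φ => exact hA.iso_refl φ
  | iso_trans e e' => exact hA.iso_trans e e'
  | inner g f σ => exact hA.equivariance (Iso.refl _) σ (Iso.refl _) _ _ _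
  | outer g f σ σ' => exact hA.equivariance σ (Iso.refl _) σ' _ _ _
  | assoc h g f => exact hA.assoc h g f

variable [MonoidalCategory C]

variable (I) in
/-- The interpretation of the letters. -/
def Interp.inducedMulData (L : MulLetters C S) : MulData C I.Induced where
  toCompData := I.inducedData L.toLetters
  μ φ ψ := I.eval (L.μ φ ψ)

variable (I) in
/-- The interpretation of the letters. -/
def Interp.mulData (L : MulLetters C S) : MulData C D where
  toCompData := I.compData L.toLetters
  μ φ ψ := (I.μ _ _).hom ≫ I.forget.map (I.eval (L.μ φ ψ))

theorem MulData.MulLaws.eval_eq {L : MulLetters C S} (hI : (I.mulData L).MulLaws) ⦃X Y : S.Obj⦄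
    ⦃f g : S.Word X Y⦄ (h : MulRel L f g) : I.eval f = I.eval g := by
  have hA : (I.inducedMulData L).MulLaws := MulData.MulLaws.of_map (G := I.forget) hI
  cases h with
  | equivariance e e' => exact hA.equivariance e e'
  | assoc φ ψ χ => exact hA.assoc φ ψ χ

theorem Interp.forget_braided (h : S.symm) (X Y : I.Induced) :
    letI := I.sym h
    letI := I.symmetricCategory h
    Functor.LaxMonoidal.μ I.forget X Y ≫ I.forget.map (β_ X Y).hom =
      (β_ (I.forget.obj X) (I.forget.obj Y)).hom ≫ Functor.LaxMonoidal.μ I.forget Y X :=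
  Iso.hom_inv_id_assoc _ _

theorem MulData.Interchange.eval_eq {L : MulLetters C S}
    (hI : ∀ h : S.symm, letI := I.sym h; (I.mulData L).Interchange) ⦃X Y : S.Obj⦄
    ⦃f g : S.Word X Y⦄ (h : InterchangeRel L f g) : I.eval f = I.eval g := by
  cases h with
  | interchange hS f₀ f₁ g₀ g₁ =>
    let _ := I.sym hS
    let _ := I.symmetricCategory hS
    have hA : (I.inducedMulData L).Interchange :=
      MulData.Interchange.of_map (G := I.forget) (I.forget_braided hS) (hI hS)
    have := hA f₀ f₁ g₀ g₁
    rw [tensorμ_eq_tensorHom] at this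
    exact this

theorem MulData.Comm.eval_eq [SymmetricCategory C] {L : MulLetters C S}
    (hI : ∀ h : S.symm, letI := I.sym h; (I.mulData L).Comm) ⦃X Y : S.Obj⦄
    ⦃f g : S.Word X Y⦄ (h : CommRel L f g) : I.eval f = I.eval g := by
  cases h with
  | comm hS φ ψ =>
    let _ := I.sym hS
    let _ := I.symmetricCategory hS
    have hA : (I.inducedMulData L).Comm :=
      MulData.Comm.of_map (G := I.forget) (I.forget_braided hS) (hI hS)
    exact hA φ ψ

end Interpreted

end PlusConstruction

namespace PlusConstruction

/-! ### Monoidal natural transformations between functors on a generated category -/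

section Families

variable {C : Type u₁} [Category.{v₁} C] [MonoidalCategory C] {D : Type u₂} [Category.{v₂} D]
  [MonoidalCategory D]

open Functor.LaxMonoidal (ε μ)

/-- A family of morphisms that is compatible with the structure morphisms of two functors. -/
structure IsMonoidalFamily {Q R : MonFunctor C D} (t : ∀ X, Q.obj X ⟶ R.obj X) : Prop where
  unit : ε Q.toFunctor ≫ t (𝟙_ C) = ε R.toFunctor
  tensor (X Y : C) : μ Q.toFunctor X Y ≫ t (X ⊗ Y) = (t X ⊗ₘ t Y) ≫ μ R.toFunctor X Y

namespace IsMonoidalFamily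

variable {Q R : MonFunctor C D} {t : ∀ X, Q.obj X ⟶ R.obj X} (ht : IsMonoidalFamily t)

include ht

/-- With the lemmas that follow, this shows that the morphisms on which `t` is natural are closed
under products and contain all structural morphisms. In each case one cancels structure morphisms of
`Q` and uses compatibility of `t` to pass to `R`. -/
theorem natural_tensorHom {X Y X' Y' : C} {f : X ⟶ Y} {g : X' ⟶ Y'}
    (hf : Q.map f ≫ t Y = t X ≫ R.map f) (hg : Q.map g ≫ t Y' = t X' ≫ R.map g) :
    Q.map (f ⊗ₘ g) ≫ t (Y ⊗ Y') = t (X ⊗ X') ≫ R.map (f ⊗ₘ g) := by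
  rw [← cancel_epi (μ Q.toFunctor X X'), ← Functor.LaxMonoidal.μ_natural_assoc, ht.tensor,
    tensorHom_comp_tensorHom_assoc, hf, hg, reassoc_of% (ht.tensor X X'),
    ← Functor.LaxMonoidal.μ_natural, tensorHom_comp_tensorHom_assoc]

theorem natural_associator (X Y Z : C) :
    Q.map (α_ X Y Z).hom ≫ t _ = t _ ≫ R.map (α_ X Y Z).hom := by
  rw [← cancel_epi (μ Q.toFunctor (X ⊗ Y) Z), ← cancel_epi (μ Q.toFunctor X Y ▷ Q.obj Z),
    Functor.LaxMonoidal.associativity_assoc, ht.tensor, reassoc_of% (ht.tensor (X ⊗ Y) Z),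
    ← tensorHom_id, tensorHom_comp_tensorHom_assoc, ht.tensor, Category.id_comp,
    ← id_tensorHom, tensorHom_comp_tensorHom_assoc, ht.tensor, Category.id_comp]
  have h₁ : ((t X ⊗ₘ t Y) ≫ μ R.toFunctor X Y) ⊗ₘ t Z =
      ((t X ⊗ₘ t Y) ⊗ₘ t Z) ≫ (μ R.toFunctor X Y ▷ _) := by
    rw [← tensorHom_id, tensorHom_comp_tensorHom, Category.comp_id]
  have h₂ : t X ⊗ₘ ((t Y ⊗ₘ t Z) ≫ μ R.toFunctor Y Z) =
      (t X ⊗ₘ (t Y ⊗ₘ t Z)) ≫ (_ ◁ μ R.toFunctor Y Z) := by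
    rw [← id_tensorHom, tensorHom_comp_tensorHom, Category.comp_id]
  rw [h₁, h₂, Category.assoc, Category.assoc, Functor.LaxMonoidal.associativity,
    associator_naturality_assoc]

theorem natural_leftUnitor (X : C) : Q.map (λ_ X).hom ≫ t _ = t _ ≫ R.map (λ_ X).hom := by
  rw [← cancel_epi (μ Q.toFunctor (𝟙_ C) X), ← cancel_epi (ε Q.toFunctor ▷ Q.obj X),
    reassoc_of% (ht.tensor (𝟙_ C) X), ← Functor.LaxMonoidal.left_unitality_assoc,
    ← tensorHom_id, tensorHom_comp_tensorHom_assoc, ht.unit, Category.id_comp]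
  have h₁ : ε R.toFunctor ⊗ₘ t X = (_ ◁ t X) ≫ (ε R.toFunctor ▷ _) := by
    rw [MonoidalCategory.tensorHom_def']
  rw [h₁, Category.assoc, ← Functor.LaxMonoidal.left_unitality, leftUnitor_naturality]

theorem natural_rightUnitor (X : C) : Q.map (ρ_ X).hom ≫ t _ = t _ ≫ R.map (ρ_ X).hom := by
  rw [← cancel_epi (μ Q.toFunctor X (𝟙_ C)), ← cancel_epi (Q.obj X ◁ ε Q.toFunctor),
    reassoc_of% (ht.tensor X (𝟙_ C)), ← Functor.LaxMonoidal.right_unitality_assoc,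
    ← id_tensorHom, tensorHom_comp_tensorHom_assoc, ht.unit, Category.id_comp]
  have h₁ : t X ⊗ₘ ε R.toFunctor = (t X ▷ _) ≫ (_ ◁ ε R.toFunctor) := by
    rw [MonoidalCategory.tensorHom_def]
  rw [h₁, Category.assoc, ← Functor.LaxMonoidal.right_unitality, rightUnitor_naturality]

theorem natural_braiding [SymmetricCategory C] [SymmetricCategory D] (hQ : Q.IsSymmetric)
    (hR : R.IsSymmetric) (X Y : C) :
    Q.map (β_ X Y).hom ≫ t _ = t _ ≫ R.map (β_ X Y).hom := by
  rw [← cancel_epi (μ Q.toFunctor X Y), reassoc_of% (hQ X Y), reassoc_of% (ht.tensor X Y), hR,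
    ht.tensor, BraidedCategory.braiding_naturality_assoc]

omit ht in
-- Besides the inverse constraints, this takes care of the generators `μ⁻¹` of `M^{loc+}`.
theorem natural_inv {X Y : C} {e : X ≅ Y} (h : Q.map e.hom ≫ t Y = t X ≫ R.map e.hom) :
    Q.map e.inv ≫ t X = t Y ≫ R.map e.inv := by
  rw [← cancel_epi (Q.map e.hom), reassoc_of% h, ← Functor.map_comp_assoc, e.hom_inv_id,
    ← Functor.map_comp, e.hom_inv_id]
  simp

end IsMonoidalFamily

/-- A natural family of isomorphisms compatible with the structure morphisms, as an isomorphism of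
strong monoidal functors. -/
def MonFunctor.isoOfFamily {Q R : MonFunctor C D} (t : ∀ X, Q.obj X ≅ R.obj X)
    (ht : IsMonoidalFamily fun X => (t X).hom)
    (hn : ∀ {X Y : C} (f : X ⟶ Y), Q.map f ≫ (t Y).hom = (t X).hom ≫ R.map f) : Q ≅ R :=
  MonFunctor.isoMk (NatIso.ofComponents t hn) ⟨ht.unit, ht.tensor⟩

/-- It suffices to compare `ε` and `μ`: the oplax half of a strong monoidal structure consists of
their inverses. -/
theorem MonFunctor.ext_of_eq {Q R : MonFunctor C D} (h : Q.toFunctor = R.toFunctor)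
    (hε : ε Q.toFunctor ≫ eqToHom (congrArg (fun G => G.obj (𝟙_ C)) h) = ε R.toFunctor)
    (hμ : ∀ X Y, μ Q.toFunctor X Y ≫ eqToHom (congrArg (fun G => G.obj (X ⊗ Y)) h) =
      (eqToHom (congrArg (fun G => G.obj X) h) ⊗ₘ eqToHom (congrArg (fun G => G.obj Y) h)) ≫
        μ R.toFunctor X Y) : Q = R := by
  obtain @⟨Q, mQ⟩ := Q
  obtain @⟨R, mR⟩ := R
  obtain rfl : Q = R := h
  have h₁ : mQ.toLaxMonoidal.ε = mR.toLaxMonoidal.ε := by simpa using hε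
  have h₂ : mQ.toLaxMonoidal.μ = mR.toLaxMonoidal.μ := by
    funext X Y; simpa using hμ X Y
  congr 1
  -- The two remaining goals are equalities of `η` and of `δ`, which follow by uniqueness of
  -- inverses.
  refine Functor.Monoidal.ext h₁ h₂ ?_ ?_
  · have a := mQ.ε_η
    have b := mR.ε_η
    have c := mQ.η_ε
    rw [← Category.comp_id mQ.toOplaxMonoidal.η, ← Category.id_comp mR.toOplaxMonoidal.η, ← c,
      Category.assoc]
    congr 1
    rw [h₁]
    exact b.symm
  · funext X Y
    have b := mR.μ_δ X Y
    have c := mQ.δ_μ X Y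
    rw [← Category.comp_id (mQ.toOplaxMonoidal.δ X Y), ← Category.id_comp (mR.toOplaxMonoidal.δ X Y),
      ← c, Category.assoc]
    congr 1
    rw [h₂]
    exact b.symm

/-- Strong monoidal functors are equal if identities form a monoidal natural transformation between
them. -/
theorem MonFunctor.eq_of_trans {Q R : MonFunctor C D} (A : Q ⟶ R)
    (h : ∀ X, ∃ e : Q.obj X = R.obj X, A.hom.app X = eqToHom e) : Q = R := by
  choose e he using h
  have hf : Q.toFunctor = R.toFunctor := CategoryTheory.Functor.ext e fun X Y f => by
    -- Naturality of a transformation with components `eqToHom` says that the functors agree on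
    -- morphisms; the unit and product axioms of `A` then compare `ε` and `μ`.
    have := A.hom.naturality f
    rw [he, he] at this
    rw [← reassoc_of% this, eqToHom_trans, eqToHom_refl, Category.comp_id]
  refine MonFunctor.ext_of_eq hf ?_ fun X Y => ?_
  · rw [← he]; exact A.isMonoidal.unit
  · rw [← he, ← he, ← he]; exact A.isMonoidal.tensor X Y

end Families

end PlusConstruction

namespace PlusConstruction

open Functor.LaxMonoidal (ε μ)

/-! ### Naturality is checked on generators -/

section Generated

variable {P : Presentation.{w₁}} {P' : Presentation.{w₂}}

/-- The functor respects the braidings, if there are any. -/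
def MonFunctor.PreservesBraiding (Q : MonFunctor P.Cat P'.Cat) : Prop :=
  ∀ h : P.symm, ∃ h' : P'.symm,
    letI := P.symmetricCategory h
    letI := P'.symmetricCategory h'
    Q.IsSymmetric

/-- Every morphism is represented by a word, and the induction runs over the letters of the word.
Braidings require that both functors respect them. -/
theorem IsMonoidalFamily.natural_of_gen {Q R : MonFunctor P.Cat P'.Cat}
    {t : ∀ X, Q.obj X ⟶ R.obj X} (ht : IsMonoidalFamily t) (hQ : Q.PreservesBraiding)
    (hR : R.PreservesBraiding)
    (hgen : ∀ {X Y : P.Obj} (g : P.Gen X Y), Q.map (Presentation.hom (.gen g)) ≫ t Y =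
      t X ≫ R.map (Presentation.hom (.gen g))) {X Y : P.Cat} (f : X ⟶ Y) :
    Q.map f ≫ t Y = t X ≫ R.map f := by
  obtain ⟨f, rfl⟩ := Quotient.exists_rep f
  induction f with
  | gen g => exact hgen g
  | ident X =>
    exact ((congrArg (fun x => x ≫ _) (Q.map_id _)).trans (Category.id_comp _)).trans
      ((congrArg (fun x => _ ≫ x) (R.map_id _)).trans (Category.comp_id _)).symm
  | @comp X Y Z f g hf hg =>
    have h : ∀ {X Y Z : P.Cat} (f : X ⟶ Y) (g : Y ⟶ Z), Q.map f ≫ t Y = t X ≫ R.map f →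
        Q.map g ≫ t Z = t Y ≫ R.map g → Q.map (f ≫ g) ≫ t Z = t X ≫ R.map (f ≫ g) := by
      intro X Y Z f g hf hg
      rw [Functor.map_comp, Functor.map_comp, Category.assoc, hg, reassoc_of% hf]
    exact h _ _ hf hg
  | tensor f g hf hg => exact ht.natural_tensorHom hf hg
  | assocHom X Y Z => exact ht.natural_associator (C := P.Cat) X Y Z
  | assocInv X Y Z => exact natural_inv (ht.natural_associator (C := P.Cat) X Y Z)
  | leftUnitHom X => exact ht.natural_leftUnitor (C := P.Cat) X
  | leftUnitInv X => exact natural_inv (ht.natural_leftUnitor (C := P.Cat) X)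
  | rightUnitHom X => exact ht.natural_rightUnitor (C := P.Cat) X
  | rightUnitInv X => exact natural_inv (ht.natural_rightUnitor (C := P.Cat) X)
  | braid h X Y =>
    -- Both functors provide a proof of `P'.symm`; by proof irrelevance these give the same
    -- symmetric structure, so one is dropped.
    obtain ⟨h', hQ⟩ := hQ h
    obtain ⟨_, hR⟩ := hR h
    let _ := P.symmetricCategory h
    let _ := P'.symmetricCategory h'
    exact ht.natural_braiding (C := P.Cat) hQ hR X Y

end Generated

/-! ### Naturality with respect to composition and multiplication morphisms -/

section Letters

variable {D : Type u₃} [Category.{v₃} D] [MonoidalCategory D]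

/-- The isomorphisms `e` and `d` stand for the equalities between `Q` or `R` of a letter and the
letter of its image. After cancelling the epimorphism `μQ`, they meet in inverse pairs and only
`hs`, the equation inside the target construction, is left. -/
theorem natural_of_squares {q₁ q₂ q₃ q r₁ r₂ r₃ r a₁ a₂ a₃ a b₁ b₂ b₃ b : D}
    (e₁ : q₁ ≅ a₁) (e₂ : q₂ ≅ a₂) (e₃ : q₃ ≅ a₃) (d₁ : r₁ ≅ b₁) (d₂ : r₂ ≅ b₂) (d₃ : r₃ ≅ b₃)
    {μQ : q₁ ⊗ q₂ ⟶ q} [Epi μQ] {μR : r₁ ⊗ r₂ ⟶ r} {m : q ⟶ q₃} {n : r ⟶ r₃}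
    {c : a₁ ⊗ a₂ ⟶ a} {i : a ⟶ a₃} {c' : b₁ ⊗ b₂ ⟶ b} {i' : b ⟶ b₃}
    (hm : μQ ≫ m = (e₁.hom ⊗ₘ e₂.hom) ≫ c ≫ i ≫ e₃.inv)
    (hn : μR ≫ n = (d₁.hom ⊗ₘ d₂.hom) ≫ c' ≫ i' ≫ d₃.inv)
    {s₁ : a₁ ⟶ b₁} {s₂ : a₂ ⟶ b₂} {s₃ : a₃ ⟶ b₃}
    (hs : (s₁ ⊗ₘ s₂) ≫ c' ≫ i' = (c ≫ i) ≫ s₃)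
    {t₁ : q₁ ⟶ r₁} {t₂ : q₂ ⟶ r₂} {t₃ : q₃ ⟶ r₃} {t : q ⟶ r}
    (h₁ : t₁ = e₁.hom ≫ s₁ ≫ d₁.inv) (h₂ : t₂ = e₂.hom ≫ s₂ ≫ d₂.inv)
    (h₃ : t₃ = e₃.hom ≫ s₃ ≫ d₃.inv) (ht : μQ ≫ t = (t₁ ⊗ₘ t₂) ≫ μR) :
    m ≫ t₃ = t ≫ n := by
  subst h₁ h₂ h₃
  rw [← cancel_epi μQ, reassoc_of% hm, reassoc_of% ht, hn, Iso.inv_hom_id_assoc,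
    tensorHom_comp_tensorHom_assoc]
  simp only [Category.assoc, Iso.inv_hom_id, Category.comp_id]
  rw [← reassoc_of% hs]
  simp

end Letters

section Extends

variable {C : Type u₁} [Category.{v₁} C] {C' : Type u₂} [Category.{v₂} C']
  {P : Presentation.{w₁}} {P' : Presentation.{w₂}} {F G : C ⥤ C'} {α : F ≅ G}

/-- A family of morphisms given by a natural isomorphism on the morphisms of `C`. -/
def IsExtensionFamily (α : F ≅ G) (L : Letters C P.toSignature) (L' : Letters C' P'.toSignature)
    {Q R : MonFunctor P.Cat P'.Cat} (t : ∀ X, Q.obj X ⟶ R.obj X) : Prop :=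
  ∀ φ : Arrow C, ∃ (hQ : Q.obj (L.toCat φ) = L'.toCat (F.mapArrow.obj φ))
    (hR : L'.toCat (G.mapArrow.obj φ) = R.obj (L.toCat φ)),
    t (L.toCat φ) = eqToHom hQ ≫ L'.isoHom (Arrow.isoOfNatIso α φ) ≫ eqToHom hR

variable {L : Letters C P.toSignature} {L' : Letters C' P'.toSignature}
  {Q R : MonFunctor P.Cat P'.Cat} {t : ∀ X, Q.obj X ⟶ R.obj X}

/-- By functoriality of the isomorphisms this is naturality of `α` at the source and at the target
components of `e`. -/
theorem Extends.natural_isoHom (hQ : Extends F L L' Q) (hR : Extends G L L' R)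
    (hL : L'.data.Laws) (h : IsExtensionFamily α L L' t) {φ ψ : Arrow C} (e : φ ≅ ψ) :
    Q.map (L.isoHom e) ≫ t _ = t _ ≫ R.map (L.isoHom e) := by
  obtain ⟨_, _, h₁⟩ := h φ
  obtain ⟨_, _, h₂⟩ := h ψ
  have h₃ : L'.isoHom (F.mapArrow.mapIso e) ≫ L'.isoHom (Arrow.isoOfNatIso α ψ) =
      L'.isoHom (Arrow.isoOfNatIso α φ) ≫ L'.isoHom (G.mapArrow.mapIso e) := by
    refine (hL.iso_trans _ _).symm.trans (Eq.trans ?_ (hL.iso_trans _ _))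
    exact congrArg L'.isoHom (arrowIso_ext (α.hom.naturality _) (α.hom.naturality _))
  rw [h₁, h₂, hQ.iso, hR.iso]
  simp only [Category.assoc, eqToHom_trans_assoc, eqToHom_refl, Category.id_comp]
  rw [reassoc_of% h₃]

/-- This is equivariance of `γ` along the three components of `α` at `X`, `Y`, `Z`: its naturality
squares at `g` and `f` are the commuting squares that the law asks for. -/
theorem Extends.natural_γHom (hQ : Extends F L L' Q) (hR : Extends G L L' R)
    (hL : L'.data.Laws) (ht : IsMonoidalFamily t) (h : IsExtensionFamily α L L' t)
    {X Y Z : C} (g : Y ⟶ Z) (f : X ⟶ Y) :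
    Q.map (L.γHom g f) ≫ t _ = t _ ≫ R.map (L.γHom g f) := by
  obtain ⟨_, _, h₁⟩ := h (Arrow.mk g)
  obtain ⟨_, _, h₂⟩ := h (Arrow.mk f)
  obtain ⟨_, _, h₃⟩ := h (Arrow.mk (f ≫ g))
  refine natural_of_squares (eqToIso (hQ.obj (Arrow.mk g))) (eqToIso (hQ.obj (Arrow.mk f)))
    (eqToIso (hQ.obj (Arrow.mk (f ≫ g)))) (eqToIso (hR.obj (Arrow.mk g)))
    (eqToIso (hR.obj (Arrow.mk f))) (eqToIso (hR.obj (Arrow.mk (f ≫ g))))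
    (hQ.γ g f) (hR.γ g f) ?_ h₁ h₂ h₃ (ht.tensor _ _)
  have h₄ := hL.equivariance (α.app X) (α.app Y) (α.app Z) (g := F.map g) (f := F.map f)
    (g' := G.map g) (f' := G.map f) (α.hom.naturality g).symm (α.hom.naturality f).symm
    (by simp)
  refine (Category.assoc _ _ _).symm.trans ((congrArg (fun x => x ≫ _) h₄).trans ?_)
  refine (Category.assoc _ _ _).trans (Eq.trans ?_ (Category.assoc _ _ _).symm)
  refine congrArg (fun x => _ ≫ x) ?_
  refine (hL.iso_trans _ _).symm.trans (Eq.trans ?_ (hL.iso_trans _ _))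
  exact congrArg L'.isoHom (arrowIso_ext
    ((Category.comp_id _).trans (Category.id_comp _).symm)
    ((Category.comp_id _).trans (Category.id_comp _).symm))

end Extends

section ExtendsMul

variable {C : Type u₁} [Category.{v₁} C] [MonoidalCategory C] {C' : Type u₂} [Category.{v₂} C']
  [MonoidalCategory C'] {P : Presentation.{w₁}} {P' : Presentation.{w₂}} {F G : MonFunctor C C'}
  {L : MulLetters C P.toSignature} {L' : MulLetters C' P'.toSignature}
  {Q R : MonFunctor P.Cat P'.Cat} {t : ∀ X, Q.obj X ⟶ R.obj X}

/-- Equivariance of `μ` along `α` produces the product of two components of `α`; monoidality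
identifies it with the component at the product, up to the structure morphisms of `F` and `G`. -/
theorem ExtendsMul.natural_μHom (hQ : ExtendsMul F L L' Q) (hR : ExtendsMul G L L' R)
    (hL : L'.data.Laws) (hL' : L'.data.MulLaws) (ht : IsMonoidalFamily t) {α : F ≅ G}
    (h : IsExtensionFamily (MonFunctor.natIso α) L.toLetters L'.toLetters t) (φ ψ : Arrow C) :
    Q.map (L.μHom φ ψ) ≫ t _ = t _ ≫ R.map (L.μHom φ ψ) := by
  obtain ⟨_, _, h₁⟩ := h φ
  obtain ⟨_, _, h₂⟩ := h ψ
  obtain ⟨_, _, h₃⟩ := h (arrowTensor φ ψ)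
  refine natural_of_squares (eqToIso (hQ.obj φ)) (eqToIso (hQ.obj ψ))
    (eqToIso (hQ.obj (arrowTensor φ ψ))) (eqToIso (hR.obj φ))
    (eqToIso (hR.obj ψ)) (eqToIso (hR.obj (arrowTensor φ ψ)))
    (hQ.μ φ ψ) (hR.μ φ ψ) ?_ h₁ h₂ h₃ (ht.tensor _ _)
  have h₄ := hL'.equivariance (Arrow.isoOfNatIso (MonFunctor.natIso α) φ)
    (Arrow.isoOfNatIso (MonFunctor.natIso α) ψ)
  refine (Category.assoc _ _ _).symm.trans ((congrArg (fun x => x ≫ _) h₄).trans ?_)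
  refine (Category.assoc _ _ _).trans (Eq.trans ?_ (Category.assoc _ _ _).symm)
  refine congrArg (fun x => _ ≫ x) ?_
  refine (hL.iso_trans _ _).symm.trans (Eq.trans ?_ (hL.iso_trans _ _))
  exact congrArg L'.isoHom (arrowIso_ext
    (α.hom.isMonoidal.tensor _ _).symm (α.hom.isMonoidal.tensor _ _).symm)

end ExtendsMul

end PlusConstruction

namespace PlusConstruction

open Functor.LaxMonoidal (ε μ)

/-! ### Strict monoidal categories whose objects are words -/

/-- A presentation whose objects are words. -/
abbrev wordPresentation (A : Type w₁) (symm : Prop) (Gen : List A → List A → Type w₁)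
    (Rel : ∀ ⦃X Y : List A⦄, (wordSignature A symm Gen).Word X Y →
      (wordSignature A symm Gen).Word X Y → Prop) : Presentation.{w₁} where
  toSignature := wordSignature A symm Gen
  Rel := Rel

section WordPresentation

variable {A : Type w₁} {symm : Prop} {Gen : List A → List A → Type w₁}
  {Rel : ∀ ⦃X Y : List A⦄, (wordSignature A symm Gen).Word X Y →
    (wordSignature A symm Gen).Word X Y → Prop}

/-- A word, as an object of the category. -/
abbrev wordObj (Rel : ∀ ⦃X Y : List A⦄, (wordSignature A symm Gen).Word X Y →
    (wordSignature A symm Gen).Word X Y → Prop) (X : List A) :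
    (wordPresentation A symm Gen Rel).Cat := X

theorem hom_eqTo {P : Presentation.{w₁}} {X Y : P.Cat} (h : X = Y) :
    Presentation.hom (Signature.Word.eqTo (S := P.toSignature) h) = eqToHom h := by
  subst h; rfl

section Strict

variable (hRel : ∀ ⦃X Y : List A⦄ ⦃f g : (wordSignature A symm Gen).Word X Y⦄,
  StrictRel f g → Rel f g)

include hRel

omit hRel in
theorem wordObj_assoc (X Y Z : (wordPresentation A symm Gen Rel).Cat) :
    (X ⊗ Y) ⊗ Z = X ⊗ Y ⊗ Z := List.append_assoc (α := A) X Y Z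

omit hRel in
theorem wordObj_unit_tensor (X : (wordPresentation A symm Gen Rel).Cat) :
    𝟙_ _ ⊗ X = X := List.nil_append (α := A) X

omit hRel in
theorem wordObj_tensor_unit (X : (wordPresentation A symm Gen Rel).Cat) :
    X ⊗ 𝟙_ _ = X := List.append_nil (α := A) X

theorem wordObj_associator (X Y Z : (wordPresentation A symm Gen Rel).Cat) :
    (α_ X Y Z).hom = eqToHom (wordObj_assoc X Y Z) :=
  (Presentation.hom_eq (hRel (.assoc X Y Z))).trans (hom_eqTo _)

theorem wordObj_leftUnitor (X : (wordPresentation A symm Gen Rel).Cat) :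
    (λ_ X).hom = eqToHom (wordObj_unit_tensor X) :=
  (Presentation.hom_eq (hRel (.leftUnit X))).trans (hom_eqTo _)

theorem wordObj_rightUnitor (X : (wordPresentation A symm Gen Rel).Cat) :
    (ρ_ X).hom = eqToHom (wordObj_tensor_unit X) :=
  (Presentation.hom_eq (hRel (.rightUnit X))).trans (hom_eqTo _)

end Strict

variable {D : Type u₂} [Category.{v₂} D] [MonoidalCategory D]
  {Q R : MonFunctor (wordPresentation A symm Gen Rel).Cat D}

/-- The family of isomorphisms compatible with the structure morphisms that is given on letters. -/
def wordFamily (t : ∀ a : A, Q.obj (wordObj Rel [a]) ≅ R.obj (wordObj Rel [a])) :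
    ∀ X : List A, Q.obj (wordObj Rel X) ≅ R.obj (wordObj Rel X)
  | [] => (Functor.Monoidal.εIso Q.toFunctor).symm ≪≫ Functor.Monoidal.εIso R.toFunctor
  | a :: X => (Functor.Monoidal.μIso Q.toFunctor (wordObj Rel [a]) (wordObj Rel X)).symm ≪≫
      (t a ⊗ᵢ wordFamily t X) ≪≫
        Functor.Monoidal.μIso R.toFunctor (wordObj Rel [a]) (wordObj Rel X)

theorem wordFamily_unit (t : ∀ a : A, Q.obj (wordObj Rel [a]) ≅ R.obj (wordObj Rel [a])) :
    ε Q.toFunctor ≫ (wordFamily t []).hom = ε R.toFunctor :=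
  Functor.Monoidal.ε_η_assoc Q.toFunctor _

theorem wordFamily_cons (t : ∀ a : A, Q.obj (wordObj Rel [a]) ≅ R.obj (wordObj Rel [a])) (a : A)
    (X : List A) :
    μ Q.toFunctor (wordObj Rel [a]) (wordObj Rel X) ≫ (wordFamily t (a :: X)).hom =
      ((t a).hom ⊗ₘ (wordFamily t X).hom) ≫
        μ R.toFunctor (wordObj Rel [a]) (wordObj Rel X) :=
  Functor.Monoidal.μ_δ_assoc Q.toFunctor _ _ _

variable (hRel : ∀ ⦃X Y : List A⦄ ⦃f g : (wordSignature A symm Gen).Word X Y⦄,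
  StrictRel f g → Rel f g)

include hRel

/-- In this and the next two lemmas the words are of a shape for which the constraint joins
definitionally equal lists: `[] ++ X` is `X`, `[a] ++ []` is `[a]`, and both bracketings of `[a]`,
`X`, `Y` reduce to `a :: (X ++ Y)`. By strictness the constraint is then an identity, which turns
the axioms of `Q` into equations without `eqToHom`. -/
theorem MonFunctor.map_nil_leftUnitor (Q : MonFunctor (wordPresentation A symm Gen Rel).Cat D)
    (X : List A) :
    ε Q.toFunctor ▷ Q.obj (wordObj Rel X) ≫ μ Q.toFunctor (wordObj Rel []) (wordObj Rel X) =
      (λ_ (Q.obj (wordObj Rel X))).hom := by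
  have h := Functor.LaxMonoidal.left_unitality Q.toFunctor (wordObj Rel X)
  rw [wordObj_leftUnitor hRel] at h
  have h' : Q.map (eqToHom (wordObj_unit_tensor (wordObj Rel X))) = 𝟙 _ := Q.map_id _
  exact ((h.trans (congrArg (fun x => _ ≫ _ ≫ x) h')).trans
    (congrArg (fun x => _ ≫ x) (Category.comp_id _))).symm

theorem MonFunctor.map_singleton_rightUnitor
    (Q : MonFunctor (wordPresentation A symm Gen Rel).Cat D) (a : A) :
    Q.obj (wordObj Rel [a]) ◁ ε Q.toFunctor ≫ μ Q.toFunctor (wordObj Rel [a]) (wordObj Rel []) =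
      (ρ_ (Q.obj (wordObj Rel [a]))).hom := by
  have h := Functor.LaxMonoidal.right_unitality Q.toFunctor (wordObj Rel [a])
  rw [wordObj_rightUnitor hRel] at h
  have h' : Q.map (eqToHom (wordObj_tensor_unit (wordObj Rel [a]))) = 𝟙 _ := Q.map_id _
  exact ((h.trans (congrArg (fun x => _ ≫ _ ≫ x) h')).trans
    (congrArg (fun x => _ ≫ x) (Category.comp_id _))).symm

theorem MonFunctor.map_cons_associator (Q : MonFunctor (wordPresentation A symm Gen Rel).Cat D)
    (a : A) (X Y : List A) :
    μ Q.toFunctor (wordObj Rel [a]) (wordObj Rel X) ▷ Q.obj (wordObj Rel Y) ≫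
      μ Q.toFunctor (wordObj Rel (a :: X)) (wordObj Rel Y) =
    (α_ _ _ _).hom ≫ Q.obj (wordObj Rel [a]) ◁ μ Q.toFunctor (wordObj Rel X) (wordObj Rel Y) ≫
      μ Q.toFunctor (wordObj Rel [a]) (wordObj Rel (X ++ Y)) := by
  have h := Functor.LaxMonoidal.associativity Q.toFunctor (wordObj Rel [a]) (wordObj Rel X)
    (wordObj Rel Y)
  rw [wordObj_associator hRel] at h
  have h' : Q.map (eqToHom (wordObj_assoc (wordObj Rel [a]) (wordObj Rel X) (wordObj Rel Y))) =
    𝟙 _ := Q.map_id _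
  exact ((congrArg (fun x => _ ≫ x) (Category.comp_id _)).symm.trans
    (congrArg (fun x => _ ≫ _ ≫ x) h').symm).trans h

/-- The recursion reaches `[a]` through the product of `[a]` with the empty word. Right unitality of
`Q` and `R` removes that unit. -/
theorem wordFamily_singleton
    (t : ∀ a : A, Q.obj (wordObj Rel [a]) ≅ R.obj (wordObj Rel [a])) (a : A) :
    (wordFamily t [a]).hom = (t a).hom := by
  have h := wordFamily_cons t a []
  have h₁ := Q.map_singleton_rightUnitor hRel a
  have h₂ := R.map_singleton_rightUnitor hRel a
  have h₃ : (ρ_ (Q.obj (wordObj Rel [a]))).hom ≫ (wordFamily t [a]).hom =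
      (ρ_ (Q.obj (wordObj Rel [a]))).hom ≫ (t a).hom := by
    refine (congrArg (fun x => x ≫ _) h₁.symm).trans ?_
    refine (Category.assoc _ _ _).trans ((congrArg (fun x => _ ≫ x) h).trans ?_)
    rw [← id_tensorHom, tensorHom_comp_tensorHom_assoc, Category.id_comp]
    refine (congrArg (fun x => ((t a).hom ⊗ₘ x) ≫ _) (wordFamily_unit t)).trans ?_
    rw [MonoidalCategory.tensorHom_def, Category.assoc, h₂, rightUnitor_naturality]
  exact (cancel_epi _).1 h₃

/-- The recursion provides compatibility only when the first word is a single letter. Induction on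
`X` gives the rest: left unitality for the empty word, and associativity of the structure morphisms
to split off the first letter. -/
theorem wordFamily_append (t : ∀ a : A, Q.obj (wordObj Rel [a]) ≅ R.obj (wordObj Rel [a]))
    (X Y : List A) :
    μ Q.toFunctor (wordObj Rel X) (wordObj Rel Y) ≫ (wordFamily t (X ++ Y)).hom =
      ((wordFamily t X).hom ⊗ₘ (wordFamily t Y).hom) ≫
        μ R.toFunctor (wordObj Rel X) (wordObj Rel Y) := by
  induction X with
  | nil =>
    have h₁ := Q.map_nil_leftUnitor hRel Y
    have h₂ := R.map_nil_leftUnitor hRel Y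
    have h₃ := wordFamily_unit t
    refine (cancel_epi (ε Q.toFunctor ▷ Q.obj (wordObj Rel Y))).1 ?_
    refine (Category.assoc _ _ _).symm.trans ((congrArg (fun x => x ≫ _) h₁).trans ?_)
    have h₅ : ε Q.toFunctor ▷ Q.obj (wordObj Rel Y) ≫
        ((wordFamily t []).hom ⊗ₘ (wordFamily t Y).hom) =
        (ε R.toFunctor ⊗ₘ (wordFamily t Y).hom) := by
      rw [← tensorHom_id, tensorHom_comp_tensorHom, Category.id_comp]
      exact congrArg (fun x => x ⊗ₘ (wordFamily t Y).hom) h₃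
    refine Eq.trans ?_ (Category.assoc _ _ _)
    refine Eq.trans ?_ (congrArg (fun x => x ≫ _) h₅.symm)
    rw [MonoidalCategory.tensorHom_def', Category.assoc]
    exact (leftUnitor_naturality _).symm.trans (congrArg (fun x => _ ≫ x) h₂.symm)
  | cons a X ih =>
    have h₁ := Q.map_cons_associator hRel a X Y
    have h₂ := R.map_cons_associator hRel a X Y
    have h₃ := wordFamily_cons t a X
    have h₄ := wordFamily_cons t a (X ++ Y)
    refine (cancel_epi (μ Q.toFunctor (wordObj Rel [a]) (wordObj Rel X) ▷
      Q.obj (wordObj Rel Y))).1 ?_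
    refine (Category.assoc _ _ _).symm.trans ((congrArg (fun x => x ≫ _) h₁).trans ?_)
    simp only [Category.assoc]
    refine (congrArg (fun x => _ ≫ _ ≫ x) h₄).trans ?_
    have h₅ : μ Q.toFunctor (wordObj Rel [a]) (wordObj Rel X) ▷ Q.obj (wordObj Rel Y) ≫
        ((wordFamily t (a :: X)).hom ⊗ₘ (wordFamily t Y).hom) =
        (((t a).hom ⊗ₘ (wordFamily t X).hom) ⊗ₘ (wordFamily t Y).hom) ≫
          μ R.toFunctor (wordObj Rel [a]) (wordObj Rel X) ▷ _ := by
      rw [← tensorHom_id, ← tensorHom_id, tensorHom_comp_tensorHom, tensorHom_comp_tensorHom,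
        Category.id_comp, Category.comp_id]
      exact congrArg (fun x => x ⊗ₘ (wordFamily t Y).hom) h₃
    refine Eq.trans ?_ (Category.assoc _ _ _)
    refine Eq.trans ?_ (congrArg (fun x => x ≫ _) h₅.symm)
    refine Eq.trans ?_ ((congrArg (fun x => _ ≫ x) h₂.symm).trans (Category.assoc _ _ _).symm)
    rw [← id_tensorHom, tensorHom_comp_tensorHom_assoc, Category.id_comp, ih,
      associator_naturality_assoc, ← id_tensorHom, tensorHom_comp_tensorHom_assoc,
      Category.comp_id]

theorem wordFamily_isMonoidalFamily
    (t : ∀ a : A, Q.obj (wordObj Rel [a]) ≅ R.obj (wordObj Rel [a])) :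
    IsMonoidalFamily (Q := Q) (R := R) fun X => (wordFamily t X).hom :=
  ⟨wordFamily_unit t, wordFamily_append hRel t⟩

omit hRel in
-- The unit and product axioms of a monoidal transformation are the recursion that defines
-- `wordFamily`.
theorem MonTrans.app_eq_wordFamily
    (t : ∀ a : A, Q.obj (wordObj Rel [a]) ≅ R.obj (wordObj Rel [a])) (α : Q ⟶ R)
    (h : ∀ a, α.hom.app (wordObj Rel [a]) = (t a).hom) (X : List A) :
    α.hom.app (wordObj Rel X) = (wordFamily t X).hom := by
  induction X with
  | nil =>
    exact (cancel_epi (ε Q.toFunctor)).1 (α.isMonoidal.unit.trans (wordFamily_unit t).symm)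
  | cons a X ih =>
    refine (cancel_epi (μ Q.toFunctor (wordObj Rel [a]) (wordObj Rel X))).1 ?_
    refine (α.isMonoidal.tensor (wordObj Rel [a]) (wordObj Rel X)).trans ?_
    rw [h, ih]
    exact (wordFamily_cons t a X).symm

omit hRel in
/-- Isomorphisms of strong monoidal functors on a category of words are determined by their values on
letters. -/
theorem wordIso_ext {α β : Q ≅ R}
    (h : ∀ a, α.hom.hom.app (wordObj Rel [a]) = β.hom.hom.app (wordObj Rel [a])) : α = β := by
  refine Iso.ext (MonTrans.ext_app fun X => ?_)
  exact (MonTrans.app_eq_wordFamily (fun a => (MonFunctor.natIso β).app (wordObj Rel [a]))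
    α.hom h X).trans (MonTrans.app_eq_wordFamily
      (fun a => (MonFunctor.natIso β).app (wordObj Rel [a])) β.hom (fun _ => rfl) X).symm

omit hRel in
-- For strict functors every factor in the recursion is an `eqToHom`, provided this is so on
-- letters. This is how equality of strict functors is reduced to letters.
theorem wordFamily_eqToHom (hQ : Q.IsStrict) (hR : R.IsStrict)
    (h : ∀ a, Q.obj (wordObj Rel [a]) = R.obj (wordObj Rel [a])) (X : List A) :
    ∃ e : Q.obj (wordObj Rel X) = R.obj (wordObj Rel X),
      (wordFamily (fun a => eqToIso (h a)) X).hom = eqToHom e := by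
  induction X with
  | nil =>
    refine ⟨hQ.obj_unit.symm.trans hR.obj_unit, (cancel_epi (ε Q.toFunctor)).1 ?_⟩
    rw [wordFamily_unit, hR.ε_eq]
    exact (by rw [eqToHom_trans] : _ = eqToHom hQ.obj_unit ≫ eqToHom _).trans
      (congrArg (fun x => x ≫ _) hQ.ε_eq.symm)
  | cons a X ih =>
    obtain ⟨e, ih⟩ := ih
    have e' : Q.obj (wordObj Rel [a] ⊗ wordObj Rel X) = R.obj (wordObj Rel [a] ⊗ wordObj Rel X) :=
      (hQ.obj_tensor _ _).symm.trans ((congrArg₂ (fun x y => x ⊗ y) (h a) e).trans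
        (hR.obj_tensor _ _))
    refine ⟨e', (cancel_epi (μ Q.toFunctor (wordObj Rel [a]) (wordObj Rel X))).1 ?_⟩
    rw [wordFamily_cons, ih, hQ.μ_eq, hR.μ_eq]
    simp [MonoidalCategory.tensorHom_def]

end WordPresentation

end PlusConstruction

namespace PlusConstruction

/-! ### The functors on categories of words -/

theorem Interp.Sound.preservesBraiding {P : Presentation.{w₁}} {P' : Presentation.{w₂}}
    {I : Interp P.toSignature P'.Cat} (hI : I.Sound)
    (hs : ∀ h : P.symm, ∃ h' : P'.symm, I.sym h = P'.symmetricCategory h') :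
    hI.functor.PreservesBraiding := by
  intro h
  obtain ⟨h', e⟩ := hs h
  refine ⟨h', fun X Y => ?_⟩
  have := I.forget_braided h X Y
  rw [e] at this
  exact this

section WordInterp

variable {A : Type w₁} {A' : Type w₂} {symm : Prop} {Gen : List A → List A → Type w₁}
  {Gen' : List A' → List A' → Type w₂}
  {Rel' : ∀ ⦃X Y : List A'⦄, (wordSignature A' symm Gen').Word X Y →
    (wordSignature A' symm Gen').Word X Y → Prop}

/-- The interpretation of words that applies a map to the letters. -/
def wordInterp (f : A → A')
    (gen : ∀ X Y : List A, Gen X Y → (wordObj Rel' (X.map f) ⟶ wordObj Rel' (Y.map f))) :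
    Interp (wordSignature A symm Gen) (wordPresentation A' symm Gen' Rel').Cat where
  obj X := wordObj Rel' (X.map f)
  ε := Iso.refl _
  -- Mapping commutes with concatenation only up to a propositional equality, so strictness is
  -- expressed by an `eqToIso`; for the empty word the equality is definitional.
  μ _ _ := eqToIso (List.map_append).symm
  sym h := Presentation.symmetricCategory _ h
  gen := gen _ _

section

variable (hRel' : ∀ ⦃X Y : List A'⦄ ⦃f g : (wordSignature A' symm Gen').Word X Y⦄,
  StrictRel f g → Rel' f g)

include hRel'

/-- The left-hand side is the associator of the induced category. With variables in place of the
mapped and concatenated lists, all the equalities can be substituted away. -/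
theorem wordObj_associator_conj {X Y Z XY YZ W W' : (wordPresentation A' symm Gen' Rel').Cat}
    (h₁ : W = XY ⊗ Z) (h₂ : XY = X ⊗ Y) (h₃ : Y ⊗ Z = YZ) (h₄ : X ⊗ YZ = W') :
    (eqToHom h₁ ≫ (eqToHom h₂ ⊗ₘ 𝟙 Z)) ≫ (α_ X Y Z).hom ≫ ((𝟙 X ⊗ₘ eqToHom h₃) ≫ eqToHom h₄) =
      eqToHom (by subst h₁ h₂ h₃ h₄; exact wordObj_assoc X Y Z) := by
  subst h₁ h₂ h₃ h₄
  simp only [eqToHom_refl, Category.id_comp, id_tensorHom_id, Category.comp_id,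
    wordObj_associator hRel']

theorem wordObj_leftUnitor_conj {X W : (wordPresentation A' symm Gen' Rel').Cat}
    (h : W = 𝟙_ _ ⊗ X) :
    (eqToHom h ≫ (𝟙 (𝟙_ _) ⊗ₘ 𝟙 X)) ≫ (λ_ X).hom = eqToHom (h.trans (wordObj_unit_tensor X)) := by
  simp only [id_tensorHom_id, Category.comp_id, wordObj_leftUnitor hRel', eqToHom_trans]

theorem wordObj_rightUnitor_conj {X W : (wordPresentation A' symm Gen' Rel').Cat}
    (h : W = X ⊗ 𝟙_ _) :
    (eqToHom h ≫ (𝟙 X ⊗ₘ 𝟙 (𝟙_ _))) ≫ (ρ_ X).hom = eqToHom (h.trans (wordObj_tensor_unit X)) := by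
  simp only [id_tensorHom_id, Category.comp_id, wordObj_rightUnitor hRel', eqToHom_trans]

theorem wordInterp_strictRel (f : A → A')
    (gen : ∀ X Y : List A, Gen X Y → (wordObj Rel' (X.map f) ⟶ wordObj Rel' (Y.map f)))
    ⦃X Y : List A⦄ ⦃v w : (wordSignature A symm Gen).Word X Y⦄
    (h : StrictRel v w) : (wordInterp f gen).eval v = (wordInterp f gen).eval w := by
  cases h with
  | assoc X Y Z =>
    refine Eq.trans ?_ (Interp.eval_eqTo (I := wordInterp f gen) (List.append_assoc X Y Z)).symm
    exact wordObj_associator_conj hRel' (X := wordObj Rel' (X.map f)) (Y := wordObj Rel' (Y.map f))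
      (Z := wordObj Rel' (Z.map f)) List.map_append List.map_append List.map_append.symm
      List.map_append.symm
  | leftUnit X =>
    refine Eq.trans ?_ (Interp.eval_eqTo (I := wordInterp f gen) (List.nil_append _)).symm
    exact wordObj_leftUnitor_conj hRel' (X := wordObj Rel' (Y.map f)) rfl
  | rightUnit X =>
    refine Eq.trans ?_ (Interp.eval_eqTo (I := wordInterp f gen) (List.append_nil _)).symm
    exact wordObj_rightUnitor_conj hRel' (X := wordObj Rel' (Y.map f)) List.map_append

end

variable {Rel : ∀ ⦃X Y : List A⦄, (wordSignature A symm Gen).Word X Y →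
    (wordSignature A symm Gen).Word X Y → Prop}

theorem wordInterp_isStrict {f : A → A'}
    {gen : ∀ X Y : List A, Gen X Y → (wordObj Rel' (X.map f) ⟶ wordObj Rel' (Y.map f))}
    (hI : Interp.Sound (P := wordPresentation A symm Gen Rel) (wordInterp f gen)) :
    hI.functor.IsStrict where
  obj_unit := rfl
  obj_tensor _ _ := (List.map_append).symm
  ε_eq := rfl
  μ_eq _ _ := rfl

theorem wordInterp_preservesBraiding {f : A → A'}
    {gen : ∀ X Y : List A, Gen X Y → (wordObj Rel' (X.map f) ⟶ wordObj Rel' (Y.map f))}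
    (hI : Interp.Sound (P := wordPresentation A symm Gen Rel) (wordInterp f gen)) :
    hI.functor.PreservesBraiding :=
  hI.preservesBraiding fun h => ⟨h, rfl⟩

end WordInterp

section

variable {C : Type u₁} [Category.{v₁} C] {D : Type u₂} [Category.{v₂} D] [MonoidalCategory D]
  {obj : Arrow C → D} {iso : ∀ {φ ψ : Arrow C}, (φ ≅ ψ) → (obj φ ⟶ obj ψ)}
  {γ γ' : ∀ {X Y Z : C} (g : Y ⟶ Z) (f : X ⟶ Y),
    obj (Arrow.mk g) ⊗ obj (Arrow.mk f) ⟶ obj (Arrow.mk (f ≫ g))}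

/-- Fixing `obj` and `iso` keeps `γ` and `γ'` in the same type and avoids heterogeneous equality. -/
theorem CompData.mk_congr (hγ : ∀ {X Y Z : C} (g : Y ⟶ Z) (f : X ⟶ Y), γ g f = γ' g f) :
    CompData.mk obj iso γ = CompData.mk obj iso γ' := by
  obtain rfl : @γ = @γ' := by funext X Y Z g f; exact hγ g f
  rfl

theorem MulData.mk_congr [MonoidalCategory C]
    {μ μ' : ∀ φ ψ : Arrow C, obj φ ⊗ obj ψ ⟶ obj (arrowTensor φ ψ)}
    (hγ : ∀ {X Y Z : C} (g : Y ⟶ Z) (f : X ⟶ Y), γ g f = γ' g f)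
    (hμ : ∀ φ ψ, μ φ ψ = μ' φ ψ) :
    MulData.mk ⟨obj, iso, γ⟩ μ = MulData.mk ⟨obj, iso, γ'⟩ μ' := by
  obtain rfl : @γ = @γ' := by funext X Y Z g f; exact hγ g f
  obtain rfl : μ = μ' := by funext φ ψ; exact hμ φ ψ
  rfl

end

/-! #### Categories -/

section Box

variable {C : Type u₁} [Category.{v₁} C] {D : Type u₂} [Category.{v₂} D]
  (symm : Prop)

theorem boxLaws : (Letters.data (P := boxPresentation C symm) (boxLetters C symm)).Laws :=
  Letters.laws (P := boxPresentation C symm) fun _ _ _ _ h => Or.inr h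

/-- The images of the generators under the functor of plus constructions given by a functor. -/
def boxGenMap (F : C ⥤ D) : ∀ X Y : List (Arrow C), BoxGen C X Y →
    (wordObj (boxPresentation D symm).Rel (X.map F.mapArrow.obj) ⟶
      wordObj (boxPresentation D symm).Rel (Y.map F.mapArrow.obj))
  | _, _, .iso e => ((Letters.data (P := boxPresentation D symm) (boxLetters D symm)).pullback F).iso e
  | _, _, .γ g f => ((Letters.data (P := boxPresentation D symm) (boxLetters D symm)).pullback F).γ g f

/-- The interpretation of the generators of `C^{⊠+}` given by a functor. -/
def boxInterp (F : C ⥤ D) :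
    Interp (boxPresentation C symm).toSignature (boxPresentation D symm).Cat :=
  wordInterp F.mapArrow.obj (boxGenMap symm F)

/-- On one-letter words the comparison `μ` of the interpretation is an identity, so evaluating the
letters gives the restriction of the generating algebra along `F`. Soundness thus becomes stability
of the laws under restriction. -/
theorem boxInterp_compData (F : C ⥤ D) :
    (boxInterp symm F).compData (boxLetters C symm) =
      (Letters.data (P := boxPresentation D symm) (boxLetters D symm)).pullback F :=
  CompData.mk_congr fun _ _ => Category.id_comp _

theorem boxInterp_sound (F : C ⥤ D) :
    Interp.Sound (P := boxPresentation C symm) (boxInterp symm F) := by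
  rintro X Y f g (h | h)
  · exact wordInterp_strictRel (fun _ _ _ _ => Or.inl) F.mapArrow.obj (boxGenMap symm F) h
  · refine CompData.Laws.eval_eq ?_ h
    rw [boxInterp_compData]
    exact (boxLaws symm).pullback F

/-- The functor of plus constructions given by a functor. -/
def boxMap (F : C ⥤ D) : MonFunctor (boxPresentation C symm).Cat (boxPresentation D symm).Cat :=
  (boxInterp_sound symm F).functor

theorem boxMap_isStrict (F : C ⥤ D) : (boxMap symm F).IsStrict :=
  wordInterp_isStrict (boxInterp_sound symm F)

theorem boxMap_preservesBraiding (F : C ⥤ D) : (boxMap symm F).PreservesBraiding :=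
  wordInterp_preservesBraiding (boxInterp_sound symm F)

/-- This is the shape of the conditions in `Extends` and `ExtendsMul` when all equalities of objects
are definitional. -/
theorem comp_eq_id_tensor_comp {V : Type u₁} [Category.{v₁} V] [MonoidalCategory V] {X X' Y Z : V}
    (a : X ⊗ X' ⟶ Y) (b : Y ⟶ Z) : 𝟙 (X ⊗ X') ≫ (a ≫ b) = (𝟙 X ⊗ₘ 𝟙 X') ≫ a ≫ b ≫ 𝟙 Z := by
  simp

theorem boxMap_extends (F : C ⥤ D) :
    Extends F (boxLetters C symm) (boxLetters D symm) (boxMap symm F) where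
  obj _ := rfl
  iso _ := ((Category.id_comp _).trans (Category.comp_id _)).symm
  γ g f := comp_eq_id_tensor_comp (V := (boxPresentation D symm).Cat)
    ((boxLetters D symm).γHom (P := boxPresentation D symm) (F.map g) (F.map f)) _

end Box

end PlusConstruction

namespace PlusConstruction

/-! #### Monoidal categories -/

section Pullback

variable {S : Signature.{w₁}} {C : Type u₁} [Category.{v₁} C] [MonoidalCategory C]
  {D : Type u₂} [Category.{v₂} D] [MonoidalCategory D] {I : Interp S D} {L : MulLetters C S}
  {B : MulData C D} (h : I.mulData L = B) ⦃X Y : S.Obj⦄ ⦃f g : S.Word X Y⦄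

include h

theorem Interp.eval_eq_of_compRel (hB : B.Laws) (r : CompRel L.toLetters f g) :
    I.eval f = I.eval g := by
  subst h; exact hB.eval_eq r

theorem Interp.eval_eq_of_mulRel (hB : B.MulLaws) (r : MulRel L f g) : I.eval f = I.eval g := by
  subst h; exact hB.eval_eq r

theorem Interp.eval_eq_of_interchangeRel (hB : ∀ h : S.symm, letI := I.sym h; B.Interchange)
    (r : InterchangeRel L f g) : I.eval f = I.eval g := by
  subst h; exact MulData.Interchange.eval_eq hB r

theorem Interp.eval_eq_of_commRel [SymmetricCategory C]
    (hB : ∀ h : S.symm, letI := I.sym h; B.Comm) (r : CommRel L f g) : I.eval f = I.eval g := by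
  subst h; exact MulData.Comm.eval_eq hB r

end Pullback

/-! ### Soundness shared by `M^{nc+}` and `M^{loc+}` -/

section Words

variable {A : Type w₁} {symm : Prop} {Gen : List A → List A → Type w₁}
  {N : Type u₂} [Category.{v₂} N] [MonoidalCategory N]

/-- The relations of the plus constructions of monoidal categories whose objects are words. -/
structure IsPlusRel (L : MulLetters N (wordSignature A symm Gen))
    (Rel : ∀ ⦃X Y : List A⦄, (wordSignature A symm Gen).Word X Y →
      (wordSignature A symm Gen).Word X Y → Prop) : Prop where
  strict : ∀ ⦃X Y : List A⦄ ⦃f g : (wordSignature A symm Gen).Word X Y⦄, StrictRel f g → Rel f g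
  comp : ∀ ⦃X Y : List A⦄ ⦃f g : (wordSignature A symm Gen).Word X Y⦄,
    CompRel L.toLetters f g → Rel f g
  mul : ∀ ⦃X Y : List A⦄ ⦃f g : (wordSignature A symm Gen).Word X Y⦄, MulRel L f g → Rel f g
  interchange : ∀ ⦃X Y : List A⦄ ⦃f g : (wordSignature A symm Gen).Word X Y⦄,
    InterchangeRel L f g → Rel f g

variable {Rel : ∀ ⦃X Y : List A⦄, (wordSignature A symm Gen).Word X Y →
      (wordSignature A symm Gen).Word X Y → Prop} {L : MulLetters N (wordSignature A symm Gen)}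

variable (Rel L) in
/-- The algebra of generators. -/
abbrev wordData : MulData N (wordPresentation A symm Gen Rel).Cat :=
  MulLetters.data (P := wordPresentation A symm Gen Rel) L

theorem IsPlusRel.laws (h : IsPlusRel L Rel) : (wordData Rel L).Laws := Letters.laws h.comp

theorem IsPlusRel.mulLaws (h : IsPlusRel L Rel) : (wordData Rel L).MulLaws :=
  MulLetters.mulLaws h.mul

variable {A' : Type w₂} {Gen' : List A' → List A' → Type w₂}
  {M : Type u₁} [Category.{v₁} M] [MonoidalCategory M] {L' : MulLetters M (wordSignature A' symm Gen')}
  {F : MonFunctor M N} {f : A' → A}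
  {gen : ∀ X Y : List A', Gen' X Y → (wordObj Rel (X.map f) ⟶ wordObj Rel (Y.map f))}

theorem IsPlusRel.eval_eq (h : IsPlusRel L Rel)
    (hF : (wordInterp f gen).mulData L' = (wordData Rel L).pullback F)
    ⦃X Y : List A'⦄ ⦃v w : (wordSignature A' symm Gen').Word X Y⦄
    (r : StrictRel v w ∨ CompRel L'.toLetters v w ∨ MulRel L' v w ∨ InterchangeRel L' v w) :
    (wordInterp f gen).eval v = (wordInterp f gen).eval w := by
  obtain r | r | r | r := r
  · exact wordInterp_strictRel h.strict _ _ r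
  · exact Interp.eval_eq_of_compRel hF (h.laws.pullback F.toFunctor) r
  · exact Interp.eval_eq_of_mulRel hF (h.mulLaws.pullback h.laws F) r
  · refine Interp.eval_eq_of_interchangeRel hF (fun hS => ?_) r
    let _ := (wordPresentation A symm Gen Rel).symmetricCategory hS
    intro _ _ _ _ _ _
    exact MulData.Interchange.pullback h.laws
      (MulLetters.interchange (P := wordPresentation A symm Gen Rel) h.interchange hS) F

theorem IsPlusRel.eval_eq_of_commRel [SymmetricCategory M] [SymmetricCategory N]
    (h : IsPlusRel L Rel) (hF : (wordInterp f gen).mulData L' = (wordData Rel L).pullback F)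
    (hR : ∀ ⦃X Y : List A⦄ ⦃f g : (wordSignature A symm Gen).Word X Y⦄, CommRel L f g → Rel f g)
    (hs : F.IsSymmetric)
    ⦃X Y : List A'⦄ ⦃v w : (wordSignature A' symm Gen').Word X Y⦄ (r : CommRel L' v w) :
    (wordInterp f gen).eval v = (wordInterp f gen).eval w := by
  refine Interp.eval_eq_of_commRel hF (fun hS => ?_) r
  let _ := (wordPresentation A symm Gen Rel).symmetricCategory hS
  exact MulData.Comm.pullback h.laws
    (MulLetters.comm (P := wordPresentation A symm Gen Rel) hR hS) hs

end Words

/-! ### The functors on `M^{nc+}` -/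

section Nc

variable {M : Type u₁} [Category.{v₁} M] [MonoidalCategory M]
  {N : Type u₂} [Category.{v₂} N] [MonoidalCategory N]
  {Rel : ∀ ⦃X Y : List (Arrow M)⦄, (wordSignature (Arrow M) True (NcGen M)).Word X Y →
    (wordSignature (Arrow M) True (NcGen M)).Word X Y → Prop}
  (Rel' : ∀ ⦃X Y : List (Arrow N)⦄, (wordSignature (Arrow N) True (NcGen N)).Word X Y →
    (wordSignature (Arrow N) True (NcGen N)).Word X Y → Prop)

/-- The images of the generators under the functor of plus constructions given by a functor. -/
def ncGenMap (F : MonFunctor M N) : ∀ X Y : List (Arrow M), NcGen M X Y →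
    (wordObj Rel' (X.map F.mapArrow.obj) ⟶ wordObj Rel' (Y.map F.mapArrow.obj))
  | _, _, .iso e => ((wordData Rel' (ncLetters N)).pullback F).iso e
  | _, _, .γ g f => ((wordData Rel' (ncLetters N)).pullback F).γ g f
  | _, _, .μ φ ψ => ((wordData Rel' (ncLetters N)).pullback F).μ φ ψ

/-- The interpretation of the generators of `M^{nc+}` given by a functor. -/
def ncInterp (F : MonFunctor M N) :
    Interp (wordSignature (Arrow M) True (NcGen M))
      (wordPresentation (Arrow N) True (NcGen N) Rel').Cat :=
  wordInterp F.mapArrow.obj (ncGenMap Rel' F)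

theorem ncInterp_mulData (F : MonFunctor M N) :
    (ncInterp Rel' F).mulData (ncLetters M) = (wordData Rel' (ncLetters N)).pullback F :=
  MulData.mk_congr (fun _ _ => Category.id_comp _) fun _ _ => Category.id_comp _

variable {Rel'} in
theorem ncInterp_extends {F : MonFunctor M N}
    (h : Interp.Sound (P := wordPresentation (Arrow M) True (NcGen M) Rel) (ncInterp Rel' F)) :
    ExtendsMul (P := wordPresentation (Arrow M) True (NcGen M) Rel)
      (P' := wordPresentation (Arrow N) True (NcGen N) Rel') F (ncLetters M) (ncLetters N)
      h.functor where
  obj _ := rfl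
  iso _ := ((Category.id_comp _).trans (Category.comp_id _)).symm
  γ g f := comp_eq_id_tensor_comp (V := (wordPresentation (Arrow N) True (NcGen N) Rel').Cat)
    ((wordData Rel' (ncLetters N)).γ (F.map g) (F.map f)) _
  μ φ ψ := comp_eq_id_tensor_comp (V := (wordPresentation (Arrow N) True (NcGen N) Rel').Cat)
    ((wordData Rel' (ncLetters N)).μ (F.mapArrow.obj φ) (F.mapArrow.obj ψ)) _

theorem ncIsPlusRel : IsPlusRel (ncLetters M) (ncPresentation M).Rel where
  strict _ _ _ _ h := .inl h
  comp _ _ _ _ h := .inr (.inl h)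
  mul _ _ _ _ h := .inr (.inr (.inl h))
  interchange _ _ _ _ h := .inr (.inr (.inr h))

theorem symNcIsPlusRel [SymmetricCategory M] :
    IsPlusRel (ncLetters M) (symNcPresentation M).Rel where
  strict _ _ _ _ h := .inl (.inl h)
  comp _ _ _ _ h := .inl (.inr (.inl h))
  mul _ _ _ _ h := .inl (.inr (.inr (.inl h)))
  interchange _ _ _ _ h := .inl (.inr (.inr (.inr h)))

theorem ncInterp_sound (F : MonFunctor M N) :
    Interp.Sound (P := ncPresentation M) (ncInterp (ncPresentation N).Rel F) :=
  fun _ _ _ _ h => ncIsPlusRel.eval_eq (ncInterp_mulData _ F) h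

theorem symNcInterp_sound [SymmetricCategory M] [SymmetricCategory N] {F : MonFunctor M N}
    (hF : F.IsSymmetric) :
    Interp.Sound (P := symNcPresentation M) (ncInterp (symNcPresentation N).Rel F) := by
  rintro _ _ _ _ (h | h)
  · exact symNcIsPlusRel.eval_eq (ncInterp_mulData _ F) h
  · exact symNcIsPlusRel.eval_eq_of_commRel (ncInterp_mulData _ F) (fun _ _ _ _ => .inr) hF h

end Nc

/-! ### The functors on `M^{loc+}` -/

section Loc

variable {M : Type u₁} [Category.{v₁} M] [MonoidalCategory M]
  {N : Type u₂} [Category.{v₂} N] [MonoidalCategory N]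
  {Rel : ∀ ⦃X Y : List (Arrow M)⦄, (wordSignature (Arrow M) True (LocGen M)).Word X Y →
    (wordSignature (Arrow M) True (LocGen M)).Word X Y → Prop}
  (Rel' : ∀ ⦃X Y : List (Arrow N)⦄, (wordSignature (Arrow N) True (LocGen N)).Word X Y →
    (wordSignature (Arrow N) True (LocGen N)).Word X Y → Prop)

/-- The images of the generators under the functor of plus constructions given by a functor. -/
def locGenMap (F : MonFunctor M N) : ∀ X Y : List (Arrow M), LocGen M X Y →
    (wordObj Rel' (X.map F.mapArrow.obj) ⟶ wordObj Rel' (Y.map F.mapArrow.obj))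
  | _, _, .nc (.iso e) => ((wordData Rel' (locLetters N)).pullback F).iso e
  | _, _, .nc (.γ g f) => ((wordData Rel' (locLetters N)).pullback F).γ g f
  | _, _, .nc (.μ φ ψ) => ((wordData Rel' (locLetters N)).pullback F).μ φ ψ
  -- The image of `μ` is `μ` followed by `(f ⇓ f)`, so its inverse begins with the inverse of `(f ⇓
  -- f)`.
  | _, _, .μInv φ ψ => (wordData Rel' (locLetters N)).iso (F.arrowμ φ ψ).symm ≫
      Presentation.hom (P := wordPresentation (Arrow N) True (LocGen N) Rel')
        (.gen (.μInv (F.mapArrow.obj φ) (F.mapArrow.obj ψ)))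

/-- The interpretation of the generators of `M^{loc+}` given by a functor. -/
def locInterp (F : MonFunctor M N) :
    Interp (wordSignature (Arrow M) True (LocGen M))
      (wordPresentation (Arrow N) True (LocGen N) Rel').Cat :=
  wordInterp F.mapArrow.obj (locGenMap Rel' F)

theorem locInterp_mulData (F : MonFunctor M N) :
    (locInterp Rel' F).mulData (locLetters M) = (wordData Rel' (locLetters N)).pullback F :=
  MulData.mk_congr (fun _ _ => Category.id_comp _) fun _ _ => Category.id_comp _

theorem comp_iso_comp_inv {V : Type u₁} [Category.{v₁} V] {X Y Z : V} {m : X ⟶ Y} {n : Y ⟶ X}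
    (e : Y ≅ Z) (h : m ≫ n = 𝟙 X) : (m ≫ e.hom) ≫ e.inv ≫ n = 𝟙 X := by
  simp [h]

theorem inv_comp_comp_iso {V : Type u₁} [Category.{v₁} V] {X Y Z : V} {m : X ⟶ Y} {n : Y ⟶ X}
    (e : Y ≅ Z) (h : n ≫ m = 𝟙 Y) : (e.inv ≫ n) ≫ m ≫ e.hom = 𝟙 Z := by
  simp [reassoc_of% h]

theorem locInterp_eval_eq_of_invRel
    (hR' : IsPlusRel (locLetters N) Rel') (hI : ∀ ⦃X Y : List (Arrow N)⦄
      ⦃f g : (wordSignature (Arrow N) True (LocGen N)).Word X Y⦄, InvRel N f g → Rel' f g)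
    (F : MonFunctor M N) ⦃X Y : List (Arrow M)⦄
    ⦃f g : (wordSignature (Arrow M) True (LocGen M)).Word X Y⦄ (r : InvRel M f g) :
    (locInterp Rel' F).eval f = (locInterp Rel' F).eval g := by
  cases r with
  | μ_μInv φ ψ =>
    exact comp_iso_comp_inv (hR'.laws.isoOf (F.arrowμ φ ψ))
      (Presentation.hom_eq (P := wordPresentation (Arrow N) True (LocGen N) Rel')
        (hI (.μ_μInv (F.mapArrow.obj φ) (F.mapArrow.obj ψ))))
  | μInv_μ φ ψ =>
    exact inv_comp_comp_iso (hR'.laws.isoOf (F.arrowμ φ ψ))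
      (Presentation.hom_eq (P := wordPresentation (Arrow N) True (LocGen N) Rel')
        (hI (.μInv_μ (F.mapArrow.obj φ) (F.mapArrow.obj ψ))))

variable {Rel'} in
theorem locInterp_extends {F : MonFunctor M N}
    (h : Interp.Sound (P := wordPresentation (Arrow M) True (LocGen M) Rel) (locInterp Rel' F)) :
    ExtendsMul (P := wordPresentation (Arrow M) True (LocGen M) Rel)
      (P' := wordPresentation (Arrow N) True (LocGen N) Rel') F (locLetters M) (locLetters N)
      h.functor where
  obj _ := rfl
  iso _ := ((Category.id_comp _).trans (Category.comp_id _)).symm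
  γ g f := comp_eq_id_tensor_comp (V := (wordPresentation (Arrow N) True (LocGen N) Rel').Cat)
    ((wordData Rel' (locLetters N)).γ (F.map g) (F.map f)) _
  μ φ ψ := comp_eq_id_tensor_comp (V := (wordPresentation (Arrow N) True (LocGen N) Rel').Cat)
    ((wordData Rel' (locLetters N)).μ (F.mapArrow.obj φ) (F.mapArrow.obj ψ)) _

theorem locIsPlusRel : IsPlusRel (locLetters M) (locPresentation M).Rel where
  strict _ _ _ _ h := .inl h
  comp _ _ _ _ h := .inr (.inl h)
  mul _ _ _ _ h := .inr (.inr (.inl h))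
  interchange _ _ _ _ h := .inr (.inr (.inr (.inl h)))

theorem symLocIsPlusRel [SymmetricCategory M] :
    IsPlusRel (locLetters M) (symLocPresentation M).Rel where
  strict _ _ _ _ h := .inl (.inl h)
  comp _ _ _ _ h := .inl (.inr (.inl h))
  mul _ _ _ _ h := .inl (.inr (.inr (.inl h)))
  interchange _ _ _ _ h := .inl (.inr (.inr (.inr (.inl h))))

theorem locInterp_eval_eq (hR' : IsPlusRel (locLetters N) Rel') (hI : ∀ ⦃X Y : List (Arrow N)⦄
      ⦃f g : (wordSignature (Arrow N) True (LocGen N)).Word X Y⦄, InvRel N f g → Rel' f g)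
    (F : MonFunctor M N) ⦃X Y : List (Arrow M)⦄
    ⦃f g : (wordSignature (Arrow M) True (LocGen M)).Word X Y⦄ (r : (locPresentation M).Rel f g) :
    (locInterp Rel' F).eval f = (locInterp Rel' F).eval g := by
  obtain r | r | r | r | r := r
  · exact hR'.eval_eq (locInterp_mulData _ F) (.inl r)
  · exact hR'.eval_eq (locInterp_mulData _ F) (.inr (.inl r))
  · exact hR'.eval_eq (locInterp_mulData _ F) (.inr (.inr (.inl r)))
  · exact hR'.eval_eq (locInterp_mulData _ F) (.inr (.inr (.inr r)))
  · exact locInterp_eval_eq_of_invRel Rel' hR' hI F r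

theorem locInterp_sound (F : MonFunctor M N) :
    Interp.Sound (P := locPresentation M) (locInterp (locPresentation N).Rel F) :=
  fun _ _ _ _ h => locInterp_eval_eq _ locIsPlusRel
    (fun _ _ _ _ h => .inr (.inr (.inr (.inr h)))) F h

theorem symLocInterp_sound [SymmetricCategory M] [SymmetricCategory N] {F : MonFunctor M N}
    (hF : F.IsSymmetric) :
    Interp.Sound (P := symLocPresentation M) (locInterp (symLocPresentation N).Rel F) := by
  rintro _ _ _ _ (h | h)
  · exact locInterp_eval_eq _ symLocIsPlusRel
      (fun _ _ _ _ h => .inl (.inr (.inr (.inr (.inr h))))) F h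
  · exact symLocIsPlusRel.eval_eq_of_commRel (locInterp_mulData _ F) (fun _ _ _ _ => .inr) hF h

end Loc

end PlusConstruction

namespace PlusConstruction

open Functor.LaxMonoidal (ε μ)

/-! #### The reduced version -/

/-- A presentation whose objects are the morphisms of `M`. -/
abbrev arrowPresentation (M : Type u) [Category.{v} M] [MonoidalCategory M] (symm : Prop)
    (Rel : ∀ ⦃φ ψ : Arrow M⦄, (plusSignature M symm).Word φ ψ →
      (plusSignature M symm).Word φ ψ → Prop) : Presentation where
  toSignature := plusSignature M symm
  Rel := Rel

/-- The isomorphism `1 ≅ F 1` given by the structure morphism of a strong monoidal functor. -/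
def MonFunctor.arrowε {M : Type u₁} [Category.{v₁} M] [MonoidalCategory M] {N : Type u₂}
    [Category.{v₂} N] [MonoidalCategory N] (F : MonFunctor M N) :
    arrowUnit N ≅ F.mapArrow.obj (arrowUnit M) :=
  cell (Functor.Monoidal.εIso F.toFunctor) (Functor.Monoidal.εIso F.toFunctor)
    ((congrArg (fun x => _ ≫ x) (F.map_id _)).trans
      ((Category.comp_id _).trans (Category.id_comp _).symm))

section Arrow

variable {M : Type u₁} [Category.{v₁} M] [MonoidalCategory M]
  {N : Type u₂} [Category.{v₂} N] [MonoidalCategory N] {symm : Prop}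
  {Rel : ∀ ⦃φ ψ : Arrow M⦄, (plusSignature M symm).Word φ ψ →
      (plusSignature M symm).Word φ ψ → Prop}
  {Rel' : ∀ ⦃φ ψ : Arrow N⦄, (plusSignature N symm).Word φ ψ →
      (plusSignature N symm).Word φ ψ → Prop}

variable (Rel) in
/-- The relations of the reduced plus constructions. -/
structure IsArrowRel : Prop where
  unit : ∀ ⦃φ ψ : Arrow M⦄ ⦃f g : (plusSignature M symm).Word φ ψ⦄, UnitRel M symm f g → Rel f g
  mul : ∀ ⦃φ ψ : Arrow M⦄ ⦃f g : (plusSignature M symm).Word φ ψ⦄,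
    MulRel (plusLetters M symm) f g → Rel f g
  comp : ∀ ⦃φ ψ : Arrow M⦄ ⦃f g : (plusSignature M symm).Word φ ψ⦄,
    CompRel (plusLetters M symm).toLetters f g → Rel f g

variable (Rel) in
/-- The algebra of generators. -/
abbrev arrowData : MulData M (arrowPresentation M symm Rel).Cat :=
  MulLetters.data (P := arrowPresentation M symm Rel) (plusLetters M symm)

/-- A morphism, as an object of the reduced plus construction. -/
abbrev arrowObj (Rel : ∀ ⦃φ ψ : Arrow M⦄, (plusSignature M symm).Word φ ψ →
      (plusSignature M symm).Word φ ψ → Prop) (φ : Arrow M) :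
    (arrowPresentation M symm Rel).Cat := φ

theorem IsArrowRel.laws (h : IsArrowRel Rel) : (arrowData Rel).Laws := Letters.laws h.comp

theorem IsArrowRel.mulLaws (h : IsArrowRel Rel) : (arrowData Rel).MulLaws :=
  MulLetters.mulLaws h.mul

/-- Here `μ` is an identity, so equivariance of `μ` says that the product of two isomorphisms is the
one formed in the arrow category. -/
theorem IsArrowRel.iso_tensorHom (h : IsArrowRel Rel) {φ φ' ψ ψ' : Arrow M} (e : φ ≅ φ')
    (e' : ψ ≅ ψ') : (arrowData Rel).iso e ⊗ₘ (arrowData Rel).iso e' =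
      (arrowData Rel).iso (arrowTensorIso e e') :=
  ((Category.comp_id _).symm.trans (h.mulLaws.equivariance e e')).trans (Category.id_comp _)

theorem IsArrowRel.leftUnitor (h : IsArrowRel Rel) (φ : Arrow M) :
    (λ_ (arrowObj Rel φ)).hom = (arrowData Rel).iso (arrowLeftUnit φ) :=
  Presentation.hom_eq (P := arrowPresentation M symm Rel) (h.unit (.leftUnit φ))

theorem IsArrowRel.rightUnitor (h : IsArrowRel Rel) (φ : Arrow M) :
    (ρ_ (arrowObj Rel φ)).hom = (arrowData Rel).iso (arrowRightUnit φ) :=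
  Presentation.hom_eq (P := arrowPresentation M symm Rel) (h.unit (.rightUnit φ))

/-- The images of the generators under the functor of plus constructions given by a functor. -/
def plusGenMap (Rel' : ∀ ⦃φ ψ : Arrow N⦄, (plusSignature N symm).Word φ ψ →
      (plusSignature N symm).Word φ ψ → Prop) (F : MonFunctor M N) : ∀ φ ψ : Arrow M, PlusGen M φ ψ →
    (arrowObj Rel' (F.mapArrow.obj φ) ⟶ arrowObj Rel' (F.mapArrow.obj ψ))
  | _, _, .iso e => ((arrowData Rel').pullback F).iso e
  -- The source is the image of the product `g ⊗ f` of `M`, so it must first be taken to the product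
  -- of the images.
  | _, _, .γ g f => (arrowData Rel').iso (F.arrowμ (Arrow.mk g) (Arrow.mk f)).symm ≫
      ((arrowData Rel').pullback F).γ g f

/-- The interpretation of the generators of `M⁺` given by a functor. -/
def plusInterp (h : IsArrowRel Rel') (F : MonFunctor M N) :
    Interp (plusSignature M symm) (arrowPresentation N symm Rel').Cat where
  obj φ := arrowObj Rel' (F.mapArrow.obj φ)
  -- The comparisons are the structure isomorphisms of `F`; in general the resulting functor is
  -- therefore not strict.
  ε := h.laws.isoOf F.arrowε
  μ φ ψ := h.laws.isoOf (F.arrowμ φ ψ)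
  sym hS := Presentation.symmetricCategory _ hS
  gen := plusGenMap Rel' F _ _

/-- The inverse of `(f ⇓ f)` built into the image of `γ` cancels the comparison `μ` of the
interpretation, and `μ` itself is an identity. So the restricted algebra is the same as for words.
-/
theorem plusInterp_mulData (h : IsArrowRel Rel') (F : MonFunctor M N) :
    (plusInterp h F).mulData (plusLetters M symm) = (arrowData Rel').pullback F :=
  MulData.mk_congr
    (fun g f => (h.laws.isoOf (F.arrowμ (Arrow.mk g) (Arrow.mk f))).hom_inv_id_assoc _)
    fun _ _ => (Category.comp_id _).trans (Category.id_comp _).symm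

/-- In the induced category the unit constraint is the one of the target preceded by the inverses of
`μ` and `ε`. All of these are isomorphisms of the arrow category, and they compose to the image of
the constraint by unitality of `F` at source and target. -/
theorem plusInterp_eval_eq_of_unitRel (h : IsArrowRel Rel') (F : MonFunctor M N) ⦃φ ψ : Arrow M⦄
    ⦃f g : (plusSignature M symm).Word φ ψ⦄ (r : UnitRel M symm f g) :
    (plusInterp h F).eval f = (plusInterp h F).eval g := by
  cases r with
  | leftUnit =>
    have h₁ := h.iso_tensorHom F.arrowε.symm (Iso.refl (F.mapArrow.obj ψ))
    have h₂ := h.laws.iso_trans (F.arrowμ (arrowUnit M) ψ).symm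
      (arrowTensorIso F.arrowε.symm (Iso.refl (F.mapArrow.obj ψ)))
    have h₃ := h.laws.iso_trans ((F.arrowμ (arrowUnit M) ψ).symm ≪≫
      (arrowTensorIso F.arrowε.symm (Iso.refl (F.mapArrow.obj ψ))))
      (arrowLeftUnit (F.mapArrow.obj ψ))
    rw [h.laws.iso_refl] at h₁
    have h₄ : ∀ X : M, (Functor.OplaxMonoidal.δ F.toFunctor (𝟙_ M) X ≫
        (Functor.OplaxMonoidal.η F.toFunctor ⊗ₘ 𝟙 (F.obj X))) ≫ (λ_ (F.obj X)).hom =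
        F.map (λ_ X).hom := fun X => by
      rw [Category.assoc, tensorHom_id, ← Functor.OplaxMonoidal.left_unitality_hom]
    refine Eq.trans ?_ (h₃.symm.trans (congrArg (arrowData Rel').iso (arrowIso_ext (h₄ _) (h₄ _))))
    refine congrArg₂ (fun x y => x ≫ y) ?_ (h.leftUnitor _)
    exact (congrArg (fun x => _ ≫ x) h₁).trans h₂.symm
  | rightUnit =>
    have h₁ := h.iso_tensorHom (Iso.refl (F.mapArrow.obj ψ)) F.arrowε.symm
    have h₂ := h.laws.iso_trans (F.arrowμ ψ (arrowUnit M)).symm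
      (arrowTensorIso (Iso.refl (F.mapArrow.obj ψ)) F.arrowε.symm)
    have h₃ := h.laws.iso_trans ((F.arrowμ ψ (arrowUnit M)).symm ≪≫
      (arrowTensorIso (Iso.refl (F.mapArrow.obj ψ)) F.arrowε.symm))
      (arrowRightUnit (F.mapArrow.obj ψ))
    rw [h.laws.iso_refl] at h₁
    have h₄ : ∀ X : M, (Functor.OplaxMonoidal.δ F.toFunctor X (𝟙_ M) ≫
        (𝟙 (F.obj X) ⊗ₘ Functor.OplaxMonoidal.η F.toFunctor)) ≫ (ρ_ (F.obj X)).hom =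
        F.map (ρ_ X).hom := fun X => by
      rw [Category.assoc, id_tensorHom, ← Functor.OplaxMonoidal.right_unitality_hom]
    refine Eq.trans ?_ (h₃.symm.trans (congrArg (arrowData Rel').iso (arrowIso_ext (h₄ _) (h₄ _))))
    refine congrArg₂ (fun x y => x ≫ y) ?_ (h.rightUnitor _)
    exact (congrArg (fun x => _ ≫ x) h₁).trans h₂.symm

theorem plusInterp_extends {h : IsArrowRel Rel'} {F : MonFunctor M N}
    (hI : Interp.Sound (P := arrowPresentation M symm Rel) (plusInterp h F)) :
    ExtendsMul (P := arrowPresentation M symm Rel)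
      (P' := arrowPresentation N symm Rel') F (plusLetters M symm) (plusLetters N symm)
      hI.functor where
  obj _ := rfl
  iso _ := ((Category.id_comp _).trans (Category.comp_id _)).symm
  γ g f := ((h.laws.isoOf (F.arrowμ (Arrow.mk g) (Arrow.mk f))).hom_inv_id_assoc _).trans
    ((Category.id_comp _).symm.trans
      (comp_eq_id_tensor_comp (V := (arrowPresentation N symm Rel').Cat)
        ((arrowData Rel').γ (F.map g) (F.map f)) _))
  μ φ ψ := (Category.comp_id _).trans ((Category.id_comp _).symm.trans
    ((Category.id_comp _).symm.trans (comp_eq_id_tensor_comp (V := (arrowPresentation N symm Rel').Cat)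
      ((arrowData Rel').μ (F.mapArrow.obj φ) (F.mapArrow.obj ψ)) _)))

theorem plusInterp_preservesBraiding {h : IsArrowRel Rel'} {F : MonFunctor M N}
    (hI : Interp.Sound (P := arrowPresentation M symm Rel) (plusInterp h F)) :
    hI.functor.PreservesBraiding :=
  hI.preservesBraiding fun h => ⟨h, rfl⟩

theorem plusIsArrowRel : IsArrowRel (plusPresentation M).Rel where
  unit _ _ _ _ h := .inl h
  mul _ _ _ _ h := .inr (.inl h)
  comp _ _ _ _ h := .inr (.inr h)

theorem symPlusIsArrowRel [SymmetricCategory M] (inter : Prop) :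
    IsArrowRel (symPlusPresentation M inter).Rel where
  unit _ _ _ _ h := .inl h
  mul _ _ _ _ h := .inr (.inl h)
  comp _ _ _ _ h := .inr (.inr (.inl h))

theorem plusInterp_eval_eq (h : IsArrowRel Rel') (F : MonFunctor M N) ⦃φ ψ : Arrow M⦄
    ⦃f g : (plusSignature M symm).Word φ ψ⦄ (r : UnitRel M symm f g ∨
      MulRel (plusLetters M symm) f g ∨ CompRel (plusLetters M symm).toLetters f g) :
    (plusInterp h F).eval f = (plusInterp h F).eval g := by
  obtain r | r | r := r
  · exact plusInterp_eval_eq_of_unitRel h F r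
  · exact Interp.eval_eq_of_mulRel (plusInterp_mulData h F) (h.mulLaws.pullback h.laws F) r
  · exact Interp.eval_eq_of_compRel (plusInterp_mulData h F) (h.laws.pullback F.toFunctor) r

theorem plusInterp_sound (F : MonFunctor M N) :
    Interp.Sound (P := plusPresentation M) (plusInterp (plusIsArrowRel (M := N)) F) :=
  fun _ _ _ _ h => plusInterp_eval_eq plusIsArrowRel F h

theorem symPlusInterp_sound [SymmetricCategory M] [SymmetricCategory N] (inter : Prop)
    {F : MonFunctor M N} (hF : F.IsSymmetric) :
    Interp.Sound (P := symPlusPresentation M inter)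
      (plusInterp (symPlusIsArrowRel (M := N) inter) F) := by
  have h := symPlusIsArrowRel (M := N) inter
  rintro _ _ _ _ (r | r | r | r | ⟨hi, r⟩)
  · exact plusInterp_eval_eq h F (.inl r)
  · exact plusInterp_eval_eq h F (.inr (.inl r))
  · exact plusInterp_eval_eq h F (.inr (.inr r))
  · refine Interp.eval_eq_of_commRel (plusInterp_mulData h F) (fun hS => ?_) r
    let _ := (arrowPresentation N True (symPlusPresentation N inter).Rel).symmetricCategory hS
    exact MulData.Comm.pullback h.laws (MulLetters.comm (P := symPlusPresentation N inter)
      (fun _ _ _ _ r => .inr (.inr (.inr (.inl r)))) hS) hF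
  · refine Interp.eval_eq_of_interchangeRel (plusInterp_mulData h F) (fun hS => ?_) r
    let _ := (arrowPresentation N True (symPlusPresentation N inter).Rel).symmetricCategory hS
    intro _ _ _ _ _ _
    exact MulData.Interchange.pullback h.laws
      (MulLetters.interchange (P := symPlusPresentation N inter)
        (fun _ _ _ _ r => .inr (.inr (.inr (.inr ⟨hi, r⟩)))) hS) F

end Arrow

end PlusConstruction

namespace PlusConstruction

universe w₃

open Functor.LaxMonoidal (ε μ)

/-! ### Identities and composites -/

section Strict

variable {C : Type u₁} [Category.{v₁} C] [MonoidalCategory C] {D : Type u₂} [Category.{v₂} D]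
  [MonoidalCategory D] {E : Type u₃} [Category.{v₃} E] [MonoidalCategory E]

theorem MonFunctor.IsStrict.id : (MonFunctor.id C).IsStrict where
  obj_unit := rfl
  obj_tensor _ _ := rfl
  ε_eq := rfl
  μ_eq _ _ := rfl

theorem MonFunctor.IsStrict.comp {F : MonFunctor C D} {G : MonFunctor D E} (hF : F.IsStrict)
    (hG : G.IsStrict) : (F.comp G).IsStrict where
  obj_unit := hG.obj_unit.trans (congrArg G.obj hF.obj_unit)
  obj_tensor X Y := (hG.obj_tensor _ _).trans (congrArg G.obj (hF.obj_tensor X Y))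
  ε_eq := by
    show ε G.toFunctor ≫ G.map (ε F.toFunctor) = _
    rw [hF.ε_eq, hG.ε_eq, eqToHom_map, eqToHom_trans]
    rfl
  μ_eq X Y := by
    show μ G.toFunctor _ _ ≫ G.map (μ F.toFunctor X Y) = _
    rw [hF.μ_eq, hG.μ_eq, eqToHom_map, eqToHom_trans]
    rfl

theorem MonFunctor.IsSymmetric.id [SymmetricCategory C] : (MonFunctor.id C).IsSymmetric :=
  fun X Y => by
    show 𝟙 _ ≫ (β_ X Y).hom = (β_ X Y).hom ≫ 𝟙 _
    rw [Category.id_comp, Category.comp_id]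

theorem MonFunctor.IsSymmetric.comp [SymmetricCategory C] [SymmetricCategory D]
    [SymmetricCategory E] {F : MonFunctor C D} {G : MonFunctor D E} (hF : F.IsSymmetric)
    (hG : G.IsSymmetric) : (F.comp G).IsSymmetric := fun X Y => by
  have hG' := hG (F.obj X) (F.obj Y)
  show (μ G.toFunctor _ _ ≫ G.map (μ F.toFunctor X Y)) ≫
    G.map (F.map (β_ X Y).hom) = (β_ (G.obj (F.obj X)) (G.obj (F.obj Y))).hom ≫
    μ G.toFunctor _ _ ≫ G.map (μ F.toFunctor Y X)
  rw [Category.assoc, ← Functor.map_comp, hF X Y, Functor.map_comp, reassoc_of% hG']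

end Strict

section

variable {P : Presentation.{w₁}} {P' : Presentation.{w₂}} {P'' : Presentation.{w₃}}

theorem MonFunctor.PreservesBraiding.id : (MonFunctor.id P.Cat).PreservesBraiding := fun h =>
  letI := P.symmetricCategory h
  ⟨h, MonFunctor.IsSymmetric.id⟩

theorem MonFunctor.PreservesBraiding.comp {Q : MonFunctor P.Cat P'.Cat}
    {Q' : MonFunctor P'.Cat P''.Cat} (hQ : Q.PreservesBraiding) (hQ' : Q'.PreservesBraiding) :
    (Q.comp Q').PreservesBraiding := fun h => by
  obtain ⟨h', hQ⟩ := hQ h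
  obtain ⟨h'', hQ'⟩ := hQ' h'
  let _ := P.symmetricCategory h
  let _ := P'.symmetricCategory h'
  let _ := P''.symmetricCategory h''
  exact ⟨h'', MonFunctor.IsSymmetric.comp hQ hQ'⟩

end

/-! ### Pasting of the squares that describe functors on generators -/

section Square

variable {D : Type u₂} [Category.{v₂} D] [MonoidalCategory D] {E : Type u₃} [Category.{v₃} E]
  [MonoidalCategory E]

omit [MonoidalCategory D] in
theorem eqToHom_symm_comp {X Y : D} (h : X = Y) : eqToHom h.symm ≫ eqToHom h = 𝟙 Y := by simp

omit [MonoidalCategory D] [MonoidalCategory E] in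
theorem eqToHom_eq_map_comp (Q : D ⥤ E) {X Y : D} {Z : E} (h : X = Y) (h' : Q.obj Y = Z)
    (h'' : Q.obj X = Z) : eqToHom h'' = Q.map (eqToHom h) ≫ eqToHom h' := by
  subst h; simp

omit [MonoidalCategory D] [MonoidalCategory E] in
theorem eqToHom_eq_comp_map (Q : D ⥤ E) {X Y : D} {Z : E} (h : X = Y) (h' : Z = Q.obj X)
    (h'' : Z = Q.obj Y) : eqToHom h'' = eqToHom h' ≫ Q.map (eqToHom h) := by
  subst h; simp

/-- The square `h` of the first functor is mapped by `Q` and pasted to the square `h'` of `Q`. The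
equalities `d₃'` and `d₃` in the middle cancel, and the correction isomorphisms `i'` and `j` of the
two functors merge into `k`. -/
theorem MonFunctor.map_square (Q : MonFunctor D E) {q₁ q₂ q₃ q a₁ a₂ a₃ a : D} {b₁ b₂ b b₃ : E}
    {m : q₁ ⊗ q₂ ⟶ q} {n : q ⟶ q₃} {e₁ : q₁ ⟶ a₁} {e₂ : q₂ ⟶ a₂} {c : a₁ ⊗ a₂ ⟶ a} {i : a ⟶ a₃}
    {e₃ : a₃ ⟶ q₃} (h : m ≫ n = (e₁ ⊗ₘ e₂) ≫ c ≫ i ≫ e₃) {d₁ : Q.obj a₁ ⟶ b₁}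
    {d₂ : Q.obj a₂ ⟶ b₂} {c' : b₁ ⊗ b₂ ⟶ b} {a' : E} {i' : b ⟶ a'} {d₃ : Q.obj a ⟶ a'}
    {d₃' : a' ⟶ Q.obj a}
    (h' : μ Q.toFunctor a₁ a₂ ≫ Q.map c = (d₁ ⊗ₘ d₂) ≫ c' ≫ i' ≫ d₃') (hd : d₃' ≫ d₃ = 𝟙 a')
    {j : a' ⟶ b₃} {d₄ : b₃ ⟶ Q.obj a₃} (hi : Q.map i = d₃ ≫ j ≫ d₄) {k₁ : Q.obj q₁ ⟶ b₁}
    (hk₁ : k₁ = Q.map e₁ ≫ d₁) {k₂ : Q.obj q₂ ⟶ b₂} (hk₂ : k₂ = Q.map e₂ ≫ d₂)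
    {k : b ⟶ b₃} (hk : i' ≫ j = k) {k₃ : b₃ ⟶ Q.obj q₃} (hk₃ : k₃ = d₄ ≫ Q.map e₃) :
    (μ Q.toFunctor q₁ q₂ ≫ Q.map m) ≫ Q.map n = (k₁ ⊗ₘ k₂) ≫ c' ≫ k ≫ k₃ := by
  subst hk₁ hk₂ hk hk₃
  rw [Category.assoc, ← Q.map_comp, h, ← tensorHom_comp_tensorHom]
  simp only [Functor.map_comp, Category.assoc]
  rw [← Functor.LaxMonoidal.μ_natural_assoc, reassoc_of% h', hi, Category.assoc, Category.assoc,
    reassoc_of% hd]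

end Square

/-! ### Stability of the defining properties under identities, composition and whiskering -/

section Extends

variable {C : Type u₁} [Category.{v₁} C] {D : Type u₂} [Category.{v₂} D] {E : Type u₃}
  [Category.{v₃} E] {P : Presentation.{w₁}} {P' : Presentation.{w₂}} {P'' : Presentation.{w₃}}

theorem Extends.id {L : Letters C P.toSignature} (hL : L.data.Laws) :
    Extends (𝟭 C) L L (MonFunctor.id P.Cat) where
  obj _ := rfl
  iso _ := ((Category.id_comp _).trans (Category.comp_id _)).symm
  γ g f := by
    have h := hL.iso_cellEq_self (Functor.map_comp (𝟭 C) f g).symm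
    refine Eq.trans ?_ (congrArg₂ (fun x y => x ≫ _ ≫ y ≫ 𝟙 _) (id_tensorHom_id _ _).symm h.symm)
    exact congrArg (fun x => _ ≫ x)
      (((congrArg (fun x => _ ≫ x) (Category.comp_id _)).trans (Category.comp_id _)).symm)

variable {F : C ⥤ D} {G : D ⥤ E} {L : Letters C P.toSignature} {L' : Letters D P'.toSignature}
  {L'' : Letters E P''.toSignature} {Q : MonFunctor P.Cat P'.Cat} {Q' : MonFunctor P'.Cat P''.Cat}

theorem Extends.comp (hL : L''.data.Laws) (hQ : Extends F L L' Q) (hQ' : Extends G L' L'' Q') :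
    Extends (F ⋙ G) L L'' (Q.comp Q') where
  obj φ := (congrArg Q'.obj (hQ.obj φ)).trans (hQ'.obj (F.mapArrow.obj φ))
  iso e := by
    refine (congrArg Q'.map (hQ.iso e)).trans ?_
    rw [Functor.map_comp, Functor.map_comp, hQ'.iso, eqToHom_map, eqToHom_map]
    simp only [Category.assoc, eqToHom_trans, eqToHom_trans_assoc]
    rfl
  γ g f := by
    refine Q'.map_square (hQ.γ g f) (hQ'.γ (F.map g) (F.map f)) (eqToHom_symm_comp _)
      (hQ'.iso (cellEq (F.map_comp f g).symm)) 
      (eqToHom_eq_map_comp _ _ _ _) (eqToHom_eq_map_comp _ _ _ _) ?_ 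
      (eqToHom_eq_comp_map Q'.toFunctor (hQ.obj (Arrow.mk (f ≫ g))).symm
        (hQ'.obj (F.mapArrow.obj (Arrow.mk (f ≫ g)))).symm _)
    exact hL.iso_comp _ _ ((congrArg (fun x => _ ≫ x) (G.map_id _)).trans (Category.comp_id _))
        ((congrArg (fun x => _ ≫ x) (G.map_id _)).trans (Category.comp_id _))

/-- Needed because `Q` of a letter is only propositionally the letter at which a second
transformation is known. -/
theorem MonTrans.app_eq_eqToHom {C : Type u₁} [Category.{v₁} C] [MonoidalCategory C] {D : Type u₂}
    [Category.{v₂} D] [MonoidalCategory D] {Q R : MonFunctor C D} (A : Q ⟶ R) {X Y : C} (h : X = Y) :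
    A.hom.app X = eqToHom (congrArg Q.obj h) ≫ A.hom.app Y ≫ eqToHom (congrArg R.obj h.symm) := by
  subst h; simp

variable {F' : C ⥤ D} {F'' : C ⥤ D} {G' : D ⥤ E} {R S : MonFunctor P.Cat P'.Cat}
  {R' : MonFunctor P'.Cat P''.Cat}

theorem IsExtension.refl (hL : L'.data.Laws) (hQ : Extends F L L' Q) :
    IsExtension (Iso.refl F) L L' (Iso.refl Q) := fun φ => by
  have h : L'.isoHom (Arrow.isoOfNatIso (Iso.refl F) φ) = 𝟙 _ :=
    (congrArg L'.isoHom (arrowIso_ext rfl rfl)).trans (hL.iso_refl _)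
  refine ⟨hQ.obj φ, (hQ.obj φ).symm, ?_⟩
  rw [h]
  erw [Category.id_comp]
  rw [eqToHom_trans, eqToHom_refl]
  rfl

theorem IsExtension.trans (hL : L'.data.Laws) {α : F ≅ F'} {β : F' ≅ F''} {A : Q ≅ R} {B : R ≅ S}
    (hA : IsExtension α L L' A) (hB : IsExtension β L L' B) :
    IsExtension (α ≪≫ β) L L' (A ≪≫ B) := fun φ => by
  obtain ⟨hQ, hR, h₁⟩ := hA φ
  obtain ⟨hR', hS, h₂⟩ := hB φ
  refine ⟨hQ, hS, ?_⟩
  have h : L'.isoHom (Arrow.isoOfNatIso (α ≪≫ β) φ) =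
      L'.isoHom (Arrow.isoOfNatIso α φ) ≫ L'.isoHom (Arrow.isoOfNatIso β φ) :=
    (hL.iso_comp _ _ rfl rfl).symm
  refine (congrArg₂ (fun x y => x ≫ y) h₁ h₂).trans ?_
  rw [h]
  simp

/-- The whiskered isomorphism enters through its components alone, so the statement serves both the
monoidal and the symmetric monoidal bicategory. -/
theorem IsExtension.whiskerLeft (hQ : Extends F L L' Q) {α : G ≅ G'} {B : Q' ≅ R'}
    (hB : IsExtension α L' L'' B) {A : Q.comp Q' ≅ Q.comp R'}
    (hA : ∀ X, A.hom.hom.app X = B.hom.hom.app (Q.obj X)) :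
    IsExtension (Functor.isoWhiskerLeft F α) L L'' A := fun φ => by
  obtain ⟨hQ', hR', h⟩ := hB (F.mapArrow.obj φ)
  refine ⟨(congrArg Q'.obj (hQ.obj φ)).trans hQ', hR'.trans (congrArg R'.obj (hQ.obj φ)).symm, ?_⟩
  rw [hA, MonTrans.app_eq_eqToHom B.hom (hQ.obj φ), h]
  simp only [Category.assoc, eqToHom_trans, eqToHom_trans_assoc]
  rfl

theorem IsExtension.whiskerRight (hQ' : Extends G L' L'' Q') {α : F ≅ F'} {B : Q ≅ R}
    (hB : IsExtension α L L' B) {A : Q.comp Q' ≅ R.comp Q'}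
    (hA : ∀ X, A.hom.hom.app X = Q'.map (B.hom.hom.app X)) :
    IsExtension (Functor.isoWhiskerRight α G) L L'' A := fun φ => by
  obtain ⟨hQ, hR, h⟩ := hB φ
  refine ⟨(congrArg Q'.obj hQ).trans (hQ'.obj _), (hQ'.obj _).symm.trans (congrArg Q'.obj hR), ?_⟩
  rw [hA, h, Functor.map_comp, Functor.map_comp, hQ'.iso, eqToHom_map, eqToHom_map]
  simp only [Category.assoc, eqToHom_trans, eqToHom_trans_assoc]
  refine congrArg (fun x => _ ≫ x ≫ _) (congrArg L''.isoHom (arrowIso_ext rfl rfl))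

end Extends

section ExtendsMul

variable {C : Type u₁} [Category.{v₁} C] [MonoidalCategory C] {D : Type u₂} [Category.{v₂} D]
  [MonoidalCategory D] {E : Type u₃} [Category.{v₃} E] [MonoidalCategory E]
  {P : Presentation.{w₁}} {P' : Presentation.{w₂}} {P'' : Presentation.{w₃}}

theorem ExtendsMul.id {L : MulLetters C P.toSignature} (hL : L.data.Laws) :
    ExtendsMul (MonFunctor.id C) L L (MonFunctor.id P.Cat) where
  toExtends := Extends.id hL
  μ φ ψ := by
    have h : L.isoHom ((MonFunctor.id C).arrowμ φ ψ) = 𝟙 _ :=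
      (congrArg L.isoHom (arrowIso_ext rfl rfl)).trans (hL.iso_refl _)
    refine Eq.trans ?_ (congrArg₂ (fun x y => x ≫ _ ≫ y ≫ 𝟙 _) (id_tensorHom_id _ _).symm h.symm)
    exact congrArg (fun x => _ ≫ x)
      (((congrArg (fun x => _ ≫ x) (Category.comp_id _)).trans (Category.comp_id _)).symm)

variable {F : MonFunctor C D} {G : MonFunctor D E} {L : MulLetters C P.toSignature}
  {L' : MulLetters D P'.toSignature} {L'' : MulLetters E P''.toSignature}
  {Q : MonFunctor P.Cat P'.Cat} {Q' : MonFunctor P'.Cat P''.Cat}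

theorem ExtendsMul.comp (hL : L''.data.Laws) (hQ : ExtendsMul F L L' Q)
    (hQ' : ExtendsMul G L' L'' Q') : ExtendsMul (F.comp G) L L'' (Q.comp Q') where
  toExtends := Extends.comp hL hQ.toExtends hQ'.toExtends
  μ φ ψ := by
    refine Q'.map_square (hQ.μ φ ψ) (hQ'.μ (F.mapArrow.obj φ) (F.mapArrow.obj ψ))
      (eqToHom_symm_comp _) (hQ'.iso (F.arrowμ φ ψ)) 
      (eqToHom_eq_map_comp _ _ _ _) (eqToHom_eq_map_comp _ _ _ _) ?_ 
      (eqToHom_eq_comp_map Q'.toFunctor (hQ.obj (arrowTensor φ ψ)).symm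
        (hQ'.obj (F.mapArrow.obj (arrowTensor φ ψ))).symm _)
    exact hL.iso_comp _ _ rfl rfl

end ExtendsMul

end PlusConstruction

namespace PlusConstruction

open Functor.LaxMonoidal (ε μ)

/-! ### Existence and uniqueness of extensions -/

section Words

variable {C : Type u₁} [Category.{v₁} C] {C' : Type u₂} [Category.{v₂} C'] {symm : Prop}
  {Gen : List (Arrow C) → List (Arrow C) → Type (max u₁ v₁)}
  {Rel : ∀ ⦃X Y : List (Arrow C)⦄, (wordSignature (Arrow C) symm Gen).Word X Y →
    (wordSignature (Arrow C) symm Gen).Word X Y → Prop}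
  {L : Letters C (wordSignature (Arrow C) symm Gen)} {P' : Presentation.{w₂}}
  {L' : Letters C' P'.toSignature} {F G : C ⥤ C'}
  {Q R : MonFunctor (wordPresentation (Arrow C) symm Gen Rel).Cat P'.Cat}
  (hobj : L.obj = fun φ => [φ])

include hobj

/-- The family is prescribed on letters and extended to words, so only naturality on generators
depends on the construction at hand. The letters enter through the equation `hobj`, which holds by
definition for all three kinds of words. -/
theorem exists_isExtension_of_gen (hRel : ∀ ⦃X Y : List (Arrow C)⦄
      ⦃f g : (wordSignature (Arrow C) symm Gen).Word X Y⦄, StrictRel f g → Rel f g)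
    (hL' : L'.data.Laws) (bQ : Q.PreservesBraiding) (bR : R.PreservesBraiding)
    (hQ : Extends (P := wordPresentation (Arrow C) symm Gen Rel) F L L' Q)
    (hR : Extends (P := wordPresentation (Arrow C) symm Gen Rel) G L L' R) (α : F ≅ G)
    (hgen : ∀ {t : ∀ X, Q.obj X ⟶ R.obj X}, IsMonoidalFamily t →
      IsExtensionFamily (P := wordPresentation (Arrow C) symm Gen Rel) α L L' t →
        ∀ {X Y : List (Arrow C)} (g : Gen X Y),
          Q.map (Presentation.hom (P := wordPresentation (Arrow C) symm Gen Rel) (.gen g)) ≫ t Y =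
            t X ≫ R.map (Presentation.hom (P := wordPresentation (Arrow C) symm Gen Rel)
              (.gen g))) :
    ∃ A : Q ≅ R, IsExtension (P := wordPresentation (Arrow C) symm Gen Rel) α L L' A := by
  obtain ⟨obj, iso, γ⟩ := L
  obtain rfl : obj = fun φ => [φ] := hobj
  -- The equalities of objects contained in `Extends` turn `(α ⇓ α)` into an isomorphism between the
  -- values of `Q` and `R` on the letter.
  let t (φ : Arrow C) : Q.obj (wordObj Rel [φ]) ≅ R.obj (wordObj Rel [φ]) :=
    eqToIso (hQ.obj φ) ≪≫ hL'.isoOf (Arrow.isoOfNatIso α φ) ≪≫ eqToIso (hR.obj φ).symm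
  have ht := wordFamily_isMonoidalFamily hRel t
  have hE : IsExtensionFamily (P := wordPresentation (Arrow C) symm Gen Rel) α
      ⟨fun φ => [φ], iso, γ⟩ L' fun X => (wordFamily t X).hom :=
    fun φ => ⟨hQ.obj φ, (hR.obj φ).symm, wordFamily_singleton hRel t φ⟩
  exact ⟨MonFunctor.isoOfFamily (wordFamily t) ht (ht.natural_of_gen bQ bR (hgen ht hE)), hE⟩

theorem isExtension_unique {α : F ≅ G} {A B : Q ≅ R}
    (hA : IsExtension (P := wordPresentation (Arrow C) symm Gen Rel) α L L' A)
    (hB : IsExtension (P := wordPresentation (Arrow C) symm Gen Rel) α L L' B) : A = B := by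
  obtain ⟨obj, iso, γ⟩ := L
  obtain rfl : obj = fun φ => [φ] := hobj
  refine wordIso_ext fun φ => ?_
  obtain ⟨_, _, h₁⟩ := hA φ
  obtain ⟨_, _, h₂⟩ := hB φ
  exact h₁.trans h₂.symm

omit hobj in
theorem isoHom_isoOfNatIso_refl (hL' : L'.data.Laws) (φ : Arrow C) :
    L'.isoHom (Arrow.isoOfNatIso (Iso.refl F) φ) = 𝟙 (L'.toCat (F.mapArrow.obj φ)) :=
  (congrArg L'.isoHom (arrowIso_ext rfl rfl)).trans (hL'.iso_refl _)

omit hobj in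
theorem app_eq_eqToHom_of_isExtension {P : Presentation.{w₁}} {L : Letters C P.toSignature}
    {Q R : MonFunctor P.Cat P'.Cat} (hL' : L'.data.Laws) {A : Q ≅ R}
    (hA : IsExtension (Iso.refl F) L L' A) (φ : Arrow C) :
    ∃ e : Q.obj (L.toCat φ) = R.obj (L.toCat φ), A.hom.hom.app (L.toCat φ) = eqToHom e := by
  obtain ⟨h₁, h₂, h⟩ := hA φ
  refine ⟨h₁.trans h₂, h.trans ?_⟩
  rw [isoHom_isoOfNatIso_refl hL']
  exact (congrArg (fun x => _ ≫ x) (Category.id_comp _)).trans (eqToHom_trans _ _)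

/-- The extension of an identity is an `eqToHom` on letters, by strictness also on words, and a
monoidal transformation of this kind exists only between equal functors. Strict preservation of
identities and composites rests on this. -/
theorem eq_of_isExtension_refl (hL' : L'.data.Laws) (sQ : Q.IsStrict) (sR : R.IsStrict) {A : Q ≅ R}
    (hA : IsExtension (P := wordPresentation (Arrow C) symm Gen Rel) (Iso.refl F) L L' A) :
    Q = R := by
  obtain ⟨obj, iso, γ⟩ := L
  obtain rfl : obj = fun φ => [φ] := hobj
  choose e he using app_eq_eqToHom_of_isExtension hL' hA
  refine MonFunctor.eq_of_trans A.hom fun X => ?_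
  obtain ⟨e', h⟩ := wordFamily_eqToHom sQ sR e X
  exact ⟨e', (MonTrans.app_eq_wordFamily (fun a => eqToIso (e a)) A.hom he X).trans h⟩

end Words

/-! #### Categories -/

section Box

/-- The defining properties of the functor of plus constructions given by a functor. -/
structure IsBoxMap {C : Type u₁} [Category.{v₁} C] {D : Type u₂} [Category.{v₂} D] (symm : Prop)
    (F : C ⥤ D) (Q : MonFunctor (boxPresentation C symm).Cat (boxPresentation D symm).Cat) :
    Prop where
  isStrict : Q.IsStrict
  isExtension : Extends F (boxLetters C symm) (boxLetters D symm) Q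
  preservesBraiding : Q.PreservesBraiding

variable {C : Type u₁} [Category.{v₁} C] {D : Type u₂} [Category.{v₂} D] {E : Type u₃}
  [Category.{v₃} E] {symm : Prop}

theorem boxMap_isBoxMap (F : C ⥤ D) : IsBoxMap symm F (boxMap symm F) :=
  ⟨boxMap_isStrict symm F, boxMap_extends symm F, boxMap_preservesBraiding symm F⟩

theorem IsBoxMap.id : IsBoxMap symm (𝟭 C) (MonFunctor.id (boxPresentation C symm).Cat) :=
  ⟨.id, .id (boxLaws symm), .id⟩

theorem IsBoxMap.comp {F : C ⥤ D} {G : D ⥤ E}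
    {Q : MonFunctor (boxPresentation C symm).Cat (boxPresentation D symm).Cat}
    {R : MonFunctor (boxPresentation D symm).Cat (boxPresentation E symm).Cat}
    (hQ : IsBoxMap symm F Q) (hR : IsBoxMap symm G R) : IsBoxMap symm (F ⋙ G) (Q.comp R) :=
  ⟨.comp hQ.isStrict hR.isStrict, .comp (boxLaws symm) hQ.isExtension hR.isExtension,
    .comp hQ.preservesBraiding hR.preservesBraiding⟩

variable {F G : C ⥤ D} {Q R : MonFunctor (boxPresentation C symm).Cat (boxPresentation D symm).Cat}

theorem IsBoxMap.exists_isExtension (hQ : IsBoxMap symm F Q) (hR : IsBoxMap symm G R) (α : F ≅ G) :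
    ∃ A : Q ≅ R, IsExtension α (boxLetters C symm) (boxLetters D symm) A := by
  refine exists_isExtension_of_gen rfl (fun _ _ _ _ => Or.inl) (boxLaws symm) hQ.preservesBraiding
    hR.preservesBraiding hQ.isExtension hR.isExtension α fun ht hE _ _ g => ?_
  cases g with
  | iso e => exact hQ.isExtension.natural_isoHom hR.isExtension (boxLaws symm) hE e
  | γ g f => exact hQ.isExtension.natural_γHom hR.isExtension (boxLaws symm) ht hE g f

theorem IsBoxMap.unique (hQ : IsBoxMap symm F Q) (hR : IsBoxMap symm F R) : Q = R := by
  obtain ⟨A, hA⟩ := hQ.exists_isExtension hR (Iso.refl F)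
  exact eq_of_isExtension_refl rfl (boxLaws symm) hQ.isStrict hR.isStrict hA

end Box

/-! #### Monoidal categories -/

section Mul

/-- The defining properties of the functor of plus constructions given by a strong monoidal
functor. -/
structure IsWordMap {M : Type u₁} [Category.{v₁} M] [MonoidalCategory M] {N : Type u₂}
    [Category.{v₂} N] [MonoidalCategory N] {P : Presentation.{w₁}} {P' : Presentation.{w₂}}
    (F : MonFunctor M N) (L : MulLetters M P.toSignature) (L' : MulLetters N P'.toSignature)
    (Q : MonFunctor P.Cat P'.Cat) : Prop where
  isStrict : Q.IsStrict
  isExtension : ExtendsMul F L L' Q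
  preservesBraiding : Q.PreservesBraiding

variable {M : Type u₁} [Category.{v₁} M] [MonoidalCategory M] {N : Type u₂} [Category.{v₂} N]
  [MonoidalCategory N] {K : Type u₃} [Category.{v₃} K] [MonoidalCategory K]

theorem IsWordMap.id {P : Presentation.{w₁}} {L : MulLetters M P.toSignature} (hL : L.data.Laws) :
    IsWordMap (MonFunctor.id M) L L (MonFunctor.id P.Cat) :=
  ⟨.id, .id hL, .id⟩

theorem IsWordMap.comp {P : Presentation.{w₁}} {P' : Presentation.{w₂}} {P'' : Presentation.{w₃}}
    {L : MulLetters M P.toSignature} {L' : MulLetters N P'.toSignature}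
    {L'' : MulLetters K P''.toSignature} (hL : L''.data.Laws) {F : MonFunctor M N}
    {G : MonFunctor N K} {Q : MonFunctor P.Cat P'.Cat} {R : MonFunctor P'.Cat P''.Cat}
    (hQ : IsWordMap F L L' Q) (hR : IsWordMap G L' L'' R) :
    IsWordMap (F.comp G) L L'' (Q.comp R) :=
  ⟨.comp hQ.isStrict hR.isStrict, .comp hL hQ.isExtension hR.isExtension,
    .comp hQ.preservesBraiding hR.preservesBraiding⟩

/-! ### Extensions for `M^{nc+}` -/

section Nc

variable {Rel : ∀ ⦃X Y : List (Arrow M)⦄, (wordSignature (Arrow M) True (NcGen M)).Word X Y →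
    (wordSignature (Arrow M) True (NcGen M)).Word X Y → Prop}
  {Rel' : ∀ ⦃X Y : List (Arrow N)⦄, (wordSignature (Arrow N) True (NcGen N)).Word X Y →
    (wordSignature (Arrow N) True (NcGen N)).Word X Y → Prop}

variable (Rel Rel') in
/-- The defining properties of the functor of plus constructions given by a strong monoidal
functor. -/
abbrev IsNcMap (F : MonFunctor M N) (Q : MonFunctor (wordPresentation (Arrow M) True (NcGen M) Rel).Cat
    (wordPresentation (Arrow N) True (NcGen N) Rel').Cat) : Prop :=
  IsWordMap (P := wordPresentation (Arrow M) True (NcGen M) Rel)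
    (P' := wordPresentation (Arrow N) True (NcGen N) Rel') F (ncLetters M) (ncLetters N) Q

theorem ncInterp_isNcMap {F : MonFunctor M N}
    (h : Interp.Sound (P := wordPresentation (Arrow M) True (NcGen M) Rel) (ncInterp Rel' F)) :
    IsNcMap Rel Rel' F h.functor :=
  ⟨wordInterp_isStrict h, ncInterp_extends h, wordInterp_preservesBraiding h⟩

variable {F G : MonFunctor M N}
  {Q R : MonFunctor (wordPresentation (Arrow M) True (NcGen M) Rel).Cat
    (wordPresentation (Arrow N) True (NcGen N) Rel').Cat}

theorem IsNcMap.exists_isExtension (h : IsPlusRel (ncLetters M) Rel)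
    (h' : IsPlusRel (ncLetters N) Rel') (hQ : IsNcMap Rel Rel' F Q) (hR : IsNcMap Rel Rel' G R)
    (α : F ≅ G) : ∃ A : Q ≅ R, IsExtension (P := wordPresentation (Arrow M) True (NcGen M) Rel)
      (P' := wordPresentation (Arrow N) True (NcGen N) Rel') (MonFunctor.natIso α)
      (ncLetters M).toLetters (ncLetters N).toLetters A := by
  refine exists_isExtension_of_gen rfl h.strict h'.laws hQ.preservesBraiding
    hR.preservesBraiding hQ.isExtension.toExtends hR.isExtension.toExtends _ fun ht hE _ _ g => ?_
  cases g with
  | iso e => exact hQ.isExtension.natural_isoHom hR.isExtension.toExtends h'.laws hE e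
  | γ g f => exact hQ.isExtension.natural_γHom hR.isExtension.toExtends h'.laws ht hE g f
  | μ φ ψ => exact hQ.isExtension.natural_μHom hR.isExtension h'.laws h'.mulLaws ht hE φ ψ

theorem IsNcMap.unique (h : IsPlusRel (ncLetters M) Rel) (h' : IsPlusRel (ncLetters N) Rel')
    (hQ : IsNcMap Rel Rel' F Q) (hR : IsNcMap Rel Rel' F R) : Q = R := by
  obtain ⟨A, hA⟩ := hQ.exists_isExtension h h' hR (Iso.refl F)
  exact eq_of_isExtension_refl rfl h'.laws hQ.isStrict hR.isStrict hA

end Nc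

/-! ### Extensions for `M^{loc+}` -/

section Loc

variable {Rel : ∀ ⦃X Y : List (Arrow M)⦄, (wordSignature (Arrow M) True (LocGen M)).Word X Y →
    (wordSignature (Arrow M) True (LocGen M)).Word X Y → Prop}
  {Rel' : ∀ ⦃X Y : List (Arrow N)⦄, (wordSignature (Arrow N) True (LocGen N)).Word X Y →
    (wordSignature (Arrow N) True (LocGen N)).Word X Y → Prop}

variable (Rel Rel') in
/-- The defining properties of the functor of plus constructions given by a strong monoidal
functor. -/
abbrev IsLocMap (F : MonFunctor M N)
    (Q : MonFunctor (wordPresentation (Arrow M) True (LocGen M) Rel).Cat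
      (wordPresentation (Arrow N) True (LocGen N) Rel').Cat) : Prop :=
  IsWordMap (P := wordPresentation (Arrow M) True (LocGen M) Rel)
    (P' := wordPresentation (Arrow N) True (LocGen N) Rel') F (locLetters M) (locLetters N) Q

theorem locInterp_isLocMap {F : MonFunctor M N}
    (h : Interp.Sound (P := wordPresentation (Arrow M) True (LocGen M) Rel) (locInterp Rel' F)) :
    IsLocMap Rel Rel' F h.functor :=
  ⟨wordInterp_isStrict h, locInterp_extends h, wordInterp_preservesBraiding h⟩

/-- The isomorphism `μ`. -/
def locμIso (hI : ∀ ⦃X Y : List (Arrow M)⦄ ⦃f g : (wordSignature (Arrow M) True (LocGen M)).Word X Y⦄,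
      InvRel M f g → Rel f g) (φ ψ : Arrow M) :
    wordObj Rel [φ, ψ] ≅ wordObj Rel [arrowTensor φ ψ] where
  hom := Presentation.hom (P := wordPresentation (Arrow M) True (LocGen M) Rel) (.gen (.nc (.μ φ ψ)))
  inv := Presentation.hom (P := wordPresentation (Arrow M) True (LocGen M) Rel) (.gen (.μInv φ ψ))
  hom_inv_id := Presentation.hom_eq (P := wordPresentation (Arrow M) True (LocGen M) Rel)
    (hI (.μ_μInv φ ψ))
  inv_hom_id := Presentation.hom_eq (P := wordPresentation (Arrow M) True (LocGen M) Rel)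
    (hI (.μInv_μ φ ψ))

variable {F G : MonFunctor M N}
  {Q R : MonFunctor (wordPresentation (Arrow M) True (LocGen M) Rel).Cat
    (wordPresentation (Arrow N) True (LocGen N) Rel').Cat}

theorem IsLocMap.exists_isExtension (h : IsPlusRel (locLetters M) Rel)
    (hI : ∀ ⦃X Y : List (Arrow M)⦄ ⦃f g : (wordSignature (Arrow M) True (LocGen M)).Word X Y⦄,
      InvRel M f g → Rel f g)
    (h' : IsPlusRel (locLetters N) Rel') (hQ : IsLocMap Rel Rel' F Q) (hR : IsLocMap Rel Rel' G R)
    (α : F ≅ G) : ∃ A : Q ≅ R, IsExtension (P := wordPresentation (Arrow M) True (LocGen M) Rel)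
      (P' := wordPresentation (Arrow N) True (LocGen N) Rel') (MonFunctor.natIso α)
      (locLetters M).toLetters (locLetters N).toLetters A := by
  refine exists_isExtension_of_gen rfl h.strict h'.laws hQ.preservesBraiding
    hR.preservesBraiding hQ.isExtension.toExtends hR.isExtension.toExtends _ fun ht hE _ _ g => ?_
  have hμ := hQ.isExtension.natural_μHom hR.isExtension h'.laws h'.mulLaws ht hE
  rcases g with g | ⟨φ, ψ⟩
  · cases g with
    | iso e => exact hQ.isExtension.natural_isoHom hR.isExtension.toExtends h'.laws hE e
    | γ g f => exact hQ.isExtension.natural_γHom hR.isExtension.toExtends h'.laws ht hE g f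
    | μ φ ψ => exact hμ φ ψ
  -- Naturality at `μ⁻¹` is inherited from naturality at `μ`.
  · exact IsMonoidalFamily.natural_inv (e := locμIso hI φ ψ) (hμ φ ψ)

theorem IsLocMap.unique (h : IsPlusRel (locLetters M) Rel)
    (hI : ∀ ⦃X Y : List (Arrow M)⦄ ⦃f g : (wordSignature (Arrow M) True (LocGen M)).Word X Y⦄,
      InvRel M f g → Rel f g) (h' : IsPlusRel (locLetters N) Rel')
    (hQ : IsLocMap Rel Rel' F Q) (hR : IsLocMap Rel Rel' F R) : Q = R := by
  obtain ⟨A, hA⟩ := hQ.exists_isExtension h hI h' hR (Iso.refl F)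
  exact eq_of_isExtension_refl rfl h'.laws hQ.isStrict hR.isStrict hA

end Loc

end Mul

/-! #### The reduced version -/

section Plus

variable {M : Type u₁} [Category.{v₁} M] [MonoidalCategory M] {N : Type u₂} [Category.{v₂} N]
  [MonoidalCategory N] {K : Type u₃} [Category.{v₃} K] [MonoidalCategory K] {symm : Prop}
  {Rel : ∀ ⦃φ ψ : Arrow M⦄, (plusSignature M symm).Word φ ψ →
      (plusSignature M symm).Word φ ψ → Prop}
  {Rel' : ∀ ⦃φ ψ : Arrow N⦄, (plusSignature N symm).Word φ ψ →
      (plusSignature N symm).Word φ ψ → Prop}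
  {Rel'' : ∀ ⦃φ ψ : Arrow K⦄, (plusSignature K symm).Word φ ψ →
      (plusSignature K symm).Word φ ψ → Prop}

variable (Rel Rel') in
/-- The defining properties of the functor of plus constructions given by a strong monoidal
functor. -/
structure IsPlusMap (F : MonFunctor M N)
    (Q : MonFunctor (arrowPresentation M symm Rel).Cat (arrowPresentation N symm Rel').Cat) :
    Prop where
  isExtension : ExtendsMul (P := arrowPresentation M symm Rel)
    (P' := arrowPresentation N symm Rel') F (plusLetters M symm) (plusLetters N symm) Q
  -- `ExtendsMul` does not mention the unit morphism, while the unit axiom of the comparison between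
  -- two such functors refers to it.
  ε_eq : ε Q.toFunctor = (arrowData Rel').iso F.arrowε ≫
    eqToHom (isExtension.obj (arrowUnit M)).symm
  preservesBraiding : Q.PreservesBraiding

theorem plusInterp_isPlusMap {h : IsArrowRel Rel'} {F : MonFunctor M N}
    (hI : Interp.Sound (P := arrowPresentation M symm Rel) (plusInterp h F)) :
    IsPlusMap Rel Rel' F hI.functor :=
  ⟨plusInterp_extends hI, (Category.comp_id _).symm, plusInterp_preservesBraiding hI⟩

theorem IsPlusMap.id (h : IsArrowRel Rel) :
    IsPlusMap Rel Rel (MonFunctor.id M) (MonFunctor.id (arrowPresentation M symm Rel).Cat) where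
  isExtension := .id h.laws
  ε_eq := by
    refine Eq.trans ?_ (Category.comp_id _).symm
    exact (h.laws.iso_refl _).symm.trans (congrArg (arrowData Rel).iso (arrowIso_ext rfl rfl))
  preservesBraiding := .id

theorem comp_eqToHom_comp {D : Type u₃} [Category.{v₃} D] {a b b' c d e : D} (i : a ⟶ b)
    (p : b = b') (j : b ⟶ c) (q : c = d) (r : d = e) :
    (i ≫ eqToHom p) ≫ (eqToHom p.symm ≫ j ≫ eqToHom q) ≫ eqToHom r =
      (i ≫ j) ≫ eqToHom (q.trans r) := by
  subst p q r; simp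

theorem IsPlusMap.comp (h : IsArrowRel Rel'') {F : MonFunctor M N} {G : MonFunctor N K}
    {Q : MonFunctor (arrowPresentation M symm Rel).Cat (arrowPresentation N symm Rel').Cat}
    {R : MonFunctor (arrowPresentation N symm Rel').Cat (arrowPresentation K symm Rel'').Cat}
    (hQ : IsPlusMap Rel Rel' F Q) (hR : IsPlusMap Rel' Rel'' G R) :
    IsPlusMap Rel Rel'' (F.comp G) (Q.comp R) where
  isExtension := .comp h.laws hQ.isExtension hR.isExtension
  ε_eq := by
    have h₁ := (congrArg R.map hQ.ε_eq).trans (Functor.map_comp _ _ _)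
    have h₂ := hR.isExtension.iso F.arrowε
    have h₃ := hR.ε_eq
    have h₄ : (arrowData Rel'').iso G.arrowε ≫
        (arrowData Rel'').iso (G.mapArrow.mapIso F.arrowε) =
          (arrowData Rel'').iso (F.comp G).arrowε :=
      h.laws.iso_comp _ _ rfl rfl
    refine (congrArg₂ (fun x y => x ≫ y) h₃ (h₁.trans
      (congrArg₂ (fun x y => x ≫ y) h₂ (eqToHom_map R.toFunctor _)))).trans ?_
    refine Eq.trans ?_ (congrArg (fun x => x ≫ _) h₄)
    exact comp_eqToHom_comp _ (hR.isExtension.obj (arrowUnit N)).symm _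
      (hR.isExtension.obj (F.mapArrow.obj (arrowUnit M))).symm
      (congrArg R.obj (hQ.isExtension.obj (arrowUnit M)).symm)
  preservesBraiding := .comp hQ.preservesBraiding hR.preservesBraiding

/-- The counterpart of `natural_of_squares` for the product axiom of a transformation, with the same
cancellation of object equalities. -/
theorem monoidal_of_squares {D : Type u₃} [Category.{v₃} D] [MonoidalCategory D]
    {q₁ q₂ q r₁ r₂ r a₁ a₂ a b₁ b₂ b : D}
    (e₁ : q₁ ≅ a₁) (e₂ : q₂ ≅ a₂) (e : q ≅ a) (d₁ : r₁ ≅ b₁) (d₂ : r₂ ≅ b₂) (d : r ≅ b)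
    {μQ : q₁ ⊗ q₂ ⟶ q} {μR : r₁ ⊗ r₂ ⟶ r} {i : a₁ ⊗ a₂ ⟶ a} {i' : b₁ ⊗ b₂ ⟶ b}
    (hm : μQ = (e₁.hom ⊗ₘ e₂.hom) ≫ i ≫ e.inv) (hn : μR = (d₁.hom ⊗ₘ d₂.hom) ≫ i' ≫ d.inv)
    {s₁ : a₁ ⟶ b₁} {s₂ : a₂ ⟶ b₂} {s : a ⟶ b} (hs : (s₁ ⊗ₘ s₂) ≫ i' = i ≫ s)
    {t₁ : q₁ ⟶ r₁} {t₂ : q₂ ⟶ r₂} {t : q ⟶ r}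
    (h₁ : t₁ = e₁.hom ≫ s₁ ≫ d₁.inv) (h₂ : t₂ = e₂.hom ≫ s₂ ≫ d₂.inv)
    (h : t = e.hom ≫ s ≫ d.inv) : μQ ≫ t = (t₁ ⊗ₘ t₂) ≫ μR := by
  subst h₁ h₂ h hm hn
  rw [tensorHom_comp_tensorHom_assoc]
  simp only [Category.assoc, Iso.inv_hom_id, Category.comp_id, Iso.inv_hom_id_assoc]
  rw [← reassoc_of% hs]
  simp

variable {F G : MonFunctor M N}
  {Q R : MonFunctor (arrowPresentation M symm Rel).Cat (arrowPresentation N symm Rel').Cat}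

/-- Since `μ` of the reduced construction is an identity, the condition on `μ` in `ExtendsMul`
becomes a formula for the structure morphism of `Q`, namely `(f ⇓ f)`. -/
theorem IsPlusMap.μ_eq (hQ : IsPlusMap Rel Rel' F Q) (φ ψ : Arrow M) :
    μ Q.toFunctor (arrowObj Rel φ) (arrowObj Rel ψ) =
      (eqToHom (hQ.isExtension.obj φ) ⊗ₘ eqToHom (hQ.isExtension.obj ψ)) ≫
        (arrowData Rel').iso (F.arrowμ φ ψ) ≫
          eqToHom (hQ.isExtension.obj (arrowTensor φ ψ)).symm := by
  refine Eq.trans ?_ ((hQ.isExtension.μ φ ψ).trans (congrArg (fun x => _ ≫ x) (Category.id_comp _)))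
  exact ((congrArg (fun x => _ ≫ x) (Q.map_id _)).trans (Category.comp_id _)).symm

/-- Every object is a letter, so `α` prescribes the whole family. Its compatibility with structure
morphisms is no longer built in and has to be deduced from monoidality of `α`. -/
theorem IsPlusMap.exists_isExtension (h' : IsArrowRel Rel') (hQ : IsPlusMap Rel Rel' F Q)
    (hR : IsPlusMap Rel Rel' G R) (α : F ≅ G) :
    ∃ A : Q ≅ R, IsExtension (P := arrowPresentation M symm Rel)
      (P' := arrowPresentation N symm Rel') (MonFunctor.natIso α)
      (plusLetters M symm).toLetters (plusLetters N symm).toLetters A := by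
  let t (φ : Arrow M) : Q.obj (arrowObj Rel φ) ≅ R.obj (arrowObj Rel φ) :=
    eqToIso (hQ.isExtension.obj φ) ≪≫ h'.laws.isoOf (Arrow.isoOfNatIso (MonFunctor.natIso α) φ) ≪≫
      eqToIso (hR.isExtension.obj φ).symm
  have ht : IsMonoidalFamily (Q := Q) (R := R) fun φ => (t φ).hom := by
    constructor
    -- The unit axiom of `α`, read at the source and at the target of the identity of the unit
    -- object.
    · have h₁ : (arrowData Rel').iso F.arrowε ≫
          (arrowData Rel').iso (Arrow.isoOfNatIso (MonFunctor.natIso α) (arrowUnit M)) =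
            (arrowData Rel').iso G.arrowε :=
        h'.laws.iso_comp _ _ α.hom.isMonoidal.unit α.hom.isMonoidal.unit
      refine (congrArg (fun x => x ≫ _) hQ.ε_eq).trans (Eq.trans ?_ hR.ε_eq.symm)
      refine Eq.trans ?_ (congrArg (fun x => x ≫ _) h₁)
      refine (congrArg (fun x => _ ≫ x) (Category.comp_id _).symm).trans ?_
      refine Eq.trans ?_ (comp_eqToHom_comp _ (hQ.isExtension.obj (arrowUnit M)).symm _
        (hR.isExtension.obj (arrowUnit M)).symm rfl)
      rfl
    · intro φ ψ
      refine monoidal_of_squares (eqToIso (hQ.isExtension.obj φ)) (eqToIso (hQ.isExtension.obj ψ))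
        (eqToIso (hQ.isExtension.obj (arrowTensor φ ψ))) (eqToIso (hR.isExtension.obj φ))
        (eqToIso (hR.isExtension.obj ψ)) (eqToIso (hR.isExtension.obj (arrowTensor φ ψ)))
        (hQ.μ_eq φ ψ) (hR.μ_eq φ ψ) ?_ rfl rfl rfl
      refine (congrArg (fun x => x ≫ _) (h'.iso_tensorHom _ _)).trans ?_
      refine (h'.laws.iso_trans _ _).symm.trans (Eq.trans ?_ (h'.laws.iso_trans _ _))
      exact congrArg (arrowData Rel').iso (arrowIso_ext
        (α.hom.isMonoidal.tensor _ _).symm (α.hom.isMonoidal.tensor _ _).symm)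
  have hE : IsExtensionFamily (P := arrowPresentation M symm Rel)
      (P' := arrowPresentation N symm Rel') (MonFunctor.natIso α)
      (plusLetters M symm).toLetters (plusLetters N symm).toLetters (Q := Q) (R := R)
      fun φ => (t φ).hom :=
    fun φ => ⟨hQ.isExtension.obj φ, (hR.isExtension.obj φ).symm, rfl⟩
  refine ⟨MonFunctor.isoOfFamily t ht (ht.natural_of_gen hQ.preservesBraiding hR.preservesBraiding
    fun g => ?_), hE⟩
  cases g with
  | iso e => exact hQ.isExtension.natural_isoHom hR.isExtension.toExtends h'.laws hE e
  | γ g f => exact hQ.isExtension.natural_γHom hR.isExtension.toExtends h'.laws ht hE g f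

theorem isExtension_unique_of_plus {F G : M ⥤ N} {α : F ≅ G} {A B : Q ≅ R}
    (hA : IsExtension (P := arrowPresentation M symm Rel)
      (P' := arrowPresentation N symm Rel') α
      (plusLetters M symm).toLetters (plusLetters N symm).toLetters A)
    (hB : IsExtension (P := arrowPresentation M symm Rel)
      (P' := arrowPresentation N symm Rel') α
      (plusLetters M symm).toLetters (plusLetters N symm).toLetters B) : A = B := by
  refine Iso.ext (MonTrans.ext_app fun φ => ?_)
  obtain ⟨_, _, h₁⟩ := hA φ
  obtain ⟨_, _, h₂⟩ := hB φ
  exact h₁.trans h₂.symm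

/-- No strictness is needed here: the components at all objects are prescribed directly. -/
theorem IsPlusMap.unique (h' : IsArrowRel Rel') (hQ : IsPlusMap Rel Rel' F Q)
    (hR : IsPlusMap Rel Rel' F R) : Q = R := by
  obtain ⟨A, hA⟩ := hQ.exists_isExtension h' hR (Iso.refl F)
  exact MonFunctor.eq_of_trans A.hom
    (app_eq_eqToHom_of_isExtension (F := F.toFunctor) h'.laws hA)

end Plus

end PlusConstruction

namespace PlusConstruction

/-! ### Functoriality -/

section TwoFunctor

variable {A : Type u₁} {B : Type u₂} [Bicategory.{w₁, v₁} A] [Bicategory.{w₂, v₂} B] {obj : A → B}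

/-- Relations between the 1-cells and between the invertible 2-cells of two bicategories that are
functional and compatible with the operations define a strict 2-functor. -/
theorem exists_twoFunctor
    (D : ∀ {M N : A}, (M ⟶ N) → (obj M ⟶ obj N) → Prop)
    (E : ∀ {M N : A} {F G : M ⟶ N}, (F ≅ G) → ∀ {f g : obj M ⟶ obj N}, (f ≅ g) → Prop)
    (D_exists : ∀ {M N : A} (F : M ⟶ N), ∃ f, D F f)
    (D_unique : ∀ {M N : A} {F : M ⟶ N} {f f' : obj M ⟶ obj N}, D F f → D F f' → f = f')
    (D_id : ∀ M : A, D (𝟙 M) (𝟙 (obj M)))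
    (D_comp : ∀ {M N K : A} {F : M ⟶ N} {G : N ⟶ K} {f : obj M ⟶ obj N} {g : obj N ⟶ obj K},
      D F f → D G g → D (F ≫ G) (f ≫ g))
    (E_exists : ∀ {M N : A} {F G : M ⟶ N} {f g : obj M ⟶ obj N}, D F f → D G g → ∀ α : F ≅ G,
      ∃ X : f ≅ g, E α X)
    (E_unique : ∀ {M N : A} {F G : M ⟶ N} {f g : obj M ⟶ obj N} {α : F ≅ G} {X Y : f ≅ g},
      E α X → E α Y → X = Y)
    (E_refl : ∀ {M N : A} {F : M ⟶ N} {f : obj M ⟶ obj N}, D F f → E (Iso.refl F) (Iso.refl f))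
    (E_trans : ∀ {M N : A} {F G H : M ⟶ N} {f g h : obj M ⟶ obj N} {α : F ≅ G} {β : G ≅ H}
      {X : f ≅ g} {Y : g ≅ h}, E α X → E β Y → E (α ≪≫ β) (X ≪≫ Y))
    (E_whiskerLeft : ∀ {M N K : A} {F : M ⟶ N} {G H : N ⟶ K} {f : obj M ⟶ obj N}
      {g h : obj N ⟶ obj K} {α : G ≅ H} {X : g ≅ h}, D F f → E α X →
        E (Bicategory.whiskerLeftIso F α) (Bicategory.whiskerLeftIso f X))
    (E_whiskerRight : ∀ {M N K : A} {F G : M ⟶ N} {H : N ⟶ K} {f g : obj M ⟶ obj N}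
      {h : obj N ⟶ obj K} {α : F ≅ G} {X : f ≅ g}, D H h → E α X →
        E (Bicategory.whiskerRightIso α H) (Bicategory.whiskerRightIso X h)) :
    ∃ P : TwoFunctor obj, (∀ {M N : A} (F : M ⟶ N), D F (P.map F)) ∧
      ∀ {M N : A} {F G : M ⟶ N} (α : F ≅ G), E α (P.map₂ α) := by
  choose map hmap using @D_exists
  choose map₂ hmap₂ using fun {M N : A} {F G : M ⟶ N} => E_exists (hmap F) (hmap G)
  -- Whiskered 2-cells live between composites of the chosen 1-cells, which equal the chosen 1-cell
  -- of the composite only by `D_unique`. Hence `E` must be invariant under conjugation by such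
  -- equalities, which holds by substitution.
  have E_conj : ∀ {M N : A} {F G : M ⟶ N} {α : F ≅ G} {f f' g g' : obj M ⟶ obj N} {X : f ≅ g}
      (h : f' = f) (h' : g = g'), E α X → E α (eqToIso h ≪≫ X ≪≫ eqToIso h') := by
    intro M N F G α f f' g g' X h h' hX
    subst h h'
    simpa using hX
  exact ⟨
    { map := map
      map₂ := map₂
      map_id := fun M => D_unique (hmap _) (D_id M)
      map_comp := fun F G => D_unique (hmap _) (D_comp (hmap F) (hmap G))
      map₂_refl := fun F => E_unique (hmap₂ _) (E_refl (hmap F))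
      map₂_trans := fun α β => E_unique (hmap₂ _) (E_trans (hmap₂ α) (hmap₂ β))
      map₂_whiskerLeft := fun F _ _ α => E_unique (hmap₂ _)
        (E_conj _ _ (E_whiskerLeft (hmap F) (hmap₂ α)))
      map₂_whiskerRight := fun α H => E_unique (hmap₂ _)
        (E_conj _ _ (E_whiskerRight (hmap H) (hmap₂ α))) },
    hmap, hmap₂⟩

end TwoFunctor

theorem exists_boxTwoFunctor :
    ∃ P : TwoFunctor (fun C : CategoryTheory.Cat.{v, u} => BoxPlus C),
      (∀ {C D : CategoryTheory.Cat.{v, u}} (F : C ⟶ D), IsBoxMap False F.toFunctor (P.map F)) ∧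
      (∀ {C D : CategoryTheory.Cat.{v, u}} {F G : C ⟶ D} (α : F ≅ G),
        IsExtension (CategoryTheory.Cat.Hom.toNatIso α) (boxLetters C False) (boxLetters D False)
          (P.map₂ α)) :=
  exists_twoFunctor
    (D := fun {C D : CategoryTheory.Cat.{v, u}} (F : C ⟶ D) (Q : BoxPlus C ⟶ BoxPlus D) => IsBoxMap False F.toFunctor Q)
    (E := fun {C D : CategoryTheory.Cat.{v, u}} {F G : C ⟶ D} (α : F ≅ G) {Q R : BoxPlus C ⟶ BoxPlus D} (A : Q ≅ R) =>
      IsExtension (P := boxPresentation C False) (P' := boxPresentation D False) (Q := Q) (R := R)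
        (CategoryTheory.Cat.Hom.toNatIso α)
        (boxLetters C False) (boxLetters D False) A)
    (fun F => ⟨_, boxMap_isBoxMap F.toFunctor⟩)
    (fun hQ hR => hQ.unique hR)
    (fun _ => .id)
    (fun hQ hR => hQ.comp hR)
    (fun hQ hR _ => hQ.exists_isExtension hR _)
    (fun hA hB => isExtension_unique rfl hA hB)
    (fun hQ => .refl (boxLaws False) hQ.isExtension)
    (fun hA hB => .trans (boxLaws False) hA hB)
    (fun hQ hA => .whiskerLeft hQ.isExtension hA fun _ => rfl)
    (fun hQ hA => .whiskerRight hQ.isExtension hA fun _ => rfl)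


section InvRel

variable {M : Type u} [Category.{v} M] [MonoidalCategory M] ⦃X Y : List (Arrow M)⦄
  ⦃f g : (wordSignature (Arrow M) True (LocGen M)).Word X Y⦄

theorem locPresentation_invRel (h : InvRel M f g) : (locPresentation M).Rel f g :=
  .inr (.inr (.inr (.inr h)))

theorem symLocPresentation_invRel {M : Type u} [Category.{v} M] [MonoidalCategory M]
    [SymmetricCategory M] ⦃X Y : List (Arrow M)⦄
    ⦃f g : (wordSignature (Arrow M) True (LocGen M)).Word X Y⦄ (h : InvRel M f g) :
    (symLocPresentation M).Rel f g := .inl (locPresentation_invRel h)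

end InvRel

theorem SymMonFunctor.ext_toMonFunctor {M N : SymMonoidalCat.{v, u}} {F G : SymMonFunctor M N}
    (h : F.toMonFunctor = G.toMonFunctor) : F = G := by
  cases F; cases G; congr

theorem SymMonFunctor.ext_monIso {M N : SymMonoidalCat.{v, u}} {F G : SymMonFunctor M N}
    {α β : F ≅ G} (h : SymMonFunctor.monIso α = SymMonFunctor.monIso β) : α = β :=
  Iso.ext (congrArg (Iso.hom (X := F.toMonFunctor)) h)

theorem exists_symBoxTwoFunctor :
    ∃ P : TwoFunctor (fun C : CategoryTheory.Cat.{v, u} => SymBoxPlus C),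
      (∀ {C D : CategoryTheory.Cat.{v, u}} (F : C ⟶ D),
        IsBoxMap True F.toFunctor (SymMonFunctor.toMonFunctor (P.map F))) ∧
      (∀ {C D : CategoryTheory.Cat.{v, u}} {F G : C ⟶ D} (α : F ≅ G),
        IsExtension (CategoryTheory.Cat.Hom.toNatIso α) (boxLetters C True) (boxLetters D True)
          (SymMonFunctor.monIso (P.map₂ α))) :=
  exists_twoFunctor
    (D := fun {C D : CategoryTheory.Cat.{v, u}} (F : C ⟶ D) (Q : SymBoxPlus C ⟶ SymBoxPlus D) =>
      IsBoxMap True F.toFunctor (SymMonFunctor.toMonFunctor Q))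
    (E := fun {C D : CategoryTheory.Cat.{v, u}} {F G : C ⟶ D} (α : F ≅ G)
        {Q R : SymBoxPlus C ⟶ SymBoxPlus D} (A : Q ≅ R) =>
      IsExtension (P := boxPresentation C True) (P' := boxPresentation D True)
        (CategoryTheory.Cat.Hom.toNatIso α)
        (boxLetters C True) (boxLetters D True) (SymMonFunctor.monIso A))
    -- The symmetric structures depend on a proof of `True` only, so the one provided by
    -- `PreservesBraiding` is the instance itself.
    (fun F => ⟨⟨_, ((boxMap_isBoxMap F.toFunctor).preservesBraiding trivial).2⟩,
      boxMap_isBoxMap F.toFunctor⟩)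
    (fun hQ hR => SymMonFunctor.ext_toMonFunctor (hQ.unique hR))
    (fun _ => .id)
    (fun hQ hR => hQ.comp hR)
    (fun hQ hR α =>
      let ⟨A, hA⟩ := hQ.exists_isExtension hR (CategoryTheory.Cat.Hom.toNatIso α)
      ⟨SymMonFunctor.isoMk A, hA⟩)
    (fun hA hB => SymMonFunctor.ext_monIso (isExtension_unique rfl hA hB))
    (fun hQ => .refl (boxLaws True) hQ.isExtension)
    (fun hA hB => .trans (boxLaws True) hA hB)
    (fun hQ hA => .whiskerLeft hQ.isExtension hA fun _ => rfl)
    (fun hQ hA => .whiskerRight hQ.isExtension hA fun _ => rfl)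

theorem exists_ncTwoFunctor :
    ∃ P : TwoFunctor (fun M : MonoidalCat.{v, u} => (NcPlus M).toMonoidalCat),
      (∀ {M N : MonoidalCat.{v, u}} (F : M ⟶ N),
        IsNcMap (ncPresentation M).Rel (ncPresentation N).Rel F (P.map F)) ∧
      (∀ {M N : MonoidalCat.{v, u}} {F G : M ⟶ N} (α : F ≅ G),
        IsExtension (MonFunctor.natIso α) (ncLetters M).toLetters (ncLetters N).toLetters
          (P.map₂ α)) :=
  exists_twoFunctor
    (D := fun {M N : MonoidalCat.{v, u}} (F : M ⟶ N)
      (Q : (NcPlus M).toMonoidalCat ⟶ (NcPlus N).toMonoidalCat) =>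
        IsNcMap (ncPresentation M).Rel (ncPresentation N).Rel F Q)
    (E := fun {M N : MonoidalCat.{v, u}} {F G : M ⟶ N} (α : F ≅ G)
        {Q R : (NcPlus M).toMonoidalCat ⟶ (NcPlus N).toMonoidalCat} (A : Q ≅ R) =>
      IsExtension (P := ncPresentation M) (P' := ncPresentation N) (Q := Q) (R := R)
        (MonFunctor.natIso α) (ncLetters M).toLetters (ncLetters N).toLetters A)
    (fun F => ⟨_, ncInterp_isNcMap (ncInterp_sound F)⟩)
    (fun hQ hR => IsNcMap.unique ncIsPlusRel ncIsPlusRel hQ hR)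
    (fun _ => .id ncIsPlusRel.laws)
    (fun hQ hR => IsWordMap.comp ncIsPlusRel.laws hQ hR)
    (fun hQ hR α => IsNcMap.exists_isExtension ncIsPlusRel ncIsPlusRel hQ hR α)
    (fun hA hB => isExtension_unique rfl hA hB)
    (fun hQ => .refl ncIsPlusRel.laws hQ.isExtension.toExtends)
    (fun hA hB => .trans ncIsPlusRel.laws hA hB)
    (fun hQ hA => .whiskerLeft hQ.isExtension.toExtends hA fun _ => rfl)
    (fun hQ hA => .whiskerRight hQ.isExtension.toExtends hA fun _ => rfl)

theorem exists_locTwoFunctor :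
    ∃ P : TwoFunctor (fun M : MonoidalCat.{v, u} => (LocPlus M).toMonoidalCat),
      (∀ {M N : MonoidalCat.{v, u}} (F : M ⟶ N),
        IsLocMap (locPresentation M).Rel (locPresentation N).Rel F (P.map F)) ∧
      (∀ {M N : MonoidalCat.{v, u}} {F G : M ⟶ N} (α : F ≅ G),
        IsExtension (MonFunctor.natIso α) (locLetters M).toLetters (locLetters N).toLetters
          (P.map₂ α)) :=
  exists_twoFunctor
    (D := fun {M N : MonoidalCat.{v, u}} (F : M ⟶ N)
      (Q : (LocPlus M).toMonoidalCat ⟶ (LocPlus N).toMonoidalCat) =>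
        IsLocMap (locPresentation M).Rel (locPresentation N).Rel F Q)
    (E := fun {M N : MonoidalCat.{v, u}} {F G : M ⟶ N} (α : F ≅ G)
        {Q R : (LocPlus M).toMonoidalCat ⟶ (LocPlus N).toMonoidalCat} (A : Q ≅ R) =>
      IsExtension (P := locPresentation M) (P' := locPresentation N) (Q := Q) (R := R)
        (MonFunctor.natIso α) (locLetters M).toLetters (locLetters N).toLetters A)
    (fun F => ⟨_, locInterp_isLocMap (locInterp_sound F)⟩)
    (fun hQ hR => IsLocMap.unique locIsPlusRel locPresentation_invRel locIsPlusRel hQ hR)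
    (fun _ => .id locIsPlusRel.laws)
    (fun hQ hR => IsWordMap.comp locIsPlusRel.laws hQ hR)
    (fun hQ hR α => IsLocMap.exists_isExtension locIsPlusRel locPresentation_invRel locIsPlusRel
      hQ hR α)
    (fun hA hB => isExtension_unique rfl hA hB)
    (fun hQ => .refl locIsPlusRel.laws hQ.isExtension.toExtends)
    (fun hA hB => .trans locIsPlusRel.laws hA hB)
    (fun hQ hA => .whiskerLeft hQ.isExtension.toExtends hA fun _ => rfl)
    (fun hQ hA => .whiskerRight hQ.isExtension.toExtends hA fun _ => rfl)

theorem exists_plusTwoFunctor :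
    ∃ P : TwoFunctor (fun M : MonoidalCat.{v, u} => Plus M),
      (∀ {M N : MonoidalCat.{v, u}} (F : M ⟶ N),
        IsPlusMap (plusPresentation M).Rel (plusPresentation N).Rel F (P.map F)) ∧
      (∀ {M N : MonoidalCat.{v, u}} {F G : M ⟶ N} (α : F ≅ G),
        IsExtension (MonFunctor.natIso α) (plusLetters M False).toLetters
          (plusLetters N False).toLetters (P.map₂ α)) :=
  exists_twoFunctor
    (D := fun {M N : MonoidalCat.{v, u}} (F : M ⟶ N) (Q : Plus M ⟶ Plus N) =>
        IsPlusMap (plusPresentation M).Rel (plusPresentation N).Rel F Q)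
    (E := fun {M N : MonoidalCat.{v, u}} {F G : M ⟶ N} (α : F ≅ G)
        {Q R : Plus M ⟶ Plus N} (A : Q ≅ R) =>
      IsExtension (P := plusPresentation M) (P' := plusPresentation N) (Q := Q) (R := R)
        (MonFunctor.natIso α) (plusLetters M False).toLetters (plusLetters N False).toLetters A)
    (fun F => ⟨_, plusInterp_isPlusMap (plusInterp_sound F)⟩)
    (fun hQ hR => IsPlusMap.unique plusIsArrowRel hQ hR)
    (fun _ => .id plusIsArrowRel)
    (fun hQ hR => IsPlusMap.comp plusIsArrowRel hQ hR)
    (fun hQ hR α => IsPlusMap.exists_isExtension plusIsArrowRel hQ hR α)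
    (fun hA hB => isExtension_unique_of_plus hA hB)
    (fun hQ => .refl plusIsArrowRel.laws hQ.isExtension.toExtends)
    (fun hA hB => .trans plusIsArrowRel.laws hA hB)
    (fun hQ hA => .whiskerLeft hQ.isExtension.toExtends hA fun _ => rfl)
    (fun hQ hA => .whiskerRight hQ.isExtension.toExtends hA fun _ => rfl)

theorem exists_symNcTwoFunctor :
    ∃ P : TwoFunctor (fun M : SymMonoidalCat.{v, u} => SymNcPlus M),
      (∀ {M N : SymMonoidalCat.{v, u}} (F : M ⟶ N),
        IsNcMap (symNcPresentation M).Rel (symNcPresentation N).Rel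
          (SymMonFunctor.toMonFunctor F) (SymMonFunctor.toMonFunctor (P.map F))) ∧
      (∀ {M N : SymMonoidalCat.{v, u}} {F G : M ⟶ N} (α : F ≅ G),
        IsExtension (MonFunctor.natIso (SymMonFunctor.monIso α)) (ncLetters M).toLetters
          (ncLetters N).toLetters (SymMonFunctor.monIso (P.map₂ α))) :=
  exists_twoFunctor
    (D := fun {M N : SymMonoidalCat.{v, u}} (F : M ⟶ N) (Q : SymNcPlus M ⟶ SymNcPlus N) =>
        IsNcMap (symNcPresentation M).Rel (symNcPresentation N).Rel
          (SymMonFunctor.toMonFunctor F) (SymMonFunctor.toMonFunctor Q))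
    (E := fun {M N : SymMonoidalCat.{v, u}} {F G : M ⟶ N} (α : F ≅ G)
        {Q R : SymNcPlus M ⟶ SymNcPlus N} (A : Q ≅ R) =>
      IsExtension (P := symNcPresentation M) (P' := symNcPresentation N)
        (MonFunctor.natIso (SymMonFunctor.monIso α)) (ncLetters M).toLetters
        (ncLetters N).toLetters (SymMonFunctor.monIso A))
    (fun F =>
      have h := ncInterp_isNcMap (symNcInterp_sound F.isSymmetric)
      ⟨⟨_, (h.preservesBraiding trivial).2⟩, h⟩)
    (fun hQ hR => SymMonFunctor.ext_toMonFunctor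
      (IsNcMap.unique symNcIsPlusRel symNcIsPlusRel hQ hR))
    (fun _ => .id symNcIsPlusRel.laws)
    (fun hQ hR => IsWordMap.comp symNcIsPlusRel.laws hQ hR)
    (fun hQ hR α =>
      let ⟨A, hA⟩ := IsNcMap.exists_isExtension symNcIsPlusRel symNcIsPlusRel hQ hR
        (SymMonFunctor.monIso α)
      ⟨SymMonFunctor.isoMk A, hA⟩)
    (fun hA hB => SymMonFunctor.ext_monIso (isExtension_unique rfl hA hB))
    (fun hQ => .refl symNcIsPlusRel.laws hQ.isExtension.toExtends)
    (fun hA hB => .trans symNcIsPlusRel.laws hA hB)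
    (fun hQ hA => .whiskerLeft hQ.isExtension.toExtends hA fun _ => rfl)
    (fun hQ hA => .whiskerRight hQ.isExtension.toExtends hA fun _ => rfl)

theorem exists_symLocTwoFunctor :
    ∃ P : TwoFunctor (fun M : SymMonoidalCat.{v, u} => SymLocPlus M),
      (∀ {M N : SymMonoidalCat.{v, u}} (F : M ⟶ N),
        IsLocMap (symLocPresentation M).Rel (symLocPresentation N).Rel
          (SymMonFunctor.toMonFunctor F) (SymMonFunctor.toMonFunctor (P.map F))) ∧
      (∀ {M N : SymMonoidalCat.{v, u}} {F G : M ⟶ N} (α : F ≅ G),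
        IsExtension (MonFunctor.natIso (SymMonFunctor.monIso α)) (locLetters M).toLetters
          (locLetters N).toLetters (SymMonFunctor.monIso (P.map₂ α))) :=
  exists_twoFunctor
    (D := fun {M N : SymMonoidalCat.{v, u}} (F : M ⟶ N) (Q : SymLocPlus M ⟶ SymLocPlus N) =>
        IsLocMap (symLocPresentation M).Rel (symLocPresentation N).Rel
          (SymMonFunctor.toMonFunctor F) (SymMonFunctor.toMonFunctor Q))
    (E := fun {M N : SymMonoidalCat.{v, u}} {F G : M ⟶ N} (α : F ≅ G)
        {Q R : SymLocPlus M ⟶ SymLocPlus N} (A : Q ≅ R) =>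
      IsExtension (P := symLocPresentation M) (P' := symLocPresentation N)
        (MonFunctor.natIso (SymMonFunctor.monIso α)) (locLetters M).toLetters
        (locLetters N).toLetters (SymMonFunctor.monIso A))
    (fun F =>
      have h := locInterp_isLocMap (symLocInterp_sound F.isSymmetric)
      ⟨⟨_, (h.preservesBraiding trivial).2⟩, h⟩)
    (fun hQ hR => SymMonFunctor.ext_toMonFunctor
      (IsLocMap.unique symLocIsPlusRel symLocPresentation_invRel symLocIsPlusRel hQ hR))
    (fun _ => .id symLocIsPlusRel.laws)
    (fun hQ hR => IsWordMap.comp symLocIsPlusRel.laws hQ hR)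
    (fun hQ hR α =>
      let ⟨A, hA⟩ := IsLocMap.exists_isExtension symLocIsPlusRel symLocPresentation_invRel
        symLocIsPlusRel hQ hR (SymMonFunctor.monIso α)
      ⟨SymMonFunctor.isoMk A, hA⟩)
    (fun hA hB => SymMonFunctor.ext_monIso (isExtension_unique rfl hA hB))
    (fun hQ => .refl symLocIsPlusRel.laws hQ.isExtension.toExtends)
    (fun hA hB => .trans symLocIsPlusRel.laws hA hB)
    (fun hQ hA => .whiskerLeft hQ.isExtension.toExtends hA fun _ => rfl)
    (fun hQ hA => .whiskerRight hQ.isExtension.toExtends hA fun _ => rfl)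

theorem exists_symPlusTwoFunctor (inter : Prop) :
    ∃ P : TwoFunctor (fun M : SymMonoidalCat.{v, u} => SymPlus inter M),
      (∀ {M N : SymMonoidalCat.{v, u}} (F : M ⟶ N),
        IsPlusMap (symPlusPresentation M inter).Rel (symPlusPresentation N inter).Rel
          (SymMonFunctor.toMonFunctor F) (SymMonFunctor.toMonFunctor (P.map F))) ∧
      (∀ {M N : SymMonoidalCat.{v, u}} {F G : M ⟶ N} (α : F ≅ G),
        IsExtension (MonFunctor.natIso (SymMonFunctor.monIso α)) (plusLetters M True).toLetters
          (plusLetters N True).toLetters (SymMonFunctor.monIso (P.map₂ α))) :=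
  exists_twoFunctor
    (D := fun {M N : SymMonoidalCat.{v, u}} (F : M ⟶ N) (Q : SymPlus inter M ⟶ SymPlus inter N) =>
        IsPlusMap (symPlusPresentation M inter).Rel (symPlusPresentation N inter).Rel
          (SymMonFunctor.toMonFunctor F) (SymMonFunctor.toMonFunctor Q))
    (E := fun {M N : SymMonoidalCat.{v, u}} {F G : M ⟶ N} (α : F ≅ G)
        {Q R : SymPlus inter M ⟶ SymPlus inter N} (A : Q ≅ R) =>
      IsExtension (P := symPlusPresentation M inter) (P' := symPlusPresentation N inter)
        (MonFunctor.natIso (SymMonFunctor.monIso α)) (plusLetters M True).toLetters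
        (plusLetters N True).toLetters (SymMonFunctor.monIso A))
    (fun F =>
      have h := plusInterp_isPlusMap (symPlusInterp_sound inter F.isSymmetric)
      ⟨⟨_, (h.preservesBraiding trivial).2⟩, h⟩)
    (fun hQ hR => SymMonFunctor.ext_toMonFunctor
      (IsPlusMap.unique (symPlusIsArrowRel inter) hQ hR))
    (fun _ => .id (symPlusIsArrowRel inter))
    (fun hQ hR => IsPlusMap.comp (symPlusIsArrowRel inter) hQ hR)
    (fun hQ hR α =>
      let ⟨A, hA⟩ := IsPlusMap.exists_isExtension (symPlusIsArrowRel inter) hQ hR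
        (SymMonFunctor.monIso α)
      ⟨SymMonFunctor.isoMk A, hA⟩)
    (fun hA hB => SymMonFunctor.ext_monIso (isExtension_unique_of_plus hA hB))
    (fun hQ => .refl (symPlusIsArrowRel inter).laws hQ.isExtension.toExtends)
    (fun hA hB => .trans (symPlusIsArrowRel inter).laws hA hB)
    (fun hQ hA => .whiskerLeft hQ.isExtension.toExtends hA fun _ => rfl)
    (fun hQ hA => .whiskerRight hQ.isExtension.toExtends hA fun _ => rfl)

end PlusConstruction

namespace PlusConstruction

/-! ### Equivalences -/

section Monoidal

variable {M : Type u₁} [Category.{v₁} M] [MonoidalCategory M] {N : Type u₂} [Category.{v₂} N]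
  [MonoidalCategory N]

/-- `F.comp G` and the identity each have a functor of plus constructions with the defining
properties, and `α` extends to an isomorphism between these. The extension lemmas are used instead
of the 2-functor because `M` and `N` may lie in different universes. -/
theorem ncPlus_equivalent (h : MonEquivalent M N) :
    SymMonEquivalent (ncPresentation M).Cat (ncPresentation N).Cat := by
  obtain ⟨F, G, ⟨α⟩, ⟨β⟩⟩ := h
  have hF := ncInterp_isNcMap (ncInterp_sound F)
  have hG := ncInterp_isNcMap (ncInterp_sound G)
  obtain ⟨A, -⟩ := IsNcMap.exists_isExtension ncIsPlusRel ncIsPlusRel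
    (IsWordMap.comp ncIsPlusRel.laws hF hG) (.id ncIsPlusRel.laws) α
  obtain ⟨B, -⟩ := IsNcMap.exists_isExtension ncIsPlusRel ncIsPlusRel
    (IsWordMap.comp ncIsPlusRel.laws hG hF) (.id ncIsPlusRel.laws) β
  exact ⟨_, _, (hF.preservesBraiding trivial).2, (hG.preservesBraiding trivial).2, ⟨A⟩, ⟨B⟩⟩

theorem locPlus_equivalent (h : MonEquivalent M N) :
    SymMonEquivalent (locPresentation M).Cat (locPresentation N).Cat := by
  obtain ⟨F, G, ⟨α⟩, ⟨β⟩⟩ := h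
  have hF := locInterp_isLocMap (locInterp_sound F)
  have hG := locInterp_isLocMap (locInterp_sound G)
  obtain ⟨A, -⟩ := IsLocMap.exists_isExtension locIsPlusRel locPresentation_invRel locIsPlusRel
    (IsWordMap.comp locIsPlusRel.laws hF hG) (.id locIsPlusRel.laws) α
  obtain ⟨B, -⟩ := IsLocMap.exists_isExtension locIsPlusRel locPresentation_invRel locIsPlusRel
    (IsWordMap.comp locIsPlusRel.laws hG hF) (.id locIsPlusRel.laws) β
  exact ⟨_, _, (hF.preservesBraiding trivial).2, (hG.preservesBraiding trivial).2, ⟨A⟩, ⟨B⟩⟩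

theorem plus_equivalent (h : MonEquivalent M N) :
    MonEquivalent (plusPresentation M).Cat (plusPresentation N).Cat := by
  obtain ⟨F, G, ⟨α⟩, ⟨β⟩⟩ := h
  have hF := plusInterp_isPlusMap (plusInterp_sound F)
  have hG := plusInterp_isPlusMap (plusInterp_sound G)
  obtain ⟨A, -⟩ := IsPlusMap.exists_isExtension plusIsArrowRel
    (IsPlusMap.comp plusIsArrowRel hF hG) (.id plusIsArrowRel) α
  obtain ⟨B, -⟩ := IsPlusMap.exists_isExtension plusIsArrowRel
    (IsPlusMap.comp plusIsArrowRel hG hF) (.id plusIsArrowRel) β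
  exact ⟨_, _, ⟨A⟩, ⟨B⟩⟩

variable [SymmetricCategory M] [SymmetricCategory N]

theorem symNcPlus_equivalent (h : SymMonEquivalent M N) :
    SymMonEquivalent (symNcPresentation M).Cat (symNcPresentation N).Cat := by
  obtain ⟨F, G, sF, sG, ⟨α⟩, ⟨β⟩⟩ := h
  have hF := ncInterp_isNcMap (symNcInterp_sound sF)
  have hG := ncInterp_isNcMap (symNcInterp_sound sG)
  obtain ⟨A, -⟩ := IsNcMap.exists_isExtension symNcIsPlusRel symNcIsPlusRel
    (IsWordMap.comp symNcIsPlusRel.laws hF hG) (.id symNcIsPlusRel.laws) α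
  obtain ⟨B, -⟩ := IsNcMap.exists_isExtension symNcIsPlusRel symNcIsPlusRel
    (IsWordMap.comp symNcIsPlusRel.laws hG hF) (.id symNcIsPlusRel.laws) β
  exact ⟨_, _, (hF.preservesBraiding trivial).2, (hG.preservesBraiding trivial).2, ⟨A⟩, ⟨B⟩⟩

theorem symLocPlus_equivalent (h : SymMonEquivalent M N) :
    SymMonEquivalent (symLocPresentation M).Cat (symLocPresentation N).Cat := by
  obtain ⟨F, G, sF, sG, ⟨α⟩, ⟨β⟩⟩ := h
  have hF := locInterp_isLocMap (symLocInterp_sound sF)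
  have hG := locInterp_isLocMap (symLocInterp_sound sG)
  obtain ⟨A, -⟩ := IsLocMap.exists_isExtension symLocIsPlusRel symLocPresentation_invRel
    symLocIsPlusRel (IsWordMap.comp symLocIsPlusRel.laws hF hG) (.id symLocIsPlusRel.laws) α
  obtain ⟨B, -⟩ := IsLocMap.exists_isExtension symLocIsPlusRel symLocPresentation_invRel
    symLocIsPlusRel (IsWordMap.comp symLocIsPlusRel.laws hG hF) (.id symLocIsPlusRel.laws) β
  exact ⟨_, _, (hF.preservesBraiding trivial).2, (hG.preservesBraiding trivial).2, ⟨A⟩, ⟨B⟩⟩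

theorem symPlus_equivalent (inter : Prop) (h : SymMonEquivalent M N) :
    SymMonEquivalent (symPlusPresentation M inter).Cat (symPlusPresentation N inter).Cat := by
  obtain ⟨F, G, sF, sG, ⟨α⟩, ⟨β⟩⟩ := h
  have hF := plusInterp_isPlusMap (symPlusInterp_sound inter sF)
  have hG := plusInterp_isPlusMap (symPlusInterp_sound inter sG)
  obtain ⟨A, -⟩ := IsPlusMap.exists_isExtension (symPlusIsArrowRel inter)
    (IsPlusMap.comp (symPlusIsArrowRel inter) hF hG) (.id (symPlusIsArrowRel inter)) α
  obtain ⟨B, -⟩ := IsPlusMap.exists_isExtension (symPlusIsArrowRel inter)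
    (IsPlusMap.comp (symPlusIsArrowRel inter) hG hF) (.id (symPlusIsArrowRel inter)) β
  exact ⟨_, _, (hF.preservesBraiding trivial).2, (hG.preservesBraiding trivial).2, ⟨A⟩, ⟨B⟩⟩

end Monoidal

/-! ### Equivalent categories -/

section Box

variable {C : Type u₁} [Category.{v₁} C] {D : Type u₂} [Category.{v₂} D]

theorem boxMap_comp_isoId (symm : Prop) {F : C ⥤ D} {G : D ⥤ C} (α : F ⋙ G ≅ 𝟭 C) :
    Nonempty ((boxMap symm F).comp (boxMap symm G) ≅ MonFunctor.id (boxPresentation C symm).Cat) :=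
  let ⟨A, _⟩ := ((boxMap_isBoxMap F).comp (boxMap_isBoxMap G)).exists_isExtension .id α
  ⟨A⟩

theorem boxPlus_equivalent (e : C ≌ D) :
    MonEquivalent (boxPresentation C False).Cat (boxPresentation D False).Cat :=
  ⟨_, _, boxMap_comp_isoId False e.unitIso.symm, boxMap_comp_isoId False e.counitIso⟩

theorem symBoxPlus_equivalent (e : C ≌ D) :
    SymMonEquivalent (boxPresentation C True).Cat (boxPresentation D True).Cat :=
  ⟨_, _, (boxMap_preservesBraiding True e.functor trivial).2,
    (boxMap_preservesBraiding True e.inverse trivial).2, boxMap_comp_isoId True e.unitIso.symm,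
    boxMap_comp_isoId True e.counitIso⟩

end Box

end PlusConstruction

/-! ### The theorem -/

theorem theorem5p4 :
    -- The plus construction of categories is functorial.
    (∃ P : TwoFunctor (fun C : CategoryTheory.Cat.{v, u} => BoxPlus C),
      (∀ {C D : CategoryTheory.Cat.{v, u}} (F : C ⟶ D), MonFunctor.IsStrict (P.map F) ∧
        Extends F.toFunctor (boxLetters C False) (boxLetters D False) (P.map F)) ∧
      (∀ {C D : CategoryTheory.Cat.{v, u}} {F G : C ⟶ D} (α : F ≅ G),
        IsExtension (CategoryTheory.Cat.Hom.toNatIso α) (boxLetters C False) (boxLetters D False)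
          (P.map₂ α))) ∧
    (∃ P : TwoFunctor (fun C : CategoryTheory.Cat.{v, u} => SymBoxPlus C),
      (∀ {C D : CategoryTheory.Cat.{v, u}} (F : C ⟶ D),
        MonFunctor.IsStrict (SymMonFunctor.toMonFunctor (P.map F)) ∧
        Extends F.toFunctor (boxLetters C True) (boxLetters D True)
          (SymMonFunctor.toMonFunctor (P.map F))) ∧
      (∀ {C D : CategoryTheory.Cat.{v, u}} {F G : C ⟶ D} (α : F ≅ G),
        IsExtension (CategoryTheory.Cat.Hom.toNatIso α) (boxLetters C True) (boxLetters D True)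
          (SymMonFunctor.monIso (P.map₂ α)))) ∧
    -- The plus constructions of monoidal categories are functorial.
    (∃ P : TwoFunctor (fun M : MonoidalCat.{v, u} => (NcPlus M).toMonoidalCat),
      (∀ {M N : MonoidalCat.{v, u}} (F : M ⟶ N), MonFunctor.IsStrict (P.map F) ∧
        MonFunctor.IsSymmetric (C := NcPlus M) (D := NcPlus N) (P.map F) ∧
        ExtendsMul F (ncLetters M) (ncLetters N) (P.map F)) ∧
      (∀ {M N : MonoidalCat.{v, u}} {F G : M ⟶ N} (α : F ≅ G),
        IsExtension (MonFunctor.natIso α) (ncLetters M).toLetters (ncLetters N).toLetters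
          (P.map₂ α))) ∧
    (∃ P : TwoFunctor (fun M : MonoidalCat.{v, u} => (LocPlus M).toMonoidalCat),
      (∀ {M N : MonoidalCat.{v, u}} (F : M ⟶ N), MonFunctor.IsStrict (P.map F) ∧
        MonFunctor.IsSymmetric (C := LocPlus M) (D := LocPlus N) (P.map F) ∧
        ExtendsMul F (locLetters M) (locLetters N) (P.map F)) ∧
      (∀ {M N : MonoidalCat.{v, u}} {F G : M ⟶ N} (α : F ≅ G),
        IsExtension (MonFunctor.natIso α) (locLetters M).toLetters (locLetters N).toLetters
          (P.map₂ α))) ∧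
    (∃ P : TwoFunctor (fun M : MonoidalCat.{v, u} => Plus M),
      (∀ {M N : MonoidalCat.{v, u}} (F : M ⟶ N),
        ExtendsMul F (plusLetters M False) (plusLetters N False) (P.map F)) ∧
      (∀ {M N : MonoidalCat.{v, u}} {F G : M ⟶ N} (α : F ≅ G),
        IsExtension (MonFunctor.natIso α) (plusLetters M False).toLetters
          (plusLetters N False).toLetters (P.map₂ α))) ∧
    -- The plus constructions of symmetric monoidal categories are functorial.
    (∃ P : TwoFunctor (fun M : SymMonoidalCat.{v, u} => SymNcPlus M),
      (∀ {M N : SymMonoidalCat.{v, u}} (F : M ⟶ N),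
        MonFunctor.IsStrict (SymMonFunctor.toMonFunctor (P.map F)) ∧
        ExtendsMul (SymMonFunctor.toMonFunctor F) (ncLetters M) (ncLetters N)
          (SymMonFunctor.toMonFunctor (P.map F))) ∧
      (∀ {M N : SymMonoidalCat.{v, u}} {F G : M ⟶ N} (α : F ≅ G),
        IsExtension (MonFunctor.natIso (SymMonFunctor.monIso α)) (ncLetters M).toLetters
          (ncLetters N).toLetters (SymMonFunctor.monIso (P.map₂ α)))) ∧
    (∃ P : TwoFunctor (fun M : SymMonoidalCat.{v, u} => SymLocPlus M),
      (∀ {M N : SymMonoidalCat.{v, u}} (F : M ⟶ N),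
        MonFunctor.IsStrict (SymMonFunctor.toMonFunctor (P.map F)) ∧
        ExtendsMul (SymMonFunctor.toMonFunctor F) (locLetters M) (locLetters N)
          (SymMonFunctor.toMonFunctor (P.map F))) ∧
      (∀ {M N : SymMonoidalCat.{v, u}} {F G : M ⟶ N} (α : F ≅ G),
        IsExtension (MonFunctor.natIso (SymMonFunctor.monIso α)) (locLetters M).toLetters
          (locLetters N).toLetters (SymMonFunctor.monIso (P.map₂ α)))) ∧
    (∀ inter : Prop, ∃ P : TwoFunctor (fun M : SymMonoidalCat.{v, u} => SymPlus inter M),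
      (∀ {M N : SymMonoidalCat.{v, u}} (F : M ⟶ N),
        ExtendsMul (SymMonFunctor.toMonFunctor F) (plusLetters M True) (plusLetters N True)
          (SymMonFunctor.toMonFunctor (P.map F))) ∧
      (∀ {M N : SymMonoidalCat.{v, u}} {F G : M ⟶ N} (α : F ≅ G),
        IsExtension (MonFunctor.natIso (SymMonFunctor.monIso α)) (plusLetters M True).toLetters
          (plusLetters N True).toLetters (SymMonFunctor.monIso (P.map₂ α)))) ∧
    -- Equivalent monoidal categories have equivalent plus constructions.
    (∀ (M : MonoidalCat.{v₁, u₁}) (M' : MonoidalCat.{v₂, u₂}), MonEquivalent M M' →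
      SymMonEquivalent (NcPlus M) (NcPlus M') ∧ SymMonEquivalent (LocPlus M) (LocPlus M') ∧
        MonEquivalent (Plus M) (Plus M')) ∧
    (∀ (M : SymMonoidalCat.{v₁, u₁}) (M' : SymMonoidalCat.{v₂, u₂}), SymMonEquivalent M M' →
      SymMonEquivalent (SymNcPlus M) (SymNcPlus M') ∧
        SymMonEquivalent (SymLocPlus M) (SymLocPlus M') ∧
        ∀ inter : Prop, SymMonEquivalent (SymPlus inter M) (SymPlus inter M')) ∧
    -- Equivalent categories have equivalent plus constructions.
    (∀ (C : CategoryTheory.Cat.{v₁, u₁}) (C' : CategoryTheory.Cat.{v₂, u₂}), Nonempty (C ≌ C') →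
      MonEquivalent (BoxPlus C) (BoxPlus C') ∧
        SymMonEquivalent (SymBoxPlus C) (SymBoxPlus C')) := by
  refine ⟨?_, ?_, ?_, ?_, ?_, ?_, ?_, fun inter => ?_, fun M M' h => ?_, fun M M' h => ?_,
    fun C C' ⟨e⟩ => ?_⟩
  · obtain ⟨P, h₁, h₂⟩ := exists_boxTwoFunctor.{v, u}
    exact ⟨P, fun F => ⟨(h₁ F).isStrict, (h₁ F).isExtension⟩, h₂⟩
  · obtain ⟨P, h₁, h₂⟩ := exists_symBoxTwoFunctor.{v, u}
    exact ⟨P, fun F => ⟨(h₁ F).isStrict, (h₁ F).isExtension⟩, h₂⟩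
  · obtain ⟨P, h₁, h₂⟩ := exists_ncTwoFunctor.{v, u}
    exact ⟨P, fun F => ⟨(h₁ F).isStrict, ((h₁ F).preservesBraiding trivial).2,
      (h₁ F).isExtension⟩, h₂⟩
  · obtain ⟨P, h₁, h₂⟩ := exists_locTwoFunctor.{v, u}
    exact ⟨P, fun F => ⟨(h₁ F).isStrict, ((h₁ F).preservesBraiding trivial).2,
      (h₁ F).isExtension⟩, h₂⟩
  · obtain ⟨P, h₁, h₂⟩ := exists_plusTwoFunctor.{v, u}
    exact ⟨P, fun F => (h₁ F).isExtension, h₂⟩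
  · obtain ⟨P, h₁, h₂⟩ := exists_symNcTwoFunctor.{v, u}
    exact ⟨P, fun F => ⟨(h₁ F).isStrict, (h₁ F).isExtension⟩, h₂⟩
  · obtain ⟨P, h₁, h₂⟩ := exists_symLocTwoFunctor.{v, u}
    exact ⟨P, fun F => ⟨(h₁ F).isStrict, (h₁ F).isExtension⟩, h₂⟩
  · obtain ⟨P, h₁, h₂⟩ := exists_symPlusTwoFunctor.{v, u} inter
    exact ⟨P, fun F => (h₁ F).isExtension, h₂⟩
  · exact ⟨ncPlus_equivalent h, locPlus_equivalent h, plus_equivalent h⟩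
  · exact ⟨symNcPlus_equivalent h, symLocPlus_equivalent h, fun inter => symPlus_equivalent inter h⟩
  · exact ⟨boxPlus_equivalent e, symBoxPlus_equivalent e⟩
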